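/- Let $P$ be a convex polyhedron in hyperbolic $3$-space $\mathbb{H}^3$, infinite vertices (vertices on the sphere at infinity) being admitted. Here a non-degenerate convex polyhedron is the convex hull, with non-empty interior, of finitely many points of $\mathbb{H}^3\cup\partial\mathbb{H}^3$, with its usual vertices, edges and facets. Degenerate convex polyhedra are also allowed: limiting positions, with pairwise distinct vertices, of non-degenerate convex polyhedra with the same vertex–facet incidences (vertices, edges and facets being understood combinatorially), and doubly counted convex polygons (two facets, both equal to the same convex polygon). Suppose that the $m$ facets of $P$ are a $k_1$-gon, $\ldots$, $k_m$-gon, and have respective hyperbolic areas $S_1,\ldots,S_m>0$. Then for every $i\in\{1,\ldots,m\}$ we have $$ (k_i-2)\pi - S_i \;\le\; \sum_{\substack{1\le j\le m\\ j\ne i}} \bigl((k_j-2)\pi - S_j\bigr). $$ If moreover $P$ has a finite vertex (a vertex in $\mathbb{H}^3$) whose incident edges do not all lie in one plane, then this inequality is strict for every $i$. -/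

import Mathlib

/-!
Hyperbolic 3-space is the open unit ball of Euclidean 3-space with the projective (Beltrami–Klein,
"collinear") model metric.  Hyperbolic planes and segments are the intersections of Euclidean
planes and segments with the open ball; the points of the unit sphere are the points at infinity.
-/

/-- The Euclidean 3-space containing the projective model. -/
abbrev Space3 : Type := EuclideanSpace ℝ (Fin 3)

/-- The Riemannian metric of curvature `-1` of the projective model at the point `x`, `‖x‖ < 1`. -/
noncomputable def kleinMetric (x u w : Space3) : ℝ :=
  inner ℝ u w / (1 - ‖x‖ ^ 2) + inner ℝ x u * inner ℝ x w / (1 - ‖x‖ ^ 2) ^ 2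

/-- The affine parametrization `(s, t) ↦ a + s e₁ + t e₂` of a plane. -/
noncomputable def planeChart (a e₁ e₂ : Space3) (z : ℝ × ℝ) : Space3 :=
  a + z.1 • e₁ + z.2 • e₂

/-- The area element of a plane with tangent vectors `e₁`, `e₂` at the point `x`: the square root
of the Gram determinant of `e₁`, `e₂` in the hyperbolic metric. -/
noncomputable def areaDensity (x e₁ e₂ : Space3) : ℝ :=
  Real.sqrt (kleinMetric x e₁ e₁ * kleinMetric x e₂ e₂ - kleinMetric x e₁ e₂ ^ 2)

/-- `HasHypArea X A`: the set `X` lies in a plane and the hyperbolic area of the part of `X` in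
hyperbolic space is the real number `A`.  By the change of variables formula the integral does
not depend on the chosen affine chart of the plane. -/
def HasHypArea (X : Set Space3) (A : ℝ) : Prop :=
  0 ≤ A ∧ ∃ a e₁ e₂ : Space3, LinearIndependent ℝ ![e₁, e₂] ∧ X ⊆ Set.range (planeChart a e₁ e₂) ∧
    ∫⁻ z in planeChart a e₁ e₂ ⁻¹' (X ∩ Metric.ball 0 1),
      ENNReal.ofReal (areaDensity (planeChart a e₁ e₂ z) e₁ e₂) = ENNReal.ofReal A

/-- The polygon spanned by the vertices `p v`, `v ∈ A`. -/
def polygonOf {n : ℕ} (p : Fin n → Space3) (A : Finset (Fin n)) : Set Space3 :=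
  convexHull ℝ (p '' (A : Set (Fin n)))

/-- `A` is the vertex set of a two-dimensional face of the convex hull of the points `p v`: the
set of those `v` for which `p v` lies on some supporting plane, and these points are not
collinear. -/
def IsFacetVertexSet {n : ℕ} (p : Fin n → Space3) (A : Finset (Fin n)) : Prop :=
  (∃ (u : Space3) (c : ℝ), (∀ v, inner ℝ u (p v) ≤ c) ∧ ∀ v, v ∈ A ↔ inner ℝ u (p v) = c) ∧
    Module.finrank ℝ (vectorSpan ℝ (p '' (A : Set (Fin n)))) = 2

/-- A non-degenerate convex polyhedron of hyperbolic 3-space, with infinite vertices admitted: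
the `p v` are its vertices (in the closed ball, infinite if on the unit sphere), and `F` lists
the vertex sets of its facets, each facet once. -/
structure IsNondegPolyhedron {n m : ℕ} (p : Fin n → Space3) (F : Fin m → Finset (Fin n)) :
    Prop where
  norm_le_one : ∀ v, ‖p v‖ ≤ 1
  convexIndependent : ConvexIndependent ℝ p
  interior_nonempty : (interior (convexHull ℝ (Set.range p))).Nonempty
  facets_injective : Function.Injective F
  facets : ∀ A, IsFacetVertexSet p A ↔ ∃ j, F j = A

/-- A doubly counted convex polygon: a degenerate convex polyhedron with two facets, both equal
to the convex polygon with vertices `p v`. -/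
structure IsDoublePolygon {n m : ℕ} (p : Fin n → Space3) (F : Fin m → Finset (Fin n)) :
    Prop where
  norm_le_one : ∀ v, ‖p v‖ ≤ 1
  convexIndependent : ConvexIndependent ℝ p
  planar : Module.finrank ℝ (vectorSpan ℝ (Set.range p)) = 2
  card_facets : m = 2
  facets : ∀ j, F j = Finset.univ

/-- A convex polyhedron of hyperbolic 3-space, possibly degenerate, with infinite vertices
admitted: a position with distinct vertices that is a limit of non-degenerate convex polyhedra
with the same vertex-facet incidences (in particular any non-degenerate convex polyhedron), or a
doubly counted convex polygon. -/
def IsConvexPolyhedron {n m : ℕ} (p : Fin n → Space3) (F : Fin m → Finset (Fin n)) : Prop :=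
  (Function.Injective p ∧ ∃ q : ℕ → Fin n → Space3, (∀ t, IsNondegPolyhedron (q t) F) ∧
    ∀ v, Filter.Tendsto (fun t => q t v) Filter.atTop (nhds (p v))) ∨
  IsDoublePolygon p F

/-- `v` and `w` are the two ends of an edge: two different facets share exactly these two
vertices. -/
def IsEdge {n m : ℕ} (F : Fin m → Finset (Fin n)) (v w : Fin n) : Prop :=
  v ≠ w ∧ ∃ i j, i ≠ j ∧ F i ∩ F j = {v, w}

theorem IsNondegPolyhedron.isConvexPolyhedron {n m : ℕ} {p : Fin n → Space3}
    {F : Fin m → Finset (Fin n)} (h : IsNondegPolyhedron p F) : IsConvexPolyhedron p F :=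
  Or.inl ⟨h.convexIndependent.injective, fun _ => p, fun _ => h, fun _ => tendsto_const_nhds⟩

/-! By Gauss-Bonnet, `(k - 2) π - S` is the sum of the interior angles of a facet, an infinite
vertex counting as zero. The inequality therefore compares angle sums, and it suffices to compare
them vertex by vertex. At an infinite vertex all angles vanish. At a finite vertex the facets cut a
closed polygon out of the sphere of directions, whose sides are the face angles, and one side is at
most the sum of the others. If equality holds with positive sides, the other sides form a geodesic
from one end of the chosen side to the other, which puts all edge directions in one plane.

Degenerate positions enter as limits. The combinatorial facts (a vertex of a facet lies on two of
its edges, an edge lies on two facets) are proved for a non-degenerate polyhedron and then read off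
from `F` alone, so they hold for the limit too: `card_edges_of_mem_facet`, `card_facets_of_isEdge`.
Metrically, a facet of the limit is only a limit of strictly convex polygons and may have straight
angles. `IsWeakPolygon` records what survives, and `IsWeakPolygon.of_tendsto` supplies it.

`IsWeakPolygon.gauss_bonnet` cones the polygon off from its barycentre `o`. Let `D` be the disk of
area `2 π` about `o`; a sector of `D` has area equal to its angle. A triangle with apex angle `γ`
and base angles `α`, `β` has area `π - α - β - γ`, so together with its sector it has area `π - α -
β`, and the apex angle never has to be computed (`planeArea_triangle_add_sector`). Summing over all
wedges at `o` gives `S + 2 π = k π - ∑ angles`.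

The spherical inequality is `IsNondegPolyhedron.vertex_inequality`. It needs no cyclic order of the
facets: modulo two, the facets other than the chosen one have the same boundary as that one, and
`chain_length` bounds the length of such a chain by the triangle inequality for angles. -/

open Filter Topology MeasureTheory

/-! ### Incidences of vertices, edges and facets. -/

/-- In convex position, three different points are affinely independent. -/
theorem ConvexIndependent.pair_eq_zero {n : ℕ} {q : Fin n → Space3} (hq : ConvexIndependent ℝ q)
    {v w x : Fin n} (hvw : v ≠ w) (hvx : v ≠ x) (hwx : w ≠ x) {a b : ℝ}
    (h : a • (q w - q v) + b • (q x - q v) = 0) : a = 0 ∧ b = 0 := by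
  have key : ¬ Collinear ℝ {q v, q w, q x} := by
    intro hc
    have aux : ∀ a b c : Fin n, a ≠ b → c ≠ b → ¬ Wbtw ℝ (q a) (q b) (q c) := by
      intro a b c hab hcb hw
      have h1 : q b ∈ convexHull ℝ (q '' {a, c}) := by
        rw [Set.image_pair, convexHull_pair]
        exact mem_segment_iff_wbtw.2 hw
      rw [hq.mem_convexHull_iff] at h1
      rcases h1 with h1 | h1
      · exact hab h1.symm
      · exact hcb h1.symm
    rcases hc.wbtw_or_wbtw_or_wbtw with h1 | h1 | h1
    · exact aux _ _ _ hvw hwx.symm h1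
    · exact aux _ _ _ hwx hvx h1
    · exact aux _ _ _ hvx.symm hvw.symm h1
  have hinj := hq.injective
  have hw : q w - q v ≠ 0 := sub_ne_zero.2 fun e => hvw (hinj e).symm
  have hb : b = 0 := by
    by_contra hb
    apply key
    rw [collinear_iff_of_mem (p₀ := q v) (by simp)]
    refine ⟨q w - q v, ?_⟩
    have hx : q x = (-(a / b)) • (q w - q v) +ᵥ q v := by
      have : q x - q v = (-(a / b)) • (q w - q v) := by
        have h2 : b • (q x - q v) = -(a • (q w - q v)) := by
          rw [add_comm] at h; exact eq_neg_of_add_eq_zero_left h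
        rw [← inv_smul_smul₀ hb (q x - q v), h2, smul_neg, smul_smul, neg_smul]
        congr 2; field_simp
      rw [← this]; simp
    intro p hp
    rcases hp with rfl | rfl | rfl
    · exact ⟨0, by simp⟩
    · exact ⟨1, by simp⟩
    · exact ⟨_, hx⟩
  subst hb
  refine ⟨?_, rfl⟩
  simpa [hw] using h

/-- `{v, w}` is an edge of the planar face with vertex set `A`. -/
def FaceEdge {n : ℕ} (q : Fin n → Space3) (A : Finset (Fin n)) (v w : Fin n) : Prop :=
  v ≠ w ∧ v ∈ A ∧ w ∈ A ∧ ∃ f : Space3 →ₗ[ℝ] ℝ, (∀ x ∈ A, f (q x - q v) ≤ 0) ∧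
    ∀ x ∈ A, f (q x - q v) = 0 ↔ x = v ∨ x = w

theorem Submodule.exists_coords_of_finrank_two {W : Submodule ℝ Space3}
    (hW : Module.finrank ℝ W = 2) {g h : Space3} (hg : g ∈ W) (hh : h ∈ W)
    (hgh : ∀ a b : ℝ, a • g + b • h = 0 → a = 0 ∧ b = 0) {x : Space3} (hx : x ∈ W) :
    ∃ a b : ℝ, a • g + b • h = x := by
  have hli : LinearIndependent ℝ ![g, h] := LinearIndependent.pair_iff.2 hgh
  have hle : Submodule.span ℝ {g, h} ≤ W := by
    rw [Submodule.span_le]; rintro y (rfl | rfl) <;> assumption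
  have hfin : Module.finrank ℝ (Submodule.span ℝ ({g, h} : Set Space3)) = 2 := by
    have e : Set.range ![g, h] = {g, h} := by ext; simp [eq_comm, or_comm]
    have := finrank_span_eq_card hli
    rwa [e] at this
  have heq := Submodule.eq_of_le_of_finrank_eq hle (by rw [hfin, hW])
  rw [← heq, Submodule.mem_span_pair] at hx
  exact hx

theorem exists_coords_of_independent {g h k : Space3}
    (hghk : ∀ a b c : ℝ, a • g + b • h + c • k = 0 → a = 0 ∧ b = 0 ∧ c = 0) (x : Space3) :
    ∃ a b c : ℝ, a • g + b • h + c • k = x := by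
  have hli : LinearIndependent ℝ ![g, h, k] := by
    rw [Fintype.linearIndependent_iff]
    intro c hc
    rw [Fin.sum_univ_three] at hc
    obtain ⟨h0, h1, h2⟩ := hghk _ _ _ hc
    intro i; fin_cases i <;> assumption
  have htop : Submodule.span ℝ (Set.range ![g, h, k]) = ⊤ :=
    hli.span_eq_top_of_card_eq_finrank (by simp)
  have hx : x ∈ Submodule.span ℝ (Set.range ![g, h, k]) := by rw [htop]; trivial
  rw [Submodule.mem_span_range_iff_exists_fun] at hx
  obtain ⟨c, hc⟩ := hx
  rw [Fin.sum_univ_three] at hc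
  exact ⟨c 0, c 1, c 2, hc⟩

theorem exists_linear_functional_of_pair {g h : Space3}
    (hgh : ∀ a b : ℝ, a • g + b • h = 0 → a = 0 ∧ b = 0) :
    ∃ m : Space3 →ₗ[ℝ] ℝ, m g = 0 ∧ m h = 1 := by
  have hh : h ∉ Submodule.span ℝ {g} := by
    intro hm
    obtain ⟨a, ha⟩ := Submodule.mem_span_singleton.1 hm
    have := (hgh a (-1) (by rw [ha]; simp)).2
    norm_num at this
  obtain ⟨f, hf, hf0⟩ := Submodule.exists_le_ker_of_notMem hh
  refine ⟨(f h)⁻¹ • f, ?_, ?_⟩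
  · have : f g = 0 := hf0 (Submodule.mem_span_singleton_self g)
    simp [this]
  · simp [hf]

namespace IsNondegPolyhedron

variable {n m : ℕ} {q : Fin n → Space3} {F : Fin m → Finset (Fin n)}

theorem finrank_facet (h : IsNondegPolyhedron q F) (a : Fin m) :
    Module.finrank ℝ (vectorSpan ℝ (q '' (F a : Set (Fin n)))) = 2 :=
  ((h.facets (F a)).2 ⟨a, rfl⟩).2

theorem sub_mem_vectorSpan {A : Finset (Fin n)} {v w : Fin n} (hv : v ∈ A) (hw : w ∈ A) :
    q w - q v ∈ vectorSpan ℝ (q '' (A : Set (Fin n))) :=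
  vsub_mem_vectorSpan ℝ (Set.mem_image_of_mem _ hw) (Set.mem_image_of_mem _ hv)

theorem facet_coords (h : IsNondegPolyhedron q F) (a : Fin m) {v w y x : Fin n} (hv : v ∈ F a)
    (hw : w ∈ F a) (hy : y ∈ F a) (hx : x ∈ F a) (hvw : v ≠ w) (hvy : v ≠ y) (hwy : w ≠ y) :
    ∃ α β : ℝ, α • (q w - q v) + β • (q y - q v) = q x - q v :=
  Submodule.exists_coords_of_finrank_two (h.finrank_facet a) (sub_mem_vectorSpan hv hw)
    (sub_mem_vectorSpan hv hy)
    (fun _ _ e => h.convexIndependent.pair_eq_zero hvw hvy hwy e) (sub_mem_vectorSpan hv hx)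

theorem exists_third (h : IsNondegPolyhedron q F) (a : Fin m) (v w : Fin n) :
    ∃ y ∈ F a, y ≠ v ∧ y ≠ w := by
  by_contra! hc
  have hsub : q '' (F a : Set (Fin n)) ⊆ {q v, q w} := by
    rintro _ ⟨x, hx, rfl⟩
    by_cases hxv : x = v
    · left; rw [hxv]
    · right; rw [hc x hx hxv]; rfl
  have h1 := Submodule.finrank_mono (vectorSpan_mono ℝ hsub)
  have h2 := collinear_iff_finrank_le_one.1 (collinear_pair ℝ (q v) (q w))
  rw [h.finrank_facet a] at h1
  omega

/-- Evaluating on differences from a vertex of the facet removes the constant of the supporting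
plane. Functionals belonging to several faces through `v` can then be added and scaled freely. -/
theorem exists_facet_functional (h : IsNondegPolyhedron q F) (a : Fin m) :
    ∃ U : Space3 →ₗ[ℝ] ℝ, ∀ v ∈ F a, ∀ x, 0 ≤ U (q x - q v) ∧
      (U (q x - q v) = 0 ↔ x ∈ F a) := by
  obtain ⟨⟨u, c, hle, heq⟩, -⟩ := (h.facets (F a)).2 ⟨a, rfl⟩
  refine ⟨-(innerₛₗ ℝ u), fun v hv x => ?_⟩
  have hv' := (heq v).1 hv
  have e : (-(innerₛₗ ℝ u)) (q x - q v) = c - inner ℝ u (q x) := by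
    simp [inner_sub_right, hv']
  rw [e]
  refine ⟨sub_nonneg.2 (hle x), ?_⟩
  rw [heq x, sub_eq_zero, eq_comm]

/-- Otherwise the hull would lie in a level set of `f`, although it contains a ball in which one can
move in the direction `y`. -/
theorem exists_functional_ne_zero (h : IsNondegPolyhedron q F) {f : Space3 →ₗ[ℝ] ℝ}
    (hf : ∃ y, f y ≠ 0) (v : Fin n) : ∃ x, f (q x - q v) ≠ 0 := by
  by_contra! hc
  obtain ⟨y, hy⟩ := hf
  have hsub : convexHull ℝ (Set.range q) ⊆ {z | f z = f (q v)} := by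
    apply convexHull_min
    · rintro _ ⟨x, rfl⟩
      have := hc x
      rw [map_sub, sub_eq_zero] at this
      exact this
    · intro a ha b hb s t _ _ hst
      simp only [Set.mem_ofPred_eq] at *
      rw [map_add, map_smul, map_smul, ha, hb, ← add_smul, hst, one_smul]
  obtain ⟨z, hz⟩ := h.interior_nonempty
  obtain ⟨ε, hε, hball⟩ := Metric.isOpen_iff.1 isOpen_interior z hz
  have hy0 : y ≠ 0 := fun e => hy (by simp [e])
  have hz1 : f z = f (q v) := hsub (interior_subset hz)
  have hz2 : z + (ε / (2 * ‖y‖)) • y ∈ Metric.ball z ε := by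
    rw [mem_ball_iff_norm]
    have : 0 < ‖y‖ := norm_pos_iff.2 hy0
    rw [add_sub_cancel_left, norm_smul, Real.norm_of_nonneg (by positivity)]
    field_simp
    linarith
  have hz3 : f (z + (ε / (2 * ‖y‖)) • y) = f (q v) := hsub (interior_subset (hball hz2))
  rw [map_add, hz1, map_smul, smul_eq_mul] at hz3
  have : 0 < ‖y‖ := norm_pos_iff.2 hy0
  have h5 : ε / (2 * ‖y‖) ≠ 0 := by positivity
  have : ε / (2 * ‖y‖) * f y = 0 := by linarith
  exact (mul_ne_zero h5 hy) this

theorem exists_notMem_facet (h : IsNondegPolyhedron q F) (a : Fin m) {v : Fin n} (hv : v ∈ F a) :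
    ∃ x, x ∉ F a := by
  by_contra! hall
  obtain ⟨f, hf1, hf2⟩ := Submodule.exists_le_ker_of_lt_top
    (vectorSpan ℝ (q '' (F a : Set (Fin n)))) (by
      rw [lt_top_iff_ne_top]
      intro e
      have := h.finrank_facet a
      rw [e] at this
      simp at this)
  obtain ⟨x, hx⟩ := h.exists_functional_ne_zero (f := f) (by
    by_contra! hc; exact hf1 (LinearMap.ext hc)) v
  exact hx (hf2 (sub_mem_vectorSpan hv (hall x)))

/-- The zero set of `f` has dimension at most two because `f` is not zero, and at least two because
it contains three points in convex position. It is thus a facet by the completeness of the list `F`.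
-/
theorem exists_facet_of_functional (h : IsNondegPolyhedron q F) (f : Space3 →ₗ[ℝ] ℝ)
    (hf : ∃ y, f y ≠ 0) {v w x : Fin n} (hle : ∀ y, f (q y - q v) ≤ 0)
    (hw : f (q w - q v) = 0) (hx : f (q x - q v) = 0) (hvw : v ≠ w) (hvx : v ≠ x)
    (hwx : w ≠ x) : ∃ b, ∀ y, y ∈ F b ↔ f (q y - q v) = 0 := by
  classical
  set B : Finset (Fin n) := Finset.univ.filter fun y => f (q y - q v) = 0 with hB
  have hmem : ∀ y, y ∈ B ↔ f (q y - q v) = 0 := by intro y; simp [hB]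
  have hfac : IsFacetVertexSet q B := by
    refine ⟨⟨(InnerProductSpace.toDual ℝ Space3).symm (LinearMap.toContinuousLinearMap f), f (q v),
      fun y => ?_, fun y => ?_⟩, ?_⟩
    · have := hle y
      simp only [map_sub] at this
      simpa using this
    · rw [hmem, map_sub, sub_eq_zero]
      simp
    · apply le_antisymm
      · have hsub : vectorSpan ℝ (q '' (B : Set (Fin n))) ≤ LinearMap.ker f := by
          rw [vectorSpan_def, Submodule.span_le]
          rintro _ ⟨_, ⟨s, hs, rfl⟩, _, ⟨t, ht, rfl⟩, rfl⟩
          have hs' := (hmem s).1 hs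
          have ht' := (hmem t).1 ht
          rw [map_sub, sub_eq_zero] at hs' ht'
          simp [hs', ht']
        have h1 := Submodule.finrank_mono hsub
        have h2 := LinearMap.finrank_range_add_finrank_ker f
        have h3 : LinearMap.range f = ⊤ := by
          apply LinearMap.range_eq_top.2
          apply LinearMap.surjective
          obtain ⟨y, hy⟩ := hf
          exact fun e => hy (by simp [e])
        rw [h3] at h2
        simp at h2
        omega
      · have hli : LinearIndependent ℝ ![q w - q v, q x - q v] :=
          LinearIndependent.pair_iff.2 fun a b e =>
            h.convexIndependent.pair_eq_zero hvw hvx hwx e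
        have h1 := finrank_span_eq_card hli
        have hvB : v ∈ B := (hmem v).2 (by simp)
        have hle : Submodule.span ℝ (Set.range ![q w - q v, q x - q v]) ≤
            vectorSpan ℝ (q '' (B : Set (Fin n))) := by
          rw [Submodule.span_le]
          rintro _ ⟨i, rfl⟩
          fin_cases i
          · exact sub_mem_vectorSpan hvB ((hmem w).2 hw)
          · exact sub_mem_vectorSpan hvB ((hmem x).2 hx)
        have h2 := Submodule.finrank_mono hle
        rw [h1] at h2
        simpa using h2
  obtain ⟨b, hb⟩ := (h.facets B).1 hfac
  exact ⟨b, fun y => by rw [hb, hmem]⟩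

/-- The facets through an edge of a facet. -/
theorem facets_of_faceEdge (h : IsNondegPolyhedron q F) {a : Fin m} {v w : Fin n}
    (he : FaceEdge q (F a) v w) :
    ∃ b, b ≠ a ∧ F a ∩ F b = {v, w} ∧ ∀ c, v ∈ F c → w ∈ F c → c = a ∨ c = b := by
  classical
  obtain ⟨hvw, hv, hw, g, hg, hg0⟩ := he
  obtain ⟨U, hU⟩ := h.exists_facet_functional a
  have hU := hU v hv
  obtain ⟨y, hya, hyv, hyw⟩ := h.exists_third a v w
  have hgy : g (q y - q v) < 0 := lt_of_le_of_ne (hg y hya) fun e => by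
    rcases (hg0 y hya).1 e with h1 | h1 <;> contradiction
  have hgw : g (q w - q v) = 0 := (hg0 w hw).2 (Or.inr rfl)
  have hUw : U (q w - q v) = 0 := ((hU w).2).2 hw
  have hUy : U (q y - q v) = 0 := ((hU y).2).2 hya
  -- a functional vanishing on the edge and positive elsewhere
  obtain ⟨M, hM⟩ : ∃ M : ℝ, ∀ x, x ∉ F a → g (q x - q v) < M * U (q x - q v) := by
    -- Off the facet `U` is positive, so it is enough that `M` exceed every ratio `g / U`.
    refine ⟨∑ x, |g (q x - q v) / U (q x - q v)| + 1, fun x hx => ?_⟩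
    have hUx : 0 < U (q x - q v) := lt_of_le_of_ne (hU x).1 fun e => hx ((hU x).2.1 e.symm)
    rw [← div_lt_iff₀ hUx]
    have := Finset.single_le_sum (f := fun x => |g (q x - q v) / U (q x - q v)|)
      (fun _ _ => abs_nonneg _) (Finset.mem_univ x)
    have := le_abs_self (g (q x - q v) / U (q x - q v))
    linarith
  set l : Space3 →ₗ[ℝ] ℝ := M • U - g with hl
  have hlapp : ∀ z, l z = M * U z - g z := fun z => by simp [hl]
  have hlw : l (q w - q v) = 0 := by rw [hlapp, hgw, hUw]; simp
  have hlpos : ∀ x, x ≠ v → x ≠ w → 0 < l (q x - q v) := by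
    intro x hxv hxw
    rw [hlapp]
    by_cases hx : x ∈ F a
    · rw [((hU x).2).2 hx]
      have : g (q x - q v) < 0 := lt_of_le_of_ne (hg x hx) fun e => by
        rcases (hg0 x hx).1 e with h1 | h1 <;> contradiction
      linarith
    · linarith [hM x hx]
  set X : Finset (Fin n) := Finset.univ.filter fun x => x ≠ v ∧ x ≠ w with hX
  have hXmem : ∀ x, x ∈ X ↔ x ≠ v ∧ x ≠ w := fun x => by simp [hX]
  -- Rotate the plane of the facet about the edge: the planes through the edge include the kernels
  -- of `U - s • l`. At the largest ratio `s` this functional is nonpositive on all vertices and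
  -- vanishes at a new one, `x'`, so it supports the adjacent facet.
  obtain ⟨x', hx', hmax⟩ := X.exists_max_image (fun x => U (q x - q v) / l (q x - q v))
    ⟨y, (hXmem y).2 ⟨hyv, hyw⟩⟩
  obtain ⟨hx'v, hx'w⟩ := (hXmem x').1 hx'
  set s := U (q x' - q v) / l (q x' - q v) with hs
  have hlx' := hlpos x' hx'v hx'w
  have hUne : ∃ z, U z ≠ 0 := by
    by_contra! hc
    obtain ⟨x, hx⟩ := h.exists_notMem_facet a hv
    exact hx ((hU x).2.1 (hc _))
  obtain ⟨x0, hx0⟩ := h.exists_functional_ne_zero hUne v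
  have hs0 : 0 < s := by
    have hx0v : x0 ≠ v := fun e => hx0 (by simp [e])
    have hx0w : x0 ≠ w := fun e => hx0 (by rw [e, hUw])
    refine lt_of_lt_of_le ?_ (hmax x0 ((hXmem x0).2 ⟨hx0v, hx0w⟩))
    exact div_pos (lt_of_le_of_ne (hU x0).1 (Ne.symm hx0)) (hlpos x0 hx0v hx0w)
  set f : Space3 →ₗ[ℝ] ℝ := U - s • l with hf
  have hfapp : ∀ z, f z = U z - s * l z := fun z => by simp [hf]
  have hfw : f (q w - q v) = 0 := by rw [hfapp, hUw, hlw]; simp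
  have hfle : ∀ x, f (q x - q v) ≤ 0 := by
    intro x
    by_cases hxv : x = v
    · simp [hxv]
    by_cases hxw : x = w
    · rw [hxw, hfw]
    have := hmax x ((hXmem x).2 ⟨hxv, hxw⟩)
    rw [div_le_iff₀ (hlpos x hxv hxw)] at this
    rw [hfapp]; linarith
  have hfx' : f (q x' - q v) = 0 := by
    rw [hfapp, hs, div_mul_cancel₀ _ hlx'.ne']; simp
  have hfy : f (q y - q v) < 0 := by
    rw [hfapp, hUy]
    have := mul_pos hs0 (hlpos y hyv hyw)
    linarith
  obtain ⟨b, hb⟩ := h.exists_facet_of_functional f ⟨_, hfy.ne⟩ hfle hfw hfx' hvw hx'v.symm hx'w.symm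
  have hUx' : 0 < U (q x' - q v) := by
    have : U (q x' - q v) = s * l (q x' - q v) := by rw [hs, div_mul_cancel₀ _ hlx'.ne']
    rw [this]; exact mul_pos hs0 hlx'
  refine ⟨b, ?_, ?_, ?_⟩
  · rintro rfl
    exact hfy.ne ((hb y).1 hya)
  · ext x
    rw [Finset.mem_inter, hb, Finset.mem_insert, Finset.mem_singleton]
    constructor
    · rintro ⟨hxa, hxb⟩
      by_contra! hc
      have := mul_pos hs0 (hlpos x hc.1 hc.2)
      rw [hfapp, (hU x).2.2 hxa] at hxb
      linarith
    · rintro (rfl | rfl)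
      · exact ⟨hv, by simp⟩
      · exact ⟨hw, hfw⟩
  · intro c hvc hwc
    obtain ⟨K, hK⟩ := h.exists_facet_functional c
    have hK := hK v hvc
    have hKw : K (q w - q v) = 0 := (hK w).2.2 hwc
    have hind : ∀ α β γ : ℝ, α • (q w - q v) + β • (q y - q v) + γ • (q x' - q v) = 0 →
        α = 0 ∧ β = 0 ∧ γ = 0 := by
      intro α β γ e
      have e1 := congrArg U e
      simp only [map_add, map_smul, hUw, hUy, smul_eq_mul, mul_zero, zero_add, map_zero] at e1
      have hγ : γ = 0 := by
        rcases mul_eq_zero.1 e1 with h1 | h1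
        · exact h1
        · exact absurd h1 hUx'.ne'
      rw [hγ, zero_smul, add_zero] at e
      obtain ⟨h1, h2⟩ := h.convexIndependent.pair_eq_zero hvw hyv.symm hyw.symm e
      exact ⟨h1, h2, hγ⟩
    -- `K` is a combination of `U` and `l`
    obtain ⟨A, B, hAB⟩ : ∃ A B : ℝ, ∀ x, K (q x - q v) = A * U (q x - q v) + B * l (q x - q v) := by
      have hly := hlpos y hyv hyw
      refine ⟨(K (q x' - q v) - K (q y - q v) / l (q y - q v) * l (q x' - q v)) / U (q x' - q v),
        K (q y - q v) / l (q y - q v), fun x => ?_⟩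
      obtain ⟨α, β, γ, e⟩ := exists_coords_of_independent hind (q x - q v)
      rw [← e]
      simp only [map_add, map_smul, hUw, hUy, hlw, hKw, smul_eq_mul, mul_zero, zero_add]
      field_simp
      ring
    -- Three vertices pin down the coefficients. From `y` comes `0 ≤ B`. If `B` is positive, `x'`
    -- gives `0 ≤ A * s + B`, while `z` gives `A < 0` and the reverse inequality, so `K` is a
    -- multiple of `f`. If `B` is zero, `K` is a multiple of `U`.
    obtain ⟨z, hzc, hzv, hzw⟩ := h.exists_third c v w
    have hzl := hlpos z hzv hzw
    have hKz : K (q z - q v) = 0 := (hK z).2.2 hzc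
    have hly := hlpos y hyv hyw
    have hB0 : 0 ≤ B := by
      have := (hK y).1
      rw [hAB, hUy] at this
      by_contra! hc
      have := mul_neg_of_neg_of_pos hc hly
      linarith
    rcases hB0.lt_or_eq with hBpos | hB0
    · right
      have hBs : 0 ≤ A * s + B := by
        have h1 := (hK x').1
        rw [hAB] at h1
        have h2 : U (q x' - q v) = s * l (q x' - q v) := by rw [hs, div_mul_cancel₀ _ hlx'.ne']
        rw [h2] at h1
        by_contra! hc
        have := mul_neg_of_neg_of_pos hc hlx'
        linarith
      have hA : A < 0 := by
        have h1 := hAB z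
        rw [hKz] at h1
        by_contra! hc
        have := mul_pos hBpos hzl
        have := mul_nonneg hc (hU z).1
        linarith
      have hAs : A * s + B = 0 := by
        have h1 := hAB z
        rw [hKz] at h1
        have h2 := hfle z
        rw [hfapp] at h2
        have h3 := mul_nonneg_of_nonpos_of_nonpos hA.le h2
        apply le_antisymm _ hBs
        by_contra! hc
        have := mul_pos hc hzl
        linarith
      apply h.facets_injective
      ext x
      rw [hb, ← (hK x).2, hAB, hfapp]
      have : A * U (q x - q v) + B * l (q x - q v) = A * (U (q x - q v) - s * l (q x - q v)) := by
        have : B = - (A * s) := by linarith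
        rw [this]; ring
      rw [this, mul_eq_zero, or_iff_right hA.ne]
    · left
      apply h.facets_injective
      ext x
      rw [← (hK x).2, ← (hU x).2, hAB, ← hB0, zero_mul, add_zero, mul_eq_zero]
      have hA : A ≠ 0 := by
        rintro rfl
        have hall : ∀ x, x ∈ F c := fun x => (hK x).2.1 (by rw [hAB, ← hB0]; simp)
        obtain ⟨x, hx⟩ := h.exists_notMem_facet c hvc
        exact hx (hall x)
      rw [or_iff_right hA]

theorem FaceEdge.isEdge (h : IsNondegPolyhedron q F) {a : Fin m} {v w : Fin n}
    (he : FaceEdge q (F a) v w) : IsEdge F v w := by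
  obtain ⟨b, hba, hab, -⟩ := h.facets_of_faceEdge he
  exact ⟨he.1, a, b, hba.symm, hab⟩

/-- The supporting functional of the other facet, with its sign reversed, cuts the edge out of `F
a`. -/
theorem faceEdge_of_inter (h : IsNondegPolyhedron q F) {a b : Fin m} {v w : Fin n} (hvw : v ≠ w)
    (hab : F a ∩ F b = {v, w}) : FaceEdge q (F a) v w := by
  have hv : v ∈ F a ∩ F b := by rw [hab]; simp
  have hw : w ∈ F a ∩ F b := by rw [hab]; simp
  rw [Finset.mem_inter] at hv hw
  obtain ⟨U, hU⟩ := h.exists_facet_functional b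
  refine ⟨hvw, hv.1, hw.1, -U, fun x _ => ?_, fun x hx => ?_⟩
  · simpa using (hU v hv.2 x).1
  · rw [LinearMap.neg_apply, neg_eq_zero, (hU v hv.2 x).2]
    have : x ∈ F b ↔ x ∈ F a ∩ F b := by simp [hx]
    rw [this, hab]; simp

/-- The right side involves only `F`, so adjacency is the same for all polyhedra of a degenerating
sequence. Two vertices of a facet that form an edge somewhere form an edge of this facet, because
only two facets contain both. -/
theorem faceEdge_iff (h : IsNondegPolyhedron q F) {a : Fin m} {v w : Fin n} :
    FaceEdge q (F a) v w ↔ v ∈ F a ∧ w ∈ F a ∧ IsEdge F v w := by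
  refine ⟨fun he => ⟨he.2.1, he.2.2.1, FaceEdge.isEdge h he⟩, ?_⟩
  rintro ⟨hv, hw, hvw, i, j, hij, hF⟩
  have hi := h.faceEdge_of_inter hvw hF
  obtain ⟨b, -, hib, hall⟩ := h.facets_of_faceEdge hi
  have hv' : v ∈ F i ∩ F j := by rw [hF]; simp
  have hw' : w ∈ F i ∩ F j := by rw [hF]; simp
  rw [Finset.mem_inter] at hv' hw'
  have hj : j = b := (hall j hv'.2 hw'.2).resolve_left hij.symm
  rcases hall a hv hw with rfl | rfl
  · exact hi
  · rw [Finset.inter_comm] at hib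
    exact h.faceEdge_of_inter hvw hib

/-- Together with `card_edges_of_mem_facet` this says that the facets at a vertex form a cycle
modulo two. Both conclusions speak of `F` alone and so remain available in a limit position. -/
theorem card_facets_of_isEdge (h : IsNondegPolyhedron q F) {v w : Fin n} (he : IsEdge F v w) :
    (Finset.univ.filter fun a => v ∈ F a ∧ w ∈ F a).card = 2 := by
  obtain ⟨hvw, i, j, hij, hF⟩ := he
  obtain ⟨b, hbi, hib, hall⟩ := h.facets_of_faceEdge (h.faceEdge_of_inter hvw hF)
  rw [Finset.card_eq_two]
  have hv' : v ∈ F i ∩ F b := by rw [hib]; simp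
  have hw' : w ∈ F i ∩ F b := by rw [hib]; simp
  rw [Finset.mem_inter] at hv' hw'
  refine ⟨i, b, hbi.symm, ?_⟩
  ext c
  simp only [Finset.mem_filter, Finset.mem_univ, true_and, Finset.mem_insert, Finset.mem_singleton]
  constructor
  · rintro ⟨h1, h2⟩; exact hall c h1 h2
  · rintro (rfl | rfl)
    · exact ⟨hv'.1, hw'.1⟩
    · exact ⟨hv'.2, hw'.2⟩

/-- Separation of `q v` from the hull of the other vertices. The functional serves as a positive
denominator for slopes at `v`. -/
theorem exists_vertex_functional (h : IsNondegPolyhedron q F) (v : Fin n) :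
    ∃ l : Space3 →ₗ[ℝ] ℝ, ∀ x, x ≠ v → 0 < l (q x - q v) := by
  have hv : q v ∉ convexHull ℝ (q '' {v}ᶜ) := by
    rw [h.convexIndependent.mem_convexHull_iff]; simp
  obtain ⟨f, u, hf, hu⟩ := geometric_hahn_banach_point_closed (convex_convexHull ℝ _)
    ((Set.toFinite (q '' {v}ᶜ)).isClosed_convexHull ℝ) hv
  refine ⟨f.toLinearMap, fun x hx => ?_⟩
  have := hu (q x) (subset_convexHull ℝ _ ⟨x, hx, rfl⟩)
  simp only [ContinuousLinearMap.coe_coe, map_sub]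
  linarith

/-- Each vertex of a facet lies on exactly two edges of the facet. -/
theorem card_edges_of_mem_facet (h : IsNondegPolyhedron q F) {a : Fin m} {v : Fin n}
    (hv : v ∈ F a) [DecidablePred fun w => IsEdge F v w] :
    ((F a).filter fun w => IsEdge F v w).card = 2 := by
  classical
  obtain ⟨l, hl⟩ := h.exists_vertex_functional v
  obtain ⟨g, hga, hgv, -⟩ := h.exists_third a v v
  obtain ⟨y, hya, hyv, hyg⟩ := h.exists_third a v g
  -- In the plane of the facet `μ / l` is a slope of the rays from `v`, and it takes different
  -- values at `g` and `y`. The two edges at `v` are the rays of least and of greatest slope.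
  obtain ⟨μ, hμg, hμy⟩ := exists_linear_functional_of_pair
    (fun α β e => h.convexIndependent.pair_eq_zero hgv.symm hyv.symm hyg.symm e)
  have hlg := hl g hgv
  have hly := hl y hyv
  -- functionals on the plane of the facet are combinations of `l` and `μ`
  have hcomb : ∀ f : Space3 →ₗ[ℝ] ℝ, ∃ A B : ℝ, ∀ x ∈ F a,
      f (q x - q v) = A * μ (q x - q v) + B * l (q x - q v) := by
    intro f
    refine ⟨f (q y - q v) - f (q g - q v) / l (q g - q v) * l (q y - q v),
      f (q g - q v) / l (q g - q v), fun x hx => ?_⟩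
    obtain ⟨α, β, e⟩ := h.facet_coords a hv hga hya hx hgv.symm hyv.symm hyg.symm
    rw [← e]
    simp only [map_add, map_smul, hμg, hμy, smul_eq_mul, mul_zero, zero_add, mul_one]
    field_simp
    ring
  set X := (F a).erase v with hX
  have hXne : X.Nonempty := ⟨g, Finset.mem_erase.2 ⟨hgv, hga⟩⟩
  have hXl : ∀ x ∈ X, 0 < l (q x - q v) := fun x hx => hl x (Finset.ne_of_mem_erase hx)
  -- an extreme value of the slope is attained on an edge only
  have hext : ∀ σ : ℝ, σ = 1 ∨ σ = -1 → ∀ w ∈ X,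
      (∀ x ∈ X, σ * (μ (q x - q v) / l (q x - q v)) ≤ σ * (μ (q w - q v) / l (q w - q v))) →
      FaceEdge q (F a) v w := by
    intro σ hσ w hw hmax
    have hwv := Finset.ne_of_mem_erase hw
    have hwa := Finset.mem_of_mem_erase hw
    set s := μ (q w - q v) / l (q w - q v) with hs
    set f : Space3 →ₗ[ℝ] ℝ := σ • (μ - s • l) with hf
    have hfapp : ∀ z, f z = σ * (μ z - s * l z) := fun z => by simp [hf]
    have hfw : f (q w - q v) = 0 := by
      rw [hfapp, hs, div_mul_cancel₀ _ (hXl w hw).ne']; simp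
    have hσ0 : σ ≠ 0 := by rcases hσ with rfl | rfl <;> norm_num
    refine ⟨hwv.symm, hv, hwa, f, fun x hx => ?_, fun x hx => ⟨fun e => ?_, ?_⟩⟩
    · by_cases hxv : x = v
      · simp [hxv]
      · have hx' : x ∈ X := Finset.mem_erase.2 ⟨hxv, hx⟩
        have h1 := hmax x hx'
        have h2 := hXl x hx'
        have h3 := mul_le_mul_of_nonneg_right h1 h2.le
        rw [mul_assoc, div_mul_cancel₀ _ h2.ne'] at h3
        rw [hfapp]; linarith
    · by_contra! hc
      -- A zero at a third vertex makes `f` vanish on the whole plane of the facet. Then `g` forces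
      -- `s = 0`, and `y` contradicts `μ = 1` there.
      have hlz : f (q g - q v) = 0 ∧ f (q y - q v) = 0 := by
        obtain ⟨α, β, e1⟩ := h.facet_coords a hv hwa hx hga hwv.symm hc.1.symm hc.2.symm
        obtain ⟨α', β', e2⟩ := h.facet_coords a hv hwa hx hya hwv.symm hc.1.symm hc.2.symm
        rw [← e1, ← e2]
        simp [hfw, e]
      rw [hfapp, hfapp, hμg, hμy] at hlz
      have h1 : s = 0 := by
        rcases mul_eq_zero.1 hlz.1 with h1 | h1
        · exact absurd h1 hσ0
        · have : s * l (q g - q v) = 0 := by linarith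
          exact (mul_eq_zero.1 this).resolve_right hlg.ne'
      rw [h1] at hlz
      simp [hσ0] at hlz
    · rintro (rfl | rfl)
      · simp
      · exact hfw
  obtain ⟨w₁, hw₁, hmax⟩ := X.exists_max_image (fun x => μ (q x - q v) / l (q x - q v)) hXne
  obtain ⟨w₂, hw₂, hmin⟩ := X.exists_min_image (fun x => μ (q x - q v) / l (q x - q v)) hXne
  have he₁ : FaceEdge q (F a) v w₁ := hext 1 (Or.inl rfl) w₁ hw₁ (by simpa using hmax)
  have he₂ : FaceEdge q (F a) v w₂ := hext (-1) (Or.inr rfl) w₂ hw₂ (by simpa using hmin)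
  have hne : w₁ ≠ w₂ := by
    intro e
    have hg := Finset.mem_erase.2 ⟨hgv, hga⟩
    have hy := Finset.mem_erase.2 ⟨hyv, hya⟩
    have h1 := hmax y hy
    have h2 := hmin g hg
    rw [e] at h1
    have h3 := h1.trans h2
    rw [hμg, hμy, zero_div] at h3
    exact absurd h3 (not_le.2 (by positivity))
  rw [Finset.card_eq_two]
  refine ⟨w₁, w₂, hne, ?_⟩
  ext w
  simp only [Finset.mem_filter, Finset.mem_insert, Finset.mem_singleton]
  constructor
  · rintro ⟨hwa, hew⟩
    obtain ⟨hvw, -, -, f, hf, hf0⟩ := h.faceEdge_iff.2 ⟨hv, hwa, hew⟩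
    have hwX : w ∈ X := Finset.mem_erase.2 ⟨hvw.symm, hwa⟩
    obtain ⟨A, B, hAB⟩ := hcomb f
    -- The quotient `f / l` is an affine function of the slope, nonpositive on `X` with the single
    -- zero `w`. Hence `w` has extreme slope, and the sign of `A` says at which end.
    have hslope : ∀ x ∈ X, f (q x - q v) / l (q x - q v) =
        A * (μ (q x - q v) / l (q x - q v)) + B := by
      intro x hx
      have := (hXl x hx).ne'
      rw [hAB x (Finset.mem_of_mem_erase hx)]
      field_simp
    have hw0 : f (q w - q v) = 0 := (hf0 w hwa).2 (Or.inr rfl)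
    have hs0 := hslope w hwX
    rw [hw0, zero_div] at hs0
    have heq : ∀ x ∈ X, 0 ≤ A * (μ (q x - q v) / l (q x - q v)) + B → x = w := by
      intro x hx h0
      rw [← hslope x hx] at h0
      have h1 : 0 ≤ f (q x - q v) := by
        by_contra! hc
        exact absurd h0 (not_le.2 (div_neg_of_neg_of_pos hc (hXl x hx)))
      have h2 := le_antisymm (hf x (Finset.mem_of_mem_erase hx)) h1
      exact ((hf0 x (Finset.mem_of_mem_erase hx)).1 h2).resolve_left (Finset.ne_of_mem_erase hx)
    rcases lt_trichotomy A 0 with hA | hA | hA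
    · right
      refine (heq w₂ hw₂ ?_).symm
      have := mul_le_mul_of_nonpos_left (hmin w hwX) hA.le
      linarith
    · exfalso
      have h1 : ∀ x ∈ X, x = w := fun x hx => heq x hx (by rw [hA] at hs0 ⊢; linarith)
      exact hne ((h1 w₁ hw₁).trans (h1 w₂ hw₂).symm)
    · left
      refine (heq w₁ hw₁ ?_).symm
      have := mul_le_mul_of_nonneg_left (hmax w hwX) hA.le
      linarith
  · rintro (rfl | rfl)
    · exact ⟨he₁.2.2.1, FaceEdge.isEdge h he₁⟩
    · exact ⟨he₂.2.2.1, FaceEdge.isEdge h he₂⟩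

end IsNondegPolyhedron

/-! ### Strictly convex plane polygons and their limits. -/

/-- The determinant of two plane vectors. -/
def cross (a b : ℝ × ℝ) : ℝ := a.1 * b.2 - a.2 * b.1

/-- `d` lies in the open angle spanned by the independent vectors `a` and `b`. -/
def InWedge (a b d : ℝ × ℝ) : Prop := 0 < cross a d * cross a b ∧ 0 < cross d b * cross a b

/-- The barycentre of the points `y v`, `v ∈ A`. -/
noncomputable def barycentre {ι E : Type*} [AddCommGroup E] [Module ℝ E] (A : Finset ι)
    (y : ι → E) : E := (A.card : ℝ)⁻¹ • ∑ v ∈ A, y v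

theorem sum_sub_barycentre {ι E : Type*} [AddCommGroup E] [Module ℝ E] {A : Finset ι}
    (hA : A.Nonempty) (y : ι → E) : ∑ v ∈ A, (y v - barycentre A y) = 0 := by
  have : (A.card : ℝ) ≠ 0 := by exact_mod_cast hA.card_pos.ne'
  rw [Finset.sum_sub_distrib, Finset.sum_const, barycentre, ← Nat.cast_smul_eq_nsmul ℝ,
    smul_inv_smul₀ this, sub_self]

theorem cross_same (a : ℝ × ℝ) : cross a a = 0 := by simp only [cross]; ring

theorem cross_add_right (a b c : ℝ × ℝ) : cross a (b + c) = cross a b + cross a c := by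
  simp [cross]; ring

theorem cross_smul_right (a b : ℝ × ℝ) (r : ℝ) : cross a (r • b) = r * cross a b := by
  simp [cross]; ring

/-- The determinant as a linear functional of its second argument. -/
def crossLinear (a : ℝ × ℝ) : ℝ × ℝ →ₗ[ℝ] ℝ where
  toFun := cross a
  map_add' := cross_add_right a
  map_smul' r b := cross_smul_right a b r

theorem cross_sum_right {ι : Type*} (A : Finset ι) (a : ℝ × ℝ) (y : ι → ℝ × ℝ) :
    cross a (∑ v ∈ A, y v) = ∑ v ∈ A, cross a (y v) :=
  map_sum (crossLinear a) y A

theorem continuous_cross : Continuous fun z : (ℝ × ℝ) × (ℝ × ℝ) => cross z.1 z.2 := by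
  unfold cross; fun_prop

theorem Filter.Tendsto.cross {α : Type*} {l : Filter α} {f g : α → ℝ × ℝ} {a b : ℝ × ℝ}
    (hf : Tendsto f l (𝓝 a)) (hg : Tendsto g l (𝓝 b)) :
    Tendsto (fun t => _root_.cross (f t) (g t)) l (𝓝 (_root_.cross a b)) :=
  (continuous_cross.tendsto (a, b)).comp (hf.prodMk_nhds hg)

/-- A linear functional summed over the vertices is a multiple of its value at the barycentre. This
carries information about the side of an edge from the vertices to the barycentre. -/
theorem sum_cross_eq {ι : Type*} {A : Finset ι} (hA : A.Nonempty) (y : ι → ℝ × ℝ) (v w : ι) :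
    ∑ x ∈ A, cross (y w - y v) (y x - y v) =
      A.card * cross (y w - y v) (barycentre A y - y v) := by
  have h0 := congrArg (cross (y w - y v)) (sum_sub_barycentre hA y)
  rw [cross_sum_right] at h0
  have h1 : ∀ x, cross (y w - y v) (y x - y v) = cross (y w - y v) (y x - barycentre A y) +
      cross (y w - y v) (barycentre A y - y v) := fun x => by
    rw [← cross_add_right]; congr 1; abel
  simp_rw [h1]
  rw [Finset.sum_add_distrib, h0, Finset.sum_const, nsmul_eq_mul]
  simp [cross]

theorem cross_sub_sub (a b c : ℝ × ℝ) : cross (b - a) (c - a) = cross (a - c) (b - c) := by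
  simp [cross]; ring

/-- `y` maps `A` to the vertices of a strictly convex polygon with adjacency relation `N`. -/
structure IsStrictPolygon {ι : Type*} (A : Finset ι) (N : ι → ι → Prop) (y : ι → ℝ × ℝ) :
    Prop where
  three_le_card : 3 ≤ A.card
  symm : ∀ v w, N v w → N w v
  ne : ∀ v w, N v w → v ≠ w
  cross_ne_zero : ∀ v ∈ A, ∀ w ∈ A, ∀ x ∈ A, v ≠ w → v ≠ x → w ≠ x →
    cross (y w - y v) (y x - y v) ≠ 0
  adj_iff : ∀ v ∈ A, ∀ w ∈ A, v ≠ w → (N v w ↔ ∀ x ∈ A, ∀ x' ∈ A, x ≠ v → x ≠ w → x' ≠ v →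
    x' ≠ w → 0 < cross (y w - y v) (y x - y v) * cross (y w - y v) (y x' - y v))

namespace IsStrictPolygon

variable {ι : Type*} {A : Finset ι} {N : ι → ι → Prop} {y : ι → ℝ × ℝ}

theorem nonempty (h : IsStrictPolygon A N y) : A.Nonempty := by
  rw [← Finset.card_pos]; have := h.three_le_card; omega

theorem exists_third (h : IsStrictPolygon A N y) (v w : ι) : ∃ x ∈ A, x ≠ v ∧ x ≠ w := by
  classical
  by_contra! hc
  have : A ⊆ {v, w} := fun x hx => by
    rw [Finset.mem_insert, Finset.mem_singleton]
    by_cases hxv : x = v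
    · exact Or.inl hxv
    · exact Or.inr (hc x hx hxv)
  have := (Finset.card_le_card this).trans Finset.card_le_two
  have := h.three_le_card
  omega

theorem cross_barycentre_pos (h : IsStrictPolygon A N y) {v w x : ι} (hv : v ∈ A) (hw : w ∈ A)
    (hN : N v w) (hx : x ∈ A) (hxv : x ≠ v) (hxw : x ≠ w) :
    0 < cross (y w - y v) (barycentre A y - y v) * cross (y w - y v) (y x - y v) := by
  have hs := (h.adj_iff v hv w hw (h.ne v w hN)).1 hN
  have h1 : 0 < ∑ x' ∈ A, cross (y w - y v) (y x' - y v) * cross (y w - y v) (y x - y v) := by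
    refine Finset.sum_pos' (fun x' hx' => ?_) ⟨x, hx, hs x hx x hx hxv hxw hxv hxw⟩
    by_cases h1 : x' = v
    · simp [h1, cross]
    by_cases h2 : x' = w
    · subst h2; rw [cross_same, zero_mul]
    exact (hs x' hx' x hx h1 h2 hxv hxw).le
  rw [← Finset.sum_mul, sum_cross_eq h.nonempty, mul_assoc] at h1
  have hc : (0 : ℝ) < A.card := by exact_mod_cast h.nonempty.card_pos
  exact (mul_pos_iff_of_pos_left hc).1 h1

/-- The line from `v` to the barycentre separates the two neighbours: the side conditions for the
two edges contain the determinant of the edge vectors with opposite signs. -/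
theorem cross_barycentre_mul_neg (h : IsStrictPolygon A N y) {v w w' : ι} (hv : v ∈ A)
    (hw : w ∈ A) (hw' : w' ∈ A) (hN : N v w) (hN' : N v w') (hne : w ≠ w') :
    cross (y w - y v) (barycentre A y - y v) * cross (y w' - y v) (barycentre A y - y v) < 0 := by
  have h1 := h.cross_barycentre_pos hv hw hN hw' (h.ne _ _ hN').symm hne.symm
  have h2 := h.cross_barycentre_pos hv hw' hN' hw (h.ne _ _ hN).symm hne
  have h3 : cross (y w' - y v) (y w - y v) = - cross (y w - y v) (y w' - y v) := by
    simp [cross]; ring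
  rw [h3] at h2
  have h4 := mul_pos h1 h2
  by_contra! hc
  nlinarith [mul_nonneg hc (sq_nonneg (cross (y w - y v) (y w' - y v)))]

/-- A generic ray from the barycentre crosses exactly one edge. -/
theorem card_inWedge (h : IsStrictPolygon A N y) {d : ℝ × ℝ}
    (hd : ∀ v ∈ A, cross d (y v - barycentre A y) ≠ 0) :
    {e : ι × ι | e ∈ A ×ˢ A ∧ N e.1 e.2 ∧
      InWedge (y e.1 - barycentre A y) (y e.2 - barycentre A y) d}.ncard = 2 := by
  classical
  set o := barycentre A y with ho
  set σ : ι → ℝ := fun v => cross d (y v - o) with hσ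
  have hsum : ∑ v ∈ A, σ v = 0 := by
    rw [hσ, ← cross_sum_right, sum_sub_barycentre h.nonempty]; simp [cross]
  have hneg : ∃ v ∈ A, σ v < 0 := by
    by_contra! hc
    have := Finset.sum_pos (fun v hv => lt_of_le_of_ne (hc v hv) (hd v hv).symm) h.nonempty
    linarith
  have hpos : ∃ v ∈ A, 0 < σ v := by
    by_contra! hc
    have := Finset.sum_neg (fun v hv => lt_of_le_of_ne (hc v hv) (hd v hv)) h.nonempty
    linarith
  set P := (A ×ˢ A).filter fun e => σ e.1 < 0 ∧ 0 < σ e.2 with hP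
  have hPmem : ∀ v w, (v, w) ∈ P ↔ v ∈ A ∧ w ∈ A ∧ σ v < 0 ∧ 0 < σ w := by
    intro v w; simp [hP, and_assoc]
  have hPne : P.Nonempty := by
    obtain ⟨v, hv, hv'⟩ := hneg
    obtain ⟨w, hw, hw'⟩ := hpos
    exact ⟨(v, w), (hPmem v w).2 ⟨hv, hw, hv', hw'⟩⟩
  -- The sign of `σ` tells the side of the line through `o` in direction `d`. A segment from the
  -- negative to the positive side meets this line at `o + H • d`, and the farthest such crossing
  -- belongs to an edge.
  set H : ι × ι → ℝ := fun e => cross (y e.1 - o) (y e.2 - o) / (σ e.2 - σ e.1) with hH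
  obtain ⟨⟨v, w⟩, hvwP, hmax⟩ := P.exists_max_image H hPne
  obtain ⟨hv, hw, hσv, hσw⟩ := (hPmem v w).1 hvwP
  have hvw : v ≠ w := by rintro rfl; linarith
  have hmax' : ∀ v' w', v' ∈ A → w' ∈ A → σ v' < 0 → 0 < σ w' →
      cross (y v' - o) (y w' - o) * (σ w - σ v) ≤ cross (y v - o) (y w - o) * (σ w' - σ v') := by
    intro v' w' hv' hw' h1 h2
    have := hmax (v', w') ((hPmem _ _).2 ⟨hv', hw', h1, h2⟩)
    simp only [hH] at this
    rwa [div_le_div_iff₀ (by linarith) (by linarith)] at this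
  -- A vertex beyond the segment, put in place of the endpoint on its own side of the line, would
  -- give a farther crossing.
  have hbelow : ∀ x ∈ A, x ≠ v → x ≠ w → 0 < cross (y w - y v) (y x - y v) := by
    intro x hx hxv hxw
    by_contra! hc
    have hD := lt_of_le_of_ne hc (h.cross_ne_zero v hv w hw x hx hvw hxv.symm hxw.symm)
    rcases lt_or_gt_of_ne (hd x hx) with hx0 | hx0
    · have h1 := hmax' x w hx hw hx0 hσw
      have h2 : cross (y x - o) (y w - o) * (σ w - σ v) - cross (y v - o) (y w - o) * (σ w - σ x)
          = -(σ w * cross (y w - y v) (y x - y v)) := by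
        simp only [hσ, cross, Prod.fst_sub, Prod.snd_sub]; ring
      have := mul_neg_of_pos_of_neg hσw hD
      linarith
    · have h1 := hmax' v x hv hx hσv hx0
      have h2 : cross (y v - o) (y x - o) * (σ w - σ v) - cross (y v - o) (y w - o) * (σ x - σ v)
          = σ v * cross (y w - y v) (y x - y v) := by
        simp only [hσ, cross, Prod.fst_sub, Prod.snd_sub]; ring
      have := mul_pos_of_neg_of_neg hσv hD
      linarith
  have hN : N v w := (h.adj_iff v hv w hw hvw).2 fun x hx x' hx' h1 h2 h3 h4 =>
    mul_pos (hbelow x hx h1 h2) (hbelow x' hx' h3 h4)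
  -- The farthest crossing is on the forward ray, the barycentre being strictly on the inner side of
  -- the edge.
  have hC : 0 < cross (y v - o) (y w - o) := by
    obtain ⟨x, hx, hxv, hxw⟩ := h.exists_third v w
    have h1 := h.cross_barycentre_pos hv hw hN hx hxv hxw
    rw [← ho, cross_sub_sub] at h1
    exact (mul_pos_iff_of_pos_right (hbelow x hx hxv hxw)).1 h1
  have hflip : ∀ v, cross (y v - o) d = - σ v := fun v => by simp only [hσ, cross]; ring
  have hanti : ∀ v w, cross (y w - o) (y v - o) = - cross (y v - o) (y w - o) := fun v w => by
    simp only [cross]; ring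
  -- uniqueness of the positively oriented edge
  have huniq : ∀ v' w', v' ∈ A → w' ∈ A → N v' w' → σ v' < 0 → 0 < σ w' →
      0 < cross (y v' - o) (y w' - o) → v' = v ∧ w' = w := by
    intro v' w' hv' hw' hN' h1 h2 h3
    have hD : ∀ x ∈ A, x ≠ v' → x ≠ w' → 0 < cross (y w' - y v') (y x - y v') := by
      intro x hx hxv hxw
      have h4 := h.cross_barycentre_pos hv' hw' hN' hx hxv hxw
      rw [← ho, cross_sub_sub] at h4
      exact (mul_pos_iff_of_pos_left h3).1 h4
    have hD0 : ∀ x ∈ A, 0 ≤ cross (y w' - y v') (y x - y v') := by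
      intro x hx
      by_cases e1 : x = v'
      · simp [e1, cross]
      by_cases e2 : x = w'
      · subst e2; simp only [cross]; apply le_of_eq; ring
      exact (hD x hx e1 e2).le
    have h4 := hmax' v' w' hv' hw' h1 h2
    -- The left side is a positive combination of the nonnegative heights of `v` and `w` over the
    -- other edge. Maximality makes the right side nonpositive, so both heights vanish.
    have h5 : σ w * cross (y w' - y v') (y v - y v') - σ v * cross (y w' - y v') (y w - y v') =
        cross (y v' - o) (y w' - o) * (σ w - σ v) - cross (y v - o) (y w - o) * (σ w' - σ v') := by
      simp only [hσ, cross, Prod.fst_sub, Prod.snd_sub]; ring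
    have h6 := mul_nonneg hσw.le (hD0 v hv)
    have h7 := mul_nonneg (neg_nonneg.2 hσv.le) (hD0 w hw)
    have h8 : cross (y w' - y v') (y v - y v') = 0 := by
      have : σ w * cross (y w' - y v') (y v - y v') = 0 := by linarith
      exact (mul_eq_zero.1 this).resolve_left hσw.ne'
    have h9 : cross (y w' - y v') (y w - y v') = 0 := by
      have : σ v * cross (y w' - y v') (y w - y v') = 0 := by linarith
      exact (mul_eq_zero.1 this).resolve_left hσv.ne
    have hv2 : v = v' ∨ v = w' := by
      by_contra! hc
      exact (hD v hv hc.1 hc.2).ne' h8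
    have hw2 : w = v' ∨ w = w' := by
      by_contra! hc
      exact (hD w hw hc.1 hc.2).ne' h9
    constructor
    · rcases hv2 with e | e
      · exact e.symm
      · rw [e] at hσv; linarith
    · rcases hw2 with e | e
      · rw [e] at hσw; linarith
      · exact e.symm
  rw [Set.ncard_eq_two]
  -- One edge counts as two ordered pairs.
  refine ⟨(v, w), (w, v), fun e => hvw (Prod.ext_iff.1 e).1, ?_⟩
  ext ⟨v', w'⟩
  rw [Set.mem_ofPred_eq]
  simp only [Finset.mem_product, Set.mem_insert_iff, Set.mem_singleton_iff, Prod.mk.injEq, InWedge,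
    hflip]
  constructor
  · rintro ⟨⟨hv', hw'⟩, hN', h1, h2⟩
    change 0 < σ w' * _ at h2
    rcases lt_trichotomy (cross (y v' - o) (y w' - o)) 0 with h3 | h3 | h3
    · right
      have := huniq w' v' hw' hv' (h.symm _ _ hN') (by nlinarith) (by nlinarith)
        (by rw [hanti]; linarith)
      exact ⟨this.2, this.1⟩
    · rw [h3] at h1; simp at h1
    · left
      exact huniq v' w' hv' hw' hN' (by nlinarith) (by nlinarith) h3
  · rintro (⟨rfl, rfl⟩ | ⟨rfl, rfl⟩)
    · exact ⟨⟨hv, hw⟩, hN, mul_pos (by linarith) hC, mul_pos hσw hC⟩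
    · refine ⟨⟨hw, hv⟩, h.symm _ _ hN, ?_, ?_⟩
      · rw [hanti]; nlinarith
      · change 0 < σ w' * _
        rw [hanti]; nlinarith

end IsStrictPolygon

/-- `z` maps `A` to the vertices of a limit of strictly convex polygons with adjacency
relation `N`. -/
structure IsWeakPolygon {ι : Type*} (A : Finset ι) (N : ι → ι → Prop) (z : ι → ℝ × ℝ) :
    Prop where
  symm : ∀ v w, N v w → N w v
  support : ∀ v ∈ A, ∀ w ∈ A, N v w → ∀ x ∈ A, ∀ x' ∈ A,
    0 ≤ cross (z w - z v) (z x - z v) * cross (z w - z v) (z x' - z v)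
  cross_barycentre_ne_zero : ∀ v ∈ A, ∀ w ∈ A, N v w →
    cross (z w - z v) (barycentre A z - z v) ≠ 0
  opposite : ∀ v ∈ A, ∀ w ∈ A, ∀ w' ∈ A, N v w → N v w' → w ≠ w' →
    cross (z w - z v) (barycentre A z - z v) * cross (z w' - z v) (barycentre A z - z v) < 0
  card_inWedge : ∀ d : ℝ × ℝ, (∀ v ∈ A, cross d (z v - barycentre A z) ≠ 0) →
    {e : ι × ι | e ∈ A ×ˢ A ∧ N e.1 e.2 ∧
      InWedge (z e.1 - barycentre A z) (z e.2 - barycentre A z) d}.ncard = 2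

theorem cross_eq_zero_of_cross_eq_zero {a b c : ℝ × ℝ} (ha : a ≠ 0) (hb : cross a b = 0)
    (hc : cross a c = 0) : cross b c = 0 := by
  have h1 : a.1 * cross b c = 0 := by
    have : a.1 * cross b c = b.1 * cross a c - c.1 * cross a b := by simp only [cross]; ring
    rw [this, hb, hc]; ring
  have h2 : a.2 * cross b c = 0 := by
    have : a.2 * cross b c = b.2 * cross a c - c.2 * cross a b := by simp only [cross]; ring
    rw [this, hb, hc]; ring
  by_contra hne
  exact ha (Prod.ext ((mul_eq_zero.1 h1).resolve_right hne) ((mul_eq_zero.1 h2).resolve_right hne))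

theorem Filter.Tendsto.eventually_pos_iff {α : Type*} {l : Filter α} {f : α → ℝ} {a : ℝ}
    (hf : Tendsto f l (𝓝 a)) (ha : a ≠ 0) : ∀ᶠ t in l, (0 < f t ↔ 0 < a) := by
  rcases lt_or_gt_of_ne ha with h | h
  · filter_upwards [hf.eventually (eventually_lt_nhds h)] with t ht
    exact ⟨fun h1 => absurd h1 ht.not_gt, fun h1 => absurd h1 h.not_gt⟩
  · filter_upwards [hf.eventually (eventually_gt_nhds h)] with t ht
    exact ⟨fun _ => h, fun _ => ht⟩

theorem Filter.Tendsto.barycentre {ι α E : Type*} [NormedAddCommGroup E] [NormedSpace ℝ E]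
    {l : Filter α} {A : Finset ι} {y : α → ι → E} {z : ι → E}
    (h : ∀ v ∈ A, Tendsto (fun t => y t v) l (𝓝 (z v))) :
    Tendsto (fun t => _root_.barycentre A (y t)) l (𝓝 (_root_.barycentre A z)) :=
  (tendsto_finsetSum A h).const_smul _

/-- Weak inequalities pass to the limit. The barycentre stays off the edge lines: otherwise heights
of one sign would sum to zero and all vertices would be collinear. For a direction generic in the
limit, the determinants deciding the wedges are therefore nonzero and have eventually constant
signs, so the count is inherited from one late polygon. -/
theorem IsWeakPolygon.of_tendsto {ι : Type*} {A : Finset ι} {N : ι → ι → Prop}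
    {y : ℕ → ι → ℝ × ℝ} {z : ι → ℝ × ℝ} (hy : ∀ᶠ t in atTop, IsStrictPolygon A N (y t))
    (hlim : ∀ v ∈ A, Tendsto (fun t => y t v) atTop (𝓝 (z v))) (hinj : Set.InjOn z A)
    (hnc : ∃ a ∈ A, ∃ b ∈ A, ∃ c ∈ A, cross (z b - z a) (z c - z a) ≠ 0) :
    IsWeakPolygon A N z := by
  classical
  obtain ⟨t₀, ht₀⟩ := hy.exists
  have hsup : ∀ v ∈ A, ∀ w ∈ A, N v w → ∀ x ∈ A, ∀ x' ∈ A,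
      0 ≤ cross (z w - z v) (z x - z v) * cross (z w - z v) (z x' - z v) := by
    intro v hv w hw hN x hx x' hx'
    have hl := (((hlim w hw).sub (hlim v hv)).cross ((hlim x hx).sub (hlim v hv))).mul
      (((hlim w hw).sub (hlim v hv)).cross ((hlim x' hx').sub (hlim v hv)))
    refine ge_of_tendsto hl ?_
    filter_upwards [hy] with t ht
    have hw0 : cross (y t w - y t v) (y t w - y t v) = 0 := by simp only [cross]; ring
    by_cases h1 : x = v
    · simp [h1, cross]
    by_cases h2 : x = w
    · rw [h2, hw0, zero_mul]
    by_cases h3 : x' = v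
    · simp [h3, cross]
    by_cases h4 : x' = w
    · rw [h4, hw0, mul_zero]
    exact ((ht.adj_iff v hv w hw (ht.ne _ _ hN)).1 hN x hx x' hx' h1 h2 h3 h4).le
  have hbary : ∀ v ∈ A, ∀ w ∈ A, N v w → cross (z w - z v) (barycentre A z - z v) ≠ 0 := by
    intro v hv w hw hN h0
    have h1 := sum_cross_eq ht₀.nonempty z v w
    rw [h0, mul_zero] at h1
    have hzero : ∀ x ∈ A, cross (z w - z v) (z x - z v) = 0 := by
      intro x hx
      have h2 : ∑ x' ∈ A, cross (z w - z v) (z x - z v) * cross (z w - z v) (z x' - z v) = 0 := by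
        rw [← Finset.mul_sum, h1, mul_zero]
      have h3 := (Finset.sum_eq_zero_iff_of_nonneg
        (fun x' hx' => hsup v hv w hw hN x hx x' hx')).1 h2 x hx
      exact mul_self_eq_zero.1 h3
    have hwv : z w - z v ≠ 0 := sub_ne_zero.2 fun e => ht₀.ne _ _ hN (hinj hw hv e).symm
    obtain ⟨a, ha, b, hb, c, hc, habc⟩ := hnc
    have h4 := cross_eq_zero_of_cross_eq_zero hwv (hzero b hb) (hzero c hc)
    have h5 := cross_eq_zero_of_cross_eq_zero hwv (hzero a ha) (hzero c hc)
    have h6 := cross_eq_zero_of_cross_eq_zero hwv (hzero a ha) (hzero b hb)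
    apply habc
    have : cross (z b - z a) (z c - z a) = cross (z b - z v) (z c - z v) -
        cross (z a - z v) (z c - z v) + cross (z a - z v) (z b - z v) := by
      simp only [cross, Prod.fst_sub, Prod.snd_sub]; ring
    rw [this, h4, h5, h6]; ring
  have hlo : Tendsto (fun t => barycentre A (y t)) atTop (𝓝 (barycentre A z)) :=
    Filter.Tendsto.barycentre hlim
  refine ⟨ht₀.symm, hsup, hbary, ?_, ?_⟩
  · intro v hv w hw w' hw' hN hN' hne
    have hl := (((hlim w hw).sub (hlim v hv)).cross (hlo.sub (hlim v hv))).mul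
      (((hlim w' hw').sub (hlim v hv)).cross (hlo.sub (hlim v hv)))
    refine lt_of_le_of_ne (le_of_tendsto hl ?_)
      (mul_ne_zero (hbary v hv w hw hN) (hbary v hv w' hw' hN'))
    filter_upwards [hy] with t ht
    exact (ht.cross_barycentre_mul_neg hv hw hw' hN hN' hne).le
  · intro d hd
    have hdef : ∀ᶠ t in atTop, ∀ v ∈ A, cross d (y t v - barycentre A (y t)) ≠ 0 := by
      rw [Filter.eventually_all_finset]
      intro v hv
      exact (tendsto_const_nhds.cross ((hlim v hv).sub hlo)).eventually_ne (hd v hv)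
    have hw : ∀ᶠ t in atTop, ∀ e ∈ A ×ˢ A, N e.1 e.2 →
        (InWedge (y t e.1 - barycentre A (y t)) (y t e.2 - barycentre A (y t)) d ↔
          InWedge (z e.1 - barycentre A z) (z e.2 - barycentre A z) d) := by
      rw [Filter.eventually_all_finset]
      rintro ⟨v, w⟩ he
      obtain ⟨hv, hw⟩ := Finset.mem_product.1 he
      by_cases hN : N v w
      · have hC : cross (z v - barycentre A z) (z w - barycentre A z) ≠ 0 := by
          rw [← cross_sub_sub]; exact hbary v hv w hw hN
        have hlv := (hlim v hv).sub hlo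
        have hlw := (hlim w hw).sub hlo
        have hd' : cross (z v - barycentre A z) d ≠ 0 := by
          have : cross (z v - barycentre A z) d = - cross d (z v - barycentre A z) := by
            simp only [cross]; ring
          rw [this]; exact neg_ne_zero.2 (hd v hv)
        have h1 := ((hlv.cross (tendsto_const_nhds (x := d))).mul
          (hlv.cross hlw)).eventually_pos_iff (mul_ne_zero hd' hC)
        have h2 := (((tendsto_const_nhds (x := d)).cross hlw).mul
          (hlv.cross hlw)).eventually_pos_iff (mul_ne_zero (hd w hw) hC)
        filter_upwards [h1, h2] with t ht1 ht2 _
        exact and_congr ht1 ht2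
      · exact Eventually.of_forall fun t h => absurd h hN
    obtain ⟨t, ht, ht1, ht2⟩ := (hy.and (hdef.and hw)).exists
    have := ht.card_inWedge ht1
    rw [← this]
    congr 1
    ext e
    simp only [Set.mem_ofPred_eq]
    refine and_congr_right fun he => and_congr_right fun hN => ?_
    exact (ht2 e he hN).symm

/-- The facet of a non-degenerate polyhedron, seen in the plane under a linear map that is
injective on its plane. -/
theorem IsNondegPolyhedron.isStrictPolygon {n m : ℕ} {q : Fin n → Space3}
    {F : Fin m → Finset (Fin n)} (h : IsNondegPolyhedron q F) (a : Fin m)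
    (L : Space3 →ₗ[ℝ] ℝ × ℝ) (c : Space3) (hL : ∃ b₀ ∈ F a, ∃ b₁ ∈ F a, ∃ b₂ ∈ F a,
      cross (L (q b₁ - q b₀)) (L (q b₂ - q b₀)) ≠ 0) :
    IsStrictPolygon (F a) (IsEdge F) (fun v => L (q v - c)) := by
  classical
  have hsub : ∀ v w, L (q w - c) - L (q v - c) = L (q w - q v) := by
    intro v w; rw [← map_sub]; congr 1; abel
  -- Any three vertices span the plane of the facet, so a triple that `L` does not flatten is
  -- expressed through them, its determinant being a multiple of theirs.
  have hne : ∀ v ∈ F a, ∀ w ∈ F a, ∀ x ∈ F a, v ≠ w → v ≠ x → w ≠ x →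
      cross (L (q w - q v)) (L (q x - q v)) ≠ 0 := by
    intro v hv w hw x hx hvw hvx hwx h0
    obtain ⟨b₀, h₀, b₁, h₁, b₂, h₂, hb⟩ := hL
    apply hb
    obtain ⟨α₀, β₀, e₀⟩ := h.facet_coords a hv hw hx h₀ hvw hvx hwx
    obtain ⟨α₁, β₁, e₁⟩ := h.facet_coords a hv hw hx h₁ hvw hvx hwx
    obtain ⟨α₂, β₂, e₂⟩ := h.facet_coords a hv hw hx h₂ hvw hvx hwx
    have f₁ : q b₁ - q b₀ = (α₁ - α₀) • (q w - q v) + (β₁ - β₀) • (q x - q v) := by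
      rw [sub_smul, sub_smul, ← sub_sub_sub_cancel_right (q b₁) (q b₀) (q v), ← e₀, ← e₁]; abel
    have f₂ : q b₂ - q b₀ = (α₂ - α₀) • (q w - q v) + (β₂ - β₀) • (q x - q v) := by
      rw [sub_smul, sub_smul, ← sub_sub_sub_cancel_right (q b₂) (q b₀) (q v), ← e₀, ← e₂]; abel
    have : cross (L (q b₁ - q b₀)) (L (q b₂ - q b₀)) =
        ((α₁ - α₀) * (β₂ - β₀) - (β₁ - β₀) * (α₂ - α₀)) *
          cross (L (q w - q v)) (L (q x - q v)) := by
      rw [f₁, f₂]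
      simp only [map_add, map_smul, cross, Prod.fst_add, Prod.snd_add, Prod.smul_fst,
        Prod.smul_snd, smul_eq_mul]
      ring
    rw [this, h0, mul_zero]
  refine ⟨?_, ?_, fun v w e => e.1, ?_, ?_⟩
  · obtain ⟨v, hv⟩ : (F a).Nonempty := by
      rw [Finset.nonempty_iff_ne_empty]
      intro e
      have := h.finrank_facet a
      rw [e, Finset.coe_empty, Set.image_empty, vectorSpan_empty, finrank_bot] at this
      omega
    obtain ⟨w, hw, hwv, -⟩ := h.exists_third a v v
    obtain ⟨x, hx, hxv, hxw⟩ := h.exists_third a v w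
    have : ({v, w, x} : Finset (Fin n)) ⊆ F a := by
      intro y hy
      simp only [Finset.mem_insert, Finset.mem_singleton] at hy
      rcases hy with rfl | rfl | rfl <;> assumption
    have h3 := Finset.card_le_card this
    rwa [Finset.card_eq_three.2 ⟨v, w, x, hwv.symm, hxv.symm, hxw.symm, rfl⟩] at h3
  · rintro v w ⟨hvw, i, j, hij, e⟩
    exact ⟨hvw.symm, i, j, hij, by rw [e, Finset.pair_comm]⟩
  · intro v hv w hw x hx hvw hvx hwx
    rw [hsub, hsub]
    exact hne v hv w hw x hx hvw hvx hwx
  · intro v hv w hw hvw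
    simp only [hsub]
    have hww : cross (L (q w - q v)) (L (q w - q v)) = 0 := by simp only [cross]; ring
    constructor
    · intro hN
      obtain ⟨-, -, -, f, hf, hf0⟩ := h.faceEdge_iff.2 ⟨hv, hw, hN⟩
      have hfw := (hf0 w hw).2 (Or.inr rfl)
      obtain ⟨u, hu, huv, huw⟩ := h.exists_third a v w
      have hneg : ∀ x ∈ F a, x ≠ v → x ≠ w → f (q x - q v) < 0 := fun x hx h1 h2 =>
        lt_of_le_of_ne (hf x hx) fun e => by
          rcases (hf0 x hx).1 e with h3 | h3 <;> contradiction
      have key : ∀ x ∈ F a, x ≠ v → x ≠ w → ∃ β : ℝ, 0 < β ∧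
          cross (L (q w - q v)) (L (q x - q v)) = β * cross (L (q w - q v)) (L (q u - q v)) := by
        intro x hx h1 h2
        obtain ⟨α, β, e⟩ := h.facet_coords a hv hw hu hx hvw huv.symm huw.symm
        refine ⟨β, ?_, ?_⟩
        · have h3 := hneg x hx h1 h2
          rw [← e] at h3
          simp only [map_add, map_smul, hfw, smul_eq_mul, mul_zero, zero_add] at h3
          have := hneg u hu huv huw
          by_contra! hc
          have := mul_nonneg_of_nonpos_of_nonpos hc this.le
          linarith
        · rw [← e, map_add, map_smul, map_smul, cross_add_right, cross_smul_right,
            cross_smul_right, hww]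
          ring
      intro x hx x' hx' h1 h2 h3 h4
      obtain ⟨β, hβ, e⟩ := key x hx h1 h2
      obtain ⟨β', hβ', e'⟩ := key x' hx' h3 h4
      rw [e, e']
      have := hne v hv w hw u hu hvw huv.symm huw.symm
      have := mul_pos (mul_pos hβ hβ') (pow_two_pos_of_ne_zero this)
      nlinarith
    · intro hall
      obtain ⟨u, hu, huv, huw⟩ := h.exists_third a v w
      refine (h.faceEdge_iff.1 ⟨hvw, hv, hw,
        (-(cross (L (q w - q v)) (L (q u - q v)))) • (crossLinear (L (q w - q v))).comp L,
        fun x hx => ?_, fun x hx => ⟨fun e => ?_, ?_⟩⟩).2.2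
      · change -(cross (L (q w - q v)) (L (q u - q v))) * cross (L (q w - q v)) (L (q x - q v)) ≤ 0
        by_cases h1 : x = v
        · simp [h1, cross]
        by_cases h2 : x = w
        · rw [h2, hww, mul_zero]
        have := hall u hu x hx huv huw h1 h2
        linarith
      · change -(cross (L (q w - q v)) (L (q u - q v))) * cross (L (q w - q v)) (L (q x - q v)) = 0
          at e
        by_contra! hc
        have := hall u hu x hx huv huw hc.1 hc.2
        linarith
      · change x = v ∨ x = w → -(cross (L (q w - q v)) (L (q u - q v))) *
          cross (L (q w - q v)) (L (q x - q v)) = 0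
        rintro (rfl | rfl)
        · simp [cross]
        · rw [hww, mul_zero]

/-! ### Recentring the projective model at a point. -/

/-- A linear map carrying the hyperbolic metric at `o` to the Euclidean one. -/
noncomputable def frameMap (o : Space3) : Space3 →ₗ[ℝ] Space3 :=
  (√(1 - ‖o‖ ^ 2))⁻¹ • (LinearMap.id +
    ((√(1 - ‖o‖ ^ 2) * (1 + √(1 - ‖o‖ ^ 2)))⁻¹ • (innerₛₗ ℝ o)).smulRight o)

/-- The hyperbolic isometry carrying `o` to the centre of the ball. -/
noncomputable def boost (o x : Space3) : Space3 :=
  ((1 - ‖o‖ ^ 2) / (1 - inner ℝ o x)) • frameMap o (x - o)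

/-- The hyperbolic angle at `x` between the rays to `a` and `b`, zero at an infinite point. -/
noncomputable def hypAngle (x a b : Space3) : ℝ :=
  if ‖x‖ < 1 then InnerProductGeometry.angle (frameMap x (a - x)) (frameMap x (b - x)) else 0

theorem one_sub_norm_sq_pos {x : Space3} (hx : ‖x‖ < 1) : 0 < 1 - ‖x‖ ^ 2 := by
  nlinarith [norm_nonneg x]

theorem one_sub_inner_pos {o x : Space3} (ho : ‖o‖ < 1) (hx : ‖x‖ ≤ 1) :
    0 < 1 - inner ℝ o x := by
  have h1 := real_inner_le_norm o x
  nlinarith [norm_nonneg x, norm_nonneg o]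

/-- With `N = 1 - ‖o‖ ^ 2`, the map multiplies by `1 / N` along `o` and by `1 / √N` orthogonally to
it: it is the positive square root of the metric at `o`. -/
theorem inner_frameMap {o : Space3} (ho : ‖o‖ < 1) (a b : Space3) :
    inner ℝ (frameMap o a) (frameMap o b) = kleinMetric o a b := by
  have hN := one_sub_norm_sq_pos ho
  set s := √(1 - ‖o‖ ^ 2) with hs
  have hs0 : 0 < s := Real.sqrt_pos.2 hN
  have hs2 : s ^ 2 = 1 - ‖o‖ ^ 2 := Real.sq_sqrt hN.le
  have hoo : inner ℝ o o = 1 - s ^ 2 := by rw [hs2, real_inner_self_eq_norm_sq]; ring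
  have happ : ∀ a, frameMap o a = s⁻¹ • (a + ((s * (1 + s))⁻¹ * inner ℝ o a) • o) := by
    intro a; simp [frameMap, ← hs]
  rw [happ, happ, kleinMetric, ← hs2]
  simp only [inner_smul_left, inner_smul_right, inner_add_left, inner_add_right, hoo,
    RCLike.conj_to_real, real_inner_comm o a]
  field_simp
  ring

theorem norm_sq_le_kleinMetric {o : Space3} (ho : ‖o‖ < 1) (a : Space3) :
    ‖a‖ ^ 2 ≤ kleinMetric o a a := by
  have hN := one_sub_norm_sq_pos ho
  rw [kleinMetric, real_inner_self_eq_norm_sq]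
  have h1 : ‖a‖ ^ 2 ≤ ‖a‖ ^ 2 / (1 - ‖o‖ ^ 2) := by
    rw [le_div_iff₀ hN]; nlinarith [sq_nonneg ‖a‖, sq_nonneg ‖o‖, mul_nonneg (sq_nonneg ‖a‖) (sq_nonneg ‖o‖)]
  have h2 : 0 ≤ inner ℝ o a * inner ℝ o a / (1 - ‖o‖ ^ 2) ^ 2 := by
    have := mul_self_nonneg (inner ℝ o a); positivity
  linarith

theorem frameMap_injective {o : Space3} (ho : ‖o‖ < 1) : Function.Injective (frameMap o) := by
  rw [injective_iff_map_eq_zero]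
  intro a ha
  have h := norm_sq_le_kleinMetric ho a
  rw [← inner_frameMap ho, ha, inner_zero_left] at h
  have : ‖a‖ = 0 := by nlinarith [norm_nonneg a]
  exact norm_eq_zero.1 this

theorem inner_frameMap_sub {o : Space3} (ho : ‖o‖ < 1) (x y : Space3) :
    inner ℝ (frameMap o (x - o)) (frameMap o (y - o)) =
      ((1 - inner ℝ o x) * (1 - inner ℝ o y) / (1 - ‖o‖ ^ 2) - (1 - inner ℝ x y)) /
        (1 - ‖o‖ ^ 2) := by
  have hN := one_sub_norm_sq_pos ho
  rw [inner_frameMap ho, kleinMetric]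
  simp only [inner_sub_left, inner_sub_right, real_inner_self_eq_norm_sq, real_inner_comm o x]
  field_simp
  ring

/-- Here `1 - ⟪x, y⟫` is the Lorentz product of the lifts `(1, x)` and `(1, y)`. An isometry
preserves it up to the rescaling of the lifts, and the trigonometry below rests on this identity. -/
theorem inner_boost {o : Space3} (ho : ‖o‖ < 1) {x y : Space3} (hx : 1 - inner ℝ o x ≠ 0)
    (hy : 1 - inner ℝ o y ≠ 0) :
    1 - inner ℝ (boost o x) (boost o y) =
      (1 - ‖o‖ ^ 2) * (1 - inner ℝ x y) / ((1 - inner ℝ o x) * (1 - inner ℝ o y)) := by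
  have hN := one_sub_norm_sq_pos ho
  rw [boost, boost, inner_smul_left, inner_smul_right, inner_frameMap_sub ho]
  simp only [RCLike.conj_to_real]
  field_simp
  ring

theorem norm_boost_sq {o : Space3} (ho : ‖o‖ < 1) {x : Space3} (hx : 1 - inner ℝ o x ≠ 0) :
    1 - ‖boost o x‖ ^ 2 = (1 - ‖o‖ ^ 2) * (1 - ‖x‖ ^ 2) / (1 - inner ℝ o x) ^ 2 := by
  have := inner_boost ho hx hx
  rw [real_inner_self_eq_norm_sq, real_inner_self_eq_norm_sq] at this
  rw [this, sq (1 - inner ℝ o x)]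

/-- A frame at the point `o` of a plane: an orthonormal basis of the plane moved to the centre. -/
structure IsFrame (a e₁ e₂ o b₁ b₂ : Space3) : Prop where
  norm_lt : ‖o‖ < 1
  mem : ∃ z, planeChart a e₁ e₂ z = o
  indep : LinearIndependent ℝ ![e₁, e₂]
  inner₁₁ : inner ℝ b₁ b₁ = (1 : ℝ)
  inner₁₂ : inner ℝ b₁ b₂ = (0 : ℝ)
  inner₂₂ : inner ℝ b₂ b₂ = (1 : ℝ)
  span₁ : ∃ α β : ℝ, frameMap o e₁ = α • b₁ + β • b₂
  span₂ : ∃ α β : ℝ, frameMap o e₂ = α • b₁ + β • b₂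

/-- The coordinates of the projective disk model centred at `o`. -/
noncomputable def diskCoord (o b₁ b₂ x : Space3) : ℝ × ℝ :=
  (inner ℝ b₁ (boost o x), inner ℝ b₂ (boost o x))

/-- The area density of the projective disk model. -/
noncomputable def diskDensity (y : ℝ × ℝ) : ℝ :=
  1 / ((1 - (y.1 ^ 2 + y.2 ^ 2)) * √(1 - (y.1 ^ 2 + y.2 ^ 2)))

theorem planeChart_sub (a e₁ e₂ : Space3) (z z' : ℝ × ℝ) :
    planeChart a e₁ e₂ z - planeChart a e₁ e₂ z' = (z.1 - z'.1) • e₁ + (z.2 - z'.2) • e₂ := by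
  simp only [planeChart, sub_smul]; abel

theorem continuous_planeChart (a e₁ e₂ : Space3) : Continuous (planeChart a e₁ e₂) := by
  unfold planeChart; fun_prop

theorem measurable_diskCoord (o b₁ b₂ : Space3) : Measurable (diskCoord o b₁ b₂) := by
  have hf : Continuous (frameMap o) := (frameMap o).continuous_of_finiteDimensional
  have h1 : Measurable fun x : Space3 => (1 - ‖o‖ ^ 2) / (1 - inner ℝ o x) :=
    measurable_const.div (by fun_prop)
  have h2 : Measurable fun x : Space3 => frameMap o (x - o) := (hf.comp (by fun_prop)).measurable
  have : Measurable (boost o) := h1.smul h2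
  unfold diskCoord
  refine Measurable.prodMk ?_ ?_
  · exact (continuous_const.inner continuous_id).measurable.comp this
  · exact (continuous_const.inner continuous_id).measurable.comp this

theorem hasFDerivAt_homography {N k₁ k₂ m₁ m₂ : ℝ} {z₀ z : ℝ × ℝ}
    (hL : N - (k₁ * (z.1 - z₀.1) + k₂ * (z.2 - z₀.2)) ≠ 0) :
    HasFDerivAt (fun z : ℝ × ℝ => N * (m₁ * (z.1 - z₀.1) + m₂ * (z.2 - z₀.2)) /
        (N - (k₁ * (z.1 - z₀.1) + k₂ * (z.2 - z₀.2))))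
      ((N * (m₁ * (N - (k₁ * (z.1 - z₀.1) + k₂ * (z.2 - z₀.2))) +
          k₁ * (m₁ * (z.1 - z₀.1) + m₂ * (z.2 - z₀.2))) /
          (N - (k₁ * (z.1 - z₀.1) + k₂ * (z.2 - z₀.2))) ^ 2) • ContinuousLinearMap.fst ℝ ℝ ℝ +
        (N * (m₂ * (N - (k₁ * (z.1 - z₀.1) + k₂ * (z.2 - z₀.2))) +
          k₂ * (m₁ * (z.1 - z₀.1) + m₂ * (z.2 - z₀.2))) /
          (N - (k₁ * (z.1 - z₀.1) + k₂ * (z.2 - z₀.2))) ^ 2) • ContinuousLinearMap.snd ℝ ℝ ℝ) z := by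
  have h1 : HasFDerivAt (fun z : ℝ × ℝ => z.1 - z₀.1) (ContinuousLinearMap.fst ℝ ℝ ℝ) z :=
    hasFDerivAt_fst.sub_const _
  have h2 : HasFDerivAt (fun z : ℝ × ℝ => z.2 - z₀.2) (ContinuousLinearMap.snd ℝ ℝ ℝ) z :=
    hasFDerivAt_snd.sub_const _
  have hnum := ((h1.const_mul m₁).add (h2.const_mul m₂)).const_mul N
  have hden := ((h1.const_mul k₁).add (h2.const_mul k₂)).const_sub N
  have hinv := (hasDerivAt_inv hL).comp_hasFDerivAt z hden
  have := hnum.mul hinv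
  refine (this.congr_fderiv ?_).congr_of_eventuallyEq (Eventually.of_forall fun z => ?_)
  · ext <;> simp [div_eq_mul_inv] <;> field_simp <;> ring
  · simp [div_eq_mul_inv]

theorem linear_dependent_of_det_eq_zero {a b c d : ℝ} (h : a * d - b * c = 0) :
    ∃ x y : ℝ, (x ≠ 0 ∨ y ≠ 0) ∧ a * x + b * y = 0 ∧ c * x + d * y = 0 := by
  by_cases h1 : a = 0 ∧ b = 0
  · by_cases h2 : c = 0 ∧ d = 0
    · exact ⟨1, 0, by simp, by simp [h1], by simp [h2]⟩
    · refine ⟨d, -c, ?_, by simp [h1], by ring⟩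
      rw [neg_ne_zero]; tauto
  · refine ⟨b, -a, ?_, by ring, by linarith⟩
    rw [neg_ne_zero]; tauto

namespace IsFrame

variable {a e₁ e₂ o b₁ b₂ : Space3}

/-- The coordinates of the frame as an explicit homography. -/
theorem exists_matrix (h : IsFrame a e₁ e₂ o b₁ b₂) :
    ∃ (z₀ : ℝ × ℝ) (m₁₁ m₁₂ m₂₁ m₂₂ : ℝ), planeChart a e₁ e₂ z₀ = o ∧
      m₁₁ * m₂₂ - m₁₂ * m₂₁ ≠ 0 ∧
      frameMap o e₁ = m₁₁ • b₁ + m₂₁ • b₂ ∧ frameMap o e₂ = m₁₂ • b₁ + m₂₂ • b₂ ∧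
      (∀ z, 1 - inner ℝ o (planeChart a e₁ e₂ z) =
        1 - ‖o‖ ^ 2 - (inner ℝ o e₁ * (z.1 - z₀.1) + inner ℝ o e₂ * (z.2 - z₀.2))) ∧
      (∀ z, boost o (planeChart a e₁ e₂ z) =
        (diskCoord o b₁ b₂ (planeChart a e₁ e₂ z)).1 • b₁ +
          (diskCoord o b₁ b₂ (planeChart a e₁ e₂ z)).2 • b₂) ∧
      ∀ z, diskCoord o b₁ b₂ (planeChart a e₁ e₂ z) =
        ((1 - ‖o‖ ^ 2) * (m₁₁ * (z.1 - z₀.1) + m₁₂ * (z.2 - z₀.2)) /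
          (1 - ‖o‖ ^ 2 - (inner ℝ o e₁ * (z.1 - z₀.1) + inner ℝ o e₂ * (z.2 - z₀.2))),
        (1 - ‖o‖ ^ 2) * (m₂₁ * (z.1 - z₀.1) + m₂₂ * (z.2 - z₀.2)) /
          (1 - ‖o‖ ^ 2 - (inner ℝ o e₁ * (z.1 - z₀.1) + inner ℝ o e₂ * (z.2 - z₀.2)))) := by
  obtain ⟨z₀, hz₀⟩ := h.mem
  obtain ⟨m₁₁, m₂₁, h1⟩ := h.span₁
  obtain ⟨m₁₂, m₂₂, h2⟩ := h.span₂
  have hb : inner ℝ b₂ b₁ = (0 : ℝ) := by rw [real_inner_comm, h.inner₁₂]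
  have hL : ∀ z, 1 - inner ℝ o (planeChart a e₁ e₂ z) =
      1 - ‖o‖ ^ 2 - (inner ℝ o e₁ * (z.1 - z₀.1) + inner ℝ o e₂ * (z.2 - z₀.2)) := by
    intro z
    have e : planeChart a e₁ e₂ z = o + ((z.1 - z₀.1) • e₁ + (z.2 - z₀.2) • e₂) := by
      rw [← planeChart_sub, hz₀]; abel
    rw [e, inner_add_right, inner_add_right, inner_smul_right, inner_smul_right,
      real_inner_self_eq_norm_sq]
    ring
  have hB : ∀ z, boost o (planeChart a e₁ e₂ z) =
      ((1 - ‖o‖ ^ 2) / (1 - inner ℝ o (planeChart a e₁ e₂ z))) •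
      ((m₁₁ * (z.1 - z₀.1) + m₁₂ * (z.2 - z₀.2)) • b₁ +
        (m₂₁ * (z.1 - z₀.1) + m₂₂ * (z.2 - z₀.2)) • b₂) := by
    intro z
    have e : planeChart a e₁ e₂ z - o = (z.1 - z₀.1) • e₁ + (z.2 - z₀.2) • e₂ := by
      rw [← planeChart_sub, hz₀]
    rw [boost, e, map_add, map_smul, map_smul, h1, h2]
    congr 1
    module
  refine ⟨z₀, m₁₁, m₁₂, m₂₁, m₂₂, hz₀, ?_, h1, h2, hL, ?_, ?_⟩
  · intro hdet
    obtain ⟨x, y, hxy, hx, hy⟩ := linear_dependent_of_det_eq_zero hdet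
    have h0 : frameMap o (x • e₁ + y • e₂) = 0 := by
      rw [map_add, map_smul, map_smul, h1, h2]
      have : x • (m₁₁ • b₁ + m₂₁ • b₂) + y • (m₁₂ • b₁ + m₂₂ • b₂) =
        (m₁₁ * x + m₁₂ * y) • b₁ + (m₂₁ * x + m₂₂ * y) • b₂ := by module
      rw [this, hx, hy]; simp
    have h3 := frameMap_injective h.norm_lt (h0.trans (map_zero _).symm)
    obtain ⟨hx0, hy0⟩ := LinearIndependent.pair_iff.1 h.indep x y h3
    tauto
  · intro z
    simp only [diskCoord]
    rw [hB]
    simp only [inner_smul_right, inner_add_right, h.inner₁₁, h.inner₁₂, h.inner₂₂, hb]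
    module
  · intro z
    rw [diskCoord, hB, hL]
    simp only [inner_smul_right, inner_add_right, h.inner₁₁, h.inner₁₂, h.inner₂₂, hb]
    ext
    · simp only; ring
    · simp only; ring

theorem one_sub_diskCoord (h : IsFrame a e₁ e₂ o b₁ b₂) {z : ℝ × ℝ}
    (hz : 1 - inner ℝ o (planeChart a e₁ e₂ z) ≠ 0) :
    1 - ((diskCoord o b₁ b₂ (planeChart a e₁ e₂ z)).1 ^ 2 +
        (diskCoord o b₁ b₂ (planeChart a e₁ e₂ z)).2 ^ 2) =
      (1 - ‖o‖ ^ 2) * (1 - ‖planeChart a e₁ e₂ z‖ ^ 2) /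
        (1 - inner ℝ o (planeChart a e₁ e₂ z)) ^ 2 := by
  obtain ⟨-, -, -, -, -, -, -, -, -, -, hB, -⟩ := h.exists_matrix
  have hb : inner ℝ b₂ b₁ = (0 : ℝ) := by rw [real_inner_comm, h.inner₁₂]
  rw [← norm_boost_sq h.norm_lt hz, ← real_inner_self_eq_norm_sq, hB]
  simp only [inner_smul_right, inner_smul_left, inner_add_right, inner_add_left, h.inner₁₁,
    h.inner₁₂, h.inner₂₂, hb, RCLike.conj_to_real]
  ring

theorem diskCoord_mem_iff (h : IsFrame a e₁ e₂ o b₁ b₂) {z : ℝ × ℝ}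
    (hz : 0 < 1 - inner ℝ o (planeChart a e₁ e₂ z)) :
    (diskCoord o b₁ b₂ (planeChart a e₁ e₂ z)).1 ^ 2 +
        (diskCoord o b₁ b₂ (planeChart a e₁ e₂ z)).2 ^ 2 < 1 ↔ ‖planeChart a e₁ e₂ z‖ < 1 := by
  have h1 := h.one_sub_diskCoord hz.ne'
  have hN := one_sub_norm_sq_pos h.norm_lt
  rw [← sub_pos, h1, div_pos_iff_of_pos_right (by positivity), mul_pos_iff_of_pos_left hN, sub_pos,
    sq_lt_one_iff₀ (norm_nonneg _)]

theorem injOn (h : IsFrame a e₁ e₂ o b₁ b₂) :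
    Set.InjOn (fun z => diskCoord o b₁ b₂ (planeChart a e₁ e₂ z))
      {z | ‖planeChart a e₁ e₂ z‖ < 1} := by
  obtain ⟨z₀, m₁₁, m₁₂, m₂₁, m₂₂, hz₀, hdet, -, -, hL, -, hψ⟩ := h.exists_matrix
  intro z hz z' hz' he
  have hN := one_sub_norm_sq_pos h.norm_lt
  have h1 := one_sub_inner_pos h.norm_lt (le_of_lt hz)
  have h2 := one_sub_inner_pos h.norm_lt (le_of_lt hz')
  simp only [hψ, Prod.mk.injEq] at he
  rw [hL] at h1 h2
  set N := 1 - ‖o‖ ^ 2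
  set k₁ : ℝ := inner ℝ o e₁
  set k₂ : ℝ := inner ℝ o e₂
  set L := N - (k₁ * (z.1 - z₀.1) + k₂ * (z.2 - z₀.2)) with hLdef
  set L' := N - (k₁ * (z'.1 - z₀.1) + k₂ * (z'.2 - z₀.2)) with hLdef'
  obtain ⟨he1, he2⟩ := he
  rw [div_eq_div_iff h1.ne' h2.ne'] at he1 he2
  have f1 : m₁₁ * ((z.1 - z₀.1) * L' - (z'.1 - z₀.1) * L) +
      m₁₂ * ((z.2 - z₀.2) * L' - (z'.2 - z₀.2) * L) = 0 := by
    apply mul_left_cancel₀ hN.ne'; linear_combination he1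
  have f2 : m₂₁ * ((z.1 - z₀.1) * L' - (z'.1 - z₀.1) * L) +
      m₂₂ * ((z.2 - z₀.2) * L' - (z'.2 - z₀.2) * L) = 0 := by
    apply mul_left_cancel₀ hN.ne'; linear_combination he2
  have g1 : (z.1 - z₀.1) * L' - (z'.1 - z₀.1) * L = 0 := by
    apply mul_left_cancel₀ hdet; linear_combination m₂₂ * f1 - m₁₂ * f2
  have g2 : (z.2 - z₀.2) * L' - (z'.2 - z₀.2) * L = 0 := by
    apply mul_left_cancel₀ hdet; linear_combination m₁₁ * f2 - m₂₁ * f1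
  -- By `g1` and `g2` the vectors `z - z₀` and `z' - z₀` are in the ratio `L : L'`. As `L` is `N`
  -- minus a linear function of `z - z₀`, the ratio is one.
  have hLL : L = L' := by
    apply mul_left_cancel₀ hN.ne'
    have e1 : N * L = N * L + 0 := by ring
    have : N * L - N * L' = -(k₁ * ((z.1 - z₀.1) * L' - (z'.1 - z₀.1) * L) +
      k₂ * ((z.2 - z₀.2) * L' - (z'.2 - z₀.2) * L)) - 0 := by
      have e3 : k₁ * (z.1 - z₀.1) + k₂ * (z.2 - z₀.2) = N - L := by rw [hLdef]; ring
      have e4 : k₁ * (z'.1 - z₀.1) + k₂ * (z'.2 - z₀.2) = N - L' := by rw [hLdef']; ring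
      linear_combination (-L') * e3 + L * e4
    rw [g1, g2] at this
    linarith
  rw [hLL, ← sub_mul] at g1 g2
  have g1 := (mul_eq_zero.1 g1).resolve_right h2.ne'
  have g2 := (mul_eq_zero.1 g2).resolve_right h2.ne'
  ext <;> linarith

theorem surjOn (h : IsFrame a e₁ e₂ o b₁ b₂) {y : ℝ × ℝ} (hy : y.1 ^ 2 + y.2 ^ 2 < 1) :
    ∃ z, ‖planeChart a e₁ e₂ z‖ < 1 ∧ diskCoord o b₁ b₂ (planeChart a e₁ e₂ z) = y := by
  obtain ⟨z₀, m₁₁, m₁₂, m₂₁, m₂₂, hz₀, hdet, h1, h2, hL, -, hψ⟩ := h.exists_matrix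
  have hN := one_sub_norm_sq_pos h.norm_lt
  have hb : inner ℝ b₂ b₁ = (0 : ℝ) := by rw [real_inner_comm, h.inner₁₂]
  set D := m₁₁ * m₂₂ - m₁₂ * m₂₁ with hD
  set η₁ := (m₂₂ * y.1 - m₁₂ * y.2) / D with hη₁
  set η₂ := (m₁₁ * y.2 - m₂₁ * y.1) / D with hη₂
  have hy1 : m₁₁ * η₁ + m₁₂ * η₂ = y.1 := by rw [hη₁, hη₂]; field_simp; rw [hD]; ring
  have hy2 : m₂₁ * η₁ + m₂₂ * η₂ = y.2 := by rw [hη₁, hη₂]; field_simp; rw [hD]; ring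
  set N := 1 - ‖o‖ ^ 2 with hNdef
  set k₁ : ℝ := inner ℝ o e₁ with hk₁
  set k₂ : ℝ := inner ℝ o e₂ with hk₂
  -- The preimage of `y` under `frameMap o` has metric length less than one, and the second term of
  -- `kleinMetric` alone bounds its inner product with `o`.
  have hk : |k₁ * η₁ + k₂ * η₂| < N := by
    have e1 : frameMap o (η₁ • e₁ + η₂ • e₂) = y.1 • b₁ + y.2 • b₂ := by
      rw [map_add, map_smul, map_smul, h1, h2, ← hy1, ← hy2]; module
    have e2 : kleinMetric o (η₁ • e₁ + η₂ • e₂) (η₁ • e₁ + η₂ • e₂) = y.1 ^ 2 + y.2 ^ 2 := by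
      rw [← inner_frameMap h.norm_lt, e1]
      simp only [inner_smul_right, inner_smul_left, inner_add_right, inner_add_left, h.inner₁₁,
        h.inner₁₂, h.inner₂₂, hb, RCLike.conj_to_real]
      ring
    have e3 : inner ℝ o (η₁ • e₁ + η₂ • e₂) = k₁ * η₁ + k₂ * η₂ := by
      rw [inner_add_right, inner_smul_right, inner_smul_right]; ring
    rw [kleinMetric, e3, ← hNdef] at e2
    have e4 : 0 ≤ inner ℝ (η₁ • e₁ + η₂ • e₂) (η₁ • e₁ + η₂ • e₂) / N :=
      div_nonneg real_inner_self_nonneg hN.le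
    have e5 : (k₁ * η₁ + k₂ * η₂) * (k₁ * η₁ + k₂ * η₂) / N ^ 2 < 1 := by linarith
    rw [div_lt_one (by positivity)] at e5
    exact abs_lt_of_sq_lt_sq (by linarith [sq (k₁ * η₁ + k₂ * η₂)]) hN.le
  rw [abs_lt] at hk
  have hpos : 0 < N + (k₁ * η₁ + k₂ * η₂) := by linarith
  -- At `z₀ + t η` the homography has the value `N t y / (N - t k·η)`; this `t` makes the factor of
  -- `y` equal to one.
  set t := N / (N + (k₁ * η₁ + k₂ * η₂)) with ht
  have htpos : 0 < t := div_pos hN hpos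
  have htN : t * (N + (k₁ * η₁ + k₂ * η₂)) = N := div_mul_cancel₀ _ hpos.ne'
  set z : ℝ × ℝ := (z₀.1 + t * η₁, z₀.2 + t * η₂) with hz
  have hL1 : N - (k₁ * (z.1 - z₀.1) + k₂ * (z.2 - z₀.2)) = t * N := by
    rw [hz]; simp only; linear_combination (-1 : ℝ) * htN
  have hψz : diskCoord o b₁ b₂ (planeChart a e₁ e₂ z) = y := by
    rw [hψ, hL1]
    ext
    · simp only [hz]
      rw [← hy1]; field_simp; ring
    · simp only [hz]
      rw [← hy2]; field_simp; ring
  refine ⟨z, ?_, hψz⟩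
  rw [← h.diskCoord_mem_iff (by rw [hL, hL1]; positivity), hψz]
  exact hy

/-- Up to sign both sides are the Lorentz Gram determinant of the lift of a point and the two
tangent vectors. It does not change when the point moves by a combination of these vectors. -/
theorem gram_mul_pow {o e₁ e₂ : Space3} (ζ₁ ζ₂ : ℝ) {x : Space3} (hx : x = o + (ζ₁ • e₁ + ζ₂ • e₂))
    (ho : 1 - ‖o‖ ^ 2 ≠ 0) (hx0 : 1 - ‖x‖ ^ 2 ≠ 0) :
    (kleinMetric x e₁ e₁ * kleinMetric x e₂ e₂ - kleinMetric x e₁ e₂ ^ 2) * (1 - ‖x‖ ^ 2) ^ 3 =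
      (kleinMetric o e₁ e₁ * kleinMetric o e₂ e₂ - kleinMetric o e₁ e₂ ^ 2) *
        (1 - ‖o‖ ^ 2) ^ 3 := by
  have key : ∀ x : Space3, 1 - ‖x‖ ^ 2 ≠ 0 →
      (kleinMetric x e₁ e₁ * kleinMetric x e₂ e₂ - kleinMetric x e₁ e₂ ^ 2) * (1 - ‖x‖ ^ 2) ^ 3 =
      (inner ℝ e₁ e₁ * inner ℝ e₂ e₂ - inner ℝ e₁ e₂ ^ 2) * (1 - ‖x‖ ^ 2) +
      (inner ℝ e₁ e₁ * inner ℝ x e₂ ^ 2 + inner ℝ e₂ e₂ * inner ℝ x e₁ ^ 2 -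
        2 * inner ℝ e₁ e₂ * inner ℝ x e₁ * inner ℝ x e₂) := by
    intro x hx
    simp only [kleinMetric]
    field_simp
    ring
  rw [key x hx0, key o ho, ← real_inner_self_eq_norm_sq x, ← real_inner_self_eq_norm_sq o, hx]
  simp only [inner_add_left, inner_add_right, inner_smul_left, inner_smul_right,
    RCLike.conj_to_real, real_inner_comm o e₁, real_inner_comm o e₂, real_inner_comm e₁ e₂]
  ring

/-- The Jacobian of the homography is `N ^ 3 * det / L ^ 3`. Combined with `gram_mul_pow` it turns
the area density of any chart into the same rotationally symmetric density. -/
theorem lintegral_image (h : IsFrame a e₁ e₂ o b₁ b₂) {Z : Set (ℝ × ℝ)} (hZm : MeasurableSet Z)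
    (hZ : ∀ z ∈ Z, ‖planeChart a e₁ e₂ z‖ < 1) :
    ∫⁻ y in (fun z => diskCoord o b₁ b₂ (planeChart a e₁ e₂ z)) '' Z, ENNReal.ofReal (diskDensity y)
      = ∫⁻ z in Z, ENNReal.ofReal (areaDensity (planeChart a e₁ e₂ z) e₁ e₂) := by
  obtain ⟨z₀, m₁₁, m₁₂, m₂₁, m₂₂, hz₀, hdet, h1, h2, hL, hB, hψ⟩ := h.exists_matrix
  have hN := one_sub_norm_sq_pos h.norm_lt
  have hb : inner ℝ b₂ b₁ = (0 : ℝ) := by rw [real_inner_comm, h.inner₁₂]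
  have hLpos : ∀ z ∈ Z, 0 < 1 - ‖o‖ ^ 2 -
      (inner ℝ o e₁ * (z.1 - z₀.1) + inner ℝ o e₂ * (z.2 - z₀.2)) := fun z hz => by
    rw [← hL]; exact one_sub_inner_pos h.norm_lt (hZ z hz).le
  set N := 1 - ‖o‖ ^ 2 with hNdef
  set k₁ : ℝ := inner ℝ o e₁ with hk₁
  set k₂ : ℝ := inner ℝ o e₂ with hk₂
  set L : ℝ × ℝ → ℝ := fun z => N - (k₁ * (z.1 - z₀.1) + k₂ * (z.2 - z₀.2)) with hLdef
  set g₁ : ℝ × ℝ → ℝ := fun z => m₁₁ * (z.1 - z₀.1) + m₁₂ * (z.2 - z₀.2) with hg₁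
  set g₂ : ℝ × ℝ → ℝ := fun z => m₂₁ * (z.1 - z₀.1) + m₂₂ * (z.2 - z₀.2) with hg₂
  set f' : ℝ × ℝ → (ℝ × ℝ →L[ℝ] ℝ × ℝ) := fun z =>
    LinearMap.toContinuousLinearMap (Matrix.toLin (Module.Basis.finTwoProd ℝ)
      (Module.Basis.finTwoProd ℝ)
      !![N * (m₁₁ * L z + k₁ * g₁ z) / L z ^ 2, N * (m₁₂ * L z + k₂ * g₁ z) / L z ^ 2;
         N * (m₂₁ * L z + k₁ * g₂ z) / L z ^ 2, N * (m₂₂ * L z + k₂ * g₂ z) / L z ^ 2]) with hf'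
  have hder : ∀ z ∈ Z, HasFDerivWithinAt
      (fun z => diskCoord o b₁ b₂ (planeChart a e₁ e₂ z)) (f' z) Z z := by
    intro z hz
    refine HasFDerivAt.hasFDerivWithinAt ?_
    rw [hf']
    simp only
    rw [Matrix.toLin_finTwoProd_toContinuousLinearMap]
    exact ((hasFDerivAt_homography (m₁ := m₁₁) (m₂ := m₁₂) (hLpos z hz).ne').prodMk
      (hasFDerivAt_homography (m₁ := m₂₁) (m₂ := m₂₂) (hLpos z hz).ne')).congr_of_eventuallyEq
        (Eventually.of_forall hψ)
  rw [MeasureTheory.lintegral_image_eq_lintegral_abs_det_fderiv_mul volume hZm hder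
    (h.injOn.mono hZ)]
  refine MeasureTheory.setLIntegral_congr_fun hZm fun z hz => ?_
  have hLz : 0 < L z := hLpos z hz
  have hdet' : (f' z).det = N ^ 3 * (m₁₁ * m₂₂ - m₁₂ * m₂₁) / L z ^ 3 := by
    rw [hf', LinearMap.det_toContinuousLinearMap, LinearMap.det_toLin, Matrix.det_fin_two_of]
    have : L z = N - (k₁ * (z.1 - z₀.1) + k₂ * (z.2 - z₀.2)) := rfl
    field_simp
    simp only [hg₁, hg₂]
    rw [this]
    ring
  have hLx : 1 - inner ℝ o (planeChart a e₁ e₂ z) = L z := hL z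
  have hn := h.one_sub_diskCoord (z := z) (by rw [hLx]; exact hLz.ne')
  rw [hLx] at hn
  have hx := hZ z hz
  have hNx := one_sub_norm_sq_pos hx
  have hx' : planeChart a e₁ e₂ z = o + ((z.1 - z₀.1) • e₁ + (z.2 - z₀.2) • e₂) := by
    rw [← planeChart_sub, hz₀]; abel
  have hgram := gram_mul_pow _ _ hx' hN.ne' hNx.ne'
  have hgo : kleinMetric o e₁ e₁ * kleinMetric o e₂ e₂ - kleinMetric o e₁ e₂ ^ 2 =
      (m₁₁ * m₂₂ - m₁₂ * m₂₁) ^ 2 := by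
    rw [← inner_frameMap h.norm_lt, ← inner_frameMap h.norm_lt, ← inner_frameMap h.norm_lt, h1, h2]
    simp only [inner_smul_right, inner_smul_left, inner_add_right, inner_add_left, h.inner₁₁,
      h.inner₁₂, h.inner₂₂, hb, RCLike.conj_to_real]
    ring
  rw [hgo] at hgram
  rw [hdet', ← ENNReal.ofReal_mul (abs_nonneg _)]
  congr 1
  rw [diskDensity, hn, areaDensity]
  symm
  rw [Real.sqrt_eq_iff_mul_self_eq_of_pos]
  · have hq : 0 < (1 - ‖o‖ ^ 2) * (1 - ‖planeChart a e₁ e₂ z‖ ^ 2) / L z ^ 2 := by positivity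
    have hsq := Real.mul_self_sqrt hq.le
    set r := √((1 - ‖o‖ ^ 2) * (1 - ‖planeChart a e₁ e₂ z‖ ^ 2) / L z ^ 2)
    have e1 : |N ^ 3 * (m₁₁ * m₂₂ - m₁₂ * m₂₁) / L z ^ 3| *
        |N ^ 3 * (m₁₁ * m₂₂ - m₁₂ * m₂₁) / L z ^ 3| =
        (N ^ 3 * (m₁₁ * m₂₂ - m₁₂ * m₂₁) / L z ^ 3) ^ 2 := by rw [abs_mul_abs_self, sq]
    rw [mul_mul_mul_comm, e1, div_mul_div_comm, mul_mul_mul_comm, hsq]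
    rw [← eq_div_iff (by positivity)] at hgram
    rw [hgram]
    rw [← hNdef]
    field_simp
  · have hq : 0 < (1 - ‖o‖ ^ 2) * (1 - ‖planeChart a e₁ e₂ z‖ ^ 2) / L z ^ 2 := by positivity
    have := Real.sqrt_pos.2 hq
    have : 0 < |N ^ 3 * (m₁₁ * m₂₂ - m₁₂ * m₂₁) / L z ^ 3| := by
      rw [abs_pos]; positivity
    positivity

theorem lintegral_preimage (h : IsFrame a e₁ e₂ o b₁ b₂) {Q : Set (ℝ × ℝ)}
    (hQ : MeasurableSet Q) :
    ∫⁻ z in {z | ‖planeChart a e₁ e₂ z‖ < 1 ∧ diskCoord o b₁ b₂ (planeChart a e₁ e₂ z) ∈ Q},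
        ENNReal.ofReal (areaDensity (planeChart a e₁ e₂ z) e₁ e₂) =
      ∫⁻ y in Q ∩ {y | y.1 ^ 2 + y.2 ^ 2 < 1}, ENNReal.ofReal (diskDensity y) := by
  rw [← h.lintegral_image _ fun z hz => hz.1]
  · congr 2
    ext y
    constructor
    · rintro ⟨z, ⟨hz1, hz2⟩, rfl⟩
      exact ⟨hz2, (h.diskCoord_mem_iff (one_sub_inner_pos h.norm_lt hz1.le)).2 hz1⟩
    · rintro ⟨hy, hy1⟩
      obtain ⟨z, hz, rfl⟩ := h.surjOn hy1
      exact ⟨z, ⟨hz, hy⟩, rfl⟩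
  · exact (measurableSet_lt (continuous_planeChart _ _ _).norm.measurable measurable_const).inter
      (((measurable_diskCoord o b₁ b₂).comp (continuous_planeChart _ _ _).measurable) hQ)

end IsFrame

/-! ### Areas in polar coordinates and the angles of a triangle. -/

/-- Nonnegativity of the derivative makes it integrable, so it may blow up at the ends of the
interval. This happens in the direction of an infinite vertex. -/
theorem lintegral_Ioo_of_hasDerivAt {f f' : ℝ → ℝ} {a b : ℝ} (hab : a ≤ b)
    (hcont : ContinuousOn f (Set.Icc a b)) (hderiv : ∀ x ∈ Set.Ioo a b, HasDerivAt f (f' x) x)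
    (hpos : ∀ x ∈ Set.Ioo a b, 0 ≤ f' x) :
    ∫⁻ x in Set.Ioo a b, ENNReal.ofReal (f' x) = ENNReal.ofReal (f b - f a) := by
  have hint := intervalIntegral.integrableOn_deriv_of_nonneg hcont hderiv hpos
  have h1 := intervalIntegral.integral_eq_sub_of_hasDerivAt_of_le hab hcont hderiv
    ((intervalIntegrable_iff_integrableOn_Ioc_of_le hab).2 hint)
  rw [← h1, intervalIntegral.integral_of_le hab, integral_Ioc_eq_integral_Ioo,
    ofReal_integral_eq_lintegral_ofReal (hint.mono_set Set.Ioo_subset_Ioc_self)]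
  exact (ae_restrict_iff' measurableSet_Ioo).2 (Eventually.of_forall hpos)

theorem MeasurableSet.setOf_and {α : Type*} [MeasurableSpace α] {p q : α → Prop}
    (hp : MeasurableSet {x | p x}) (hq : MeasurableSet {x | q x}) :
    MeasurableSet {x | p x ∧ q x} := hp.inter hq

theorem measurable_diskDensity : Measurable diskDensity := by
  unfold diskDensity; fun_prop

theorem lintegral_radial {R : ℝ} (hR0 : 0 ≤ R) (hR1 : R < 1) :
    ∫⁻ r in Set.Ioo 0 R, ENNReal.ofReal (r * (1 / ((1 - r ^ 2) * √(1 - r ^ 2)))) =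
      ENNReal.ofReal (1 / √(1 - R ^ 2) - 1) := by
  have hp : ∀ r ∈ Set.Icc 0 R, 0 < 1 - r ^ 2 := fun r hr => by
    have := hr.1; have := hr.2; nlinarith
  have := lintegral_Ioo_of_hasDerivAt (f := fun r => 1 / √(1 - r ^ 2))
    (f' := fun r => r * (1 / ((1 - r ^ 2) * √(1 - r ^ 2)))) hR0 ?_ ?_ ?_
  · rw [this]; simp
  · refine continuousOn_const.div (by fun_prop) fun r hr => (Real.sqrt_pos.2 (hp r hr)).ne'
  · intro r hr
    have hr' := hp r ⟨hr.1.le, hr.2.le⟩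
    have h1 : HasDerivAt (fun r : ℝ => 1 - r ^ 2) (-(2 * r)) r := by
      simpa using (hasDerivAt_pow 2 r).const_sub 1
    have h2 := (h1.sqrt hr'.ne').inv (Real.sqrt_pos.2 hr').ne'
    simp only [one_div]
    refine h2.congr_deriv ?_
    have hs := Real.sq_sqrt hr'.le
    have := Real.sqrt_pos.2 hr'
    rw [hs]
    field_simp
  · intro r hr
    have hr' := hp r ⟨hr.1.le, hr.2.le⟩
    have := hr.1
    have := Real.sqrt_pos.2 hr'
    positivity

/-- The hyperbolic area of a star-shaped set in polar coordinates. -/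
theorem lintegral_diskDensity_polar {Q : Set (ℝ × ℝ)} (hQ : MeasurableSet Q) {φ₁ φ₂ : ℝ}
    (h₁ : -Real.pi ≤ φ₁) (h₂ : φ₂ ≤ Real.pi) {R : ℝ → ℝ}
    (hR : ∀ φ ∈ Set.Ioo φ₁ φ₂, 0 ≤ R φ ∧ R φ < 1)
    (hmem : ∀ r φ, 0 < r → φ ∈ Set.Ioo (-Real.pi) Real.pi →
      ((r * Real.cos φ, r * Real.sin φ) ∈ Q ↔ φ ∈ Set.Ioo φ₁ φ₂ ∧ r < R φ)) :
    ∫⁻ y in Q, ENNReal.ofReal (diskDensity y) =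
      ∫⁻ φ in Set.Ioo φ₁ φ₂, ENNReal.ofReal (1 / √(1 - R φ ^ 2) - 1) := by
  rw [← lintegral_indicator hQ, ← lintegral_comp_polarCoord_symm]
  have hsub : Set.Ioo φ₁ φ₂ ⊆ Set.Ioo (-Real.pi) Real.pi := Set.Ioo_subset_Ioo h₁ h₂
  rw [polarCoord_target, Measure.volume_eq_prod, ← Measure.prod_restrict]
  rw [lintegral_prod_symm]
  · rw [← lintegral_indicator measurableSet_Ioo, ← lintegral_indicator measurableSet_Ioo]
    congr 1
    ext φ
    by_cases hφ : φ ∈ Set.Ioo (-Real.pi) Real.pi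
    · rw [Set.indicator_of_mem hφ]
      by_cases hφ' : φ ∈ Set.Ioo φ₁ φ₂
      · rw [Set.indicator_of_mem hφ', ← lintegral_radial (hR φ hφ').1 (hR φ hφ').2,
          ← lintegral_indicator measurableSet_Ioi, ← lintegral_indicator measurableSet_Ioo]
        congr 1
        ext r
        by_cases hr : r ∈ Set.Ioi (0 : ℝ)
        · rw [Set.indicator_of_mem hr]
          have hr' : 0 < r := hr
          by_cases hrR : r < R φ
          · rw [Set.indicator_of_mem (show r ∈ Set.Ioo 0 (R φ) from ⟨hr, hrR⟩), polarCoord_symm_apply]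
            simp only
            rw [Set.indicator_of_mem ((hmem r φ hr hφ).2 ⟨hφ', hrR⟩), smul_eq_mul,
              ← ENNReal.ofReal_mul hr'.le, diskDensity]
            have : (r * Real.cos φ) ^ 2 + (r * Real.sin φ) ^ 2 = r ^ 2 := by
              rw [mul_pow, mul_pow, ← mul_add, Real.cos_sq_add_sin_sq, mul_one]
            simp only [this]
          · rw [Set.indicator_of_notMem (fun h : r ∈ Set.Ioo 0 (R φ) => hrR h.2),
              polarCoord_symm_apply]
            simp only
            rw [Set.indicator_of_notMem fun h => hrR ((hmem r φ hr hφ).1 h).2, smul_zero]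
        · rw [Set.indicator_of_notMem hr, Set.indicator_of_notMem fun h => hr h.1]
      · rw [Set.indicator_of_notMem hφ']
        rw [setLIntegral_eq_zero measurableSet_Ioi]
        intro r hr
        simp only
        rw [polarCoord_symm_apply]
        simp only
        rw [Set.indicator_of_notMem fun h => hφ' ((hmem r φ hr hφ).1 h).1, smul_zero]
        rfl
    · rw [Set.indicator_of_notMem hφ, Set.indicator_of_notMem fun h => hφ (hsub h)]
  · have hm : Measurable fun p : ℝ × ℝ => polarCoord.symm p :=
      continuous_polarCoord_symm.measurable
    refine (Measurable.aemeasurable ?_)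
    exact Measurable.smul (measurable_fst.ennreal_ofReal)
      ((measurable_diskDensity.ennreal_ofReal.indicator hQ).comp hm)

/-- For squared radius `3 / 4` the radial integral `1 / √(1 - 3 / 4) - 1` is one, so that area
equals angle for every sector. -/
theorem lintegral_disk :
    ∫⁻ y in {y : ℝ × ℝ | y.1 ^ 2 + y.2 ^ 2 < 3 / 4} ∩ {y | y.1 ^ 2 + y.2 ^ 2 < 1},
      ENNReal.ofReal (diskDensity y) = ENNReal.ofReal (2 * Real.pi) := by
  rw [lintegral_diskDensity_polar (φ₁ := -Real.pi) (φ₂ := Real.pi) (R := fun _ => √(3 / 4)) _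
    le_rfl le_rfl]
  · rw [Real.sq_sqrt (by norm_num), show (1 : ℝ) - 3 / 4 = (1 / 2) ^ 2 by norm_num,
      Real.sqrt_sq (by norm_num)]
    rw [setLIntegral_const, Real.volume_Ioo, ← ENNReal.ofReal_mul (by norm_num)]
    congr 1; ring
  · intro φ _
    refine ⟨by positivity, ?_⟩
    rw [Real.sqrt_lt' one_pos]; norm_num
  · intro r φ hr hφ
    have : (r * Real.cos φ) ^ 2 + (r * Real.sin φ) ^ 2 = r ^ 2 := by
      rw [mul_pow, mul_pow, ← mul_add, Real.cos_sq_add_sin_sq, mul_one]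
    simp only [Set.mem_inter_iff, Set.mem_ofPred_eq, this, hφ, true_and]
    rw [Real.lt_sqrt hr.le]
    constructor
    · exact fun h => h.1
    · exact fun h => ⟨h, by linarith⟩
  · exact (measurableSet_lt (by fun_prop) (by fun_prop)).inter
      (measurableSet_lt (by fun_prop) (by fun_prop))

/-- The complement to a right angle of the angle at the vertex `(c, s)` of the triangle with
vertices `(0, 0)`, `(c, 0)`, `(c, s)` of the projective disk. -/
noncomputable def edgeAngle (c s : ℝ) : ℝ := Real.arcsin (s / √(c ^ 2 + s ^ 2) / √(1 - c ^ 2))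

theorem mem_wedge_polar_iff {c s₁ s₂ : ℝ} (hc : 0 < c) (hs : s₁ < s₂) {r φ : ℝ} (hr : 0 < r)
    (hφ : φ ∈ Set.Ioo (-Real.pi) Real.pi) :
    (s₁ * (r * Real.cos φ) < c * (r * Real.sin φ) ∧ c * (r * Real.sin φ) < s₂ * (r * Real.cos φ)) ↔
      φ ∈ Set.Ioo (Real.arctan (s₁ / c)) (Real.arctan (s₂ / c)) := by
  have e1 : s₁ * (r * Real.cos φ) < c * (r * Real.sin φ) ↔ s₁ * Real.cos φ < c * Real.sin φ := by
    rw [mul_left_comm, mul_left_comm c, mul_lt_mul_iff_right₀ hr]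
  have e2 : c * (r * Real.sin φ) < s₂ * (r * Real.cos φ) ↔ c * Real.sin φ < s₂ * Real.cos φ := by
    rw [mul_left_comm, mul_left_comm s₂, mul_lt_mul_iff_right₀ hr]
  have key : φ ∈ Set.Ioo (-(Real.pi / 2)) (Real.pi / 2) →
      ((s₁ * Real.cos φ < c * Real.sin φ ∧ c * Real.sin φ < s₂ * Real.cos φ) ↔
      φ ∈ Set.Ioo (Real.arctan (s₁ / c)) (Real.arctan (s₂ / c))) := by
    intro h
    have hcos := Real.cos_pos_of_mem_Ioo h
    have ht : φ = Real.arctan (Real.tan φ) := (Real.arctan_tan h.1 h.2).symm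
    rw [Set.mem_Ioo]
    nth_rewrite 5 6 [ht]
    rw [Real.arctan_strictMono.lt_iff_lt, Real.arctan_strictMono.lt_iff_lt, Real.tan_eq_sin_div_cos,
      div_lt_div_iff₀ hc hcos, div_lt_div_iff₀ hcos hc, mul_comm c]
  rw [e1, e2]
  constructor
  · intro h
    refine (key ?_).1 h
    have hcos : 0 < Real.cos φ := by
      by_contra! hcon
      nlinarith [h.1.trans h.2]
    by_contra hcon
    rw [Set.mem_Ioo, not_and_or, not_lt, not_lt] at hcon
    rcases hcon with h1 | h1
    · have := Real.cos_nonpos_of_pi_div_two_le_of_le (x := -φ) (by linarith) (by linarith [hφ.1])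
      rw [Real.cos_neg] at this
      linarith
    · have := Real.cos_nonpos_of_pi_div_two_le_of_le (x := φ) h1 (by linarith [hφ.2])
      linarith
  · intro h
    refine (key ?_).2 h
    exact ⟨(Real.neg_pi_div_two_lt_arctan _).trans h.1, h.2.trans (Real.arctan_lt_pi_div_two _)⟩

/-- Per unit angle the triangle contributes `1 / √(1 - (c / cos φ) ^ 2) - 1` and the sector
contributes one. The constants cancel, and what remains has the primitive `arcsin (sin φ / √(1 - c ^
2))`. -/
theorem lintegral_triangle_add_sector {c s₁ s₂ : ℝ} (hc : 0 < c) (hs : s₁ < s₂)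
    (h₁ : c ^ 2 + s₁ ^ 2 ≤ 1) (h₂ : c ^ 2 + s₂ ^ 2 ≤ 1) :
    (∫⁻ y in {y : ℝ × ℝ | (s₁ * y.1 < c * y.2 ∧ c * y.2 < s₂ * y.1) ∧ y.1 < c} ∩
        {y | y.1 ^ 2 + y.2 ^ 2 < 1}, ENNReal.ofReal (diskDensity y)) +
      ∫⁻ y in {y : ℝ × ℝ | (s₁ * y.1 < c * y.2 ∧ c * y.2 < s₂ * y.1) ∧
        y.1 ^ 2 + y.2 ^ 2 < 3 / 4} ∩ {y | y.1 ^ 2 + y.2 ^ 2 < 1}, ENNReal.ofReal (diskDensity y) =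
      ENNReal.ofReal (edgeAngle c s₂ - edgeAngle c s₁) := by
  have hpi := Real.pi_pos
  have b₁ : -Real.pi ≤ Real.arctan (s₁ / c) := by
    have := Real.neg_pi_div_two_lt_arctan (s₁ / c); linarith
  have b₂ : Real.arctan (s₂ / c) ≤ Real.pi := by
    have := Real.arctan_lt_pi_div_two (s₂ / c); linarith
  have h12 : Real.arctan (s₁ / c) < Real.arctan (s₂ / c) :=
    Real.arctan_strictMono (div_lt_div_of_pos_right hs hc)
  have hpol : ∀ r φ : ℝ, (r * Real.cos φ) ^ 2 + (r * Real.sin φ) ^ 2 = r ^ 2 := fun r φ => by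
    rw [mul_pow, mul_pow, ← mul_add, Real.cos_sq_add_sin_sq, mul_one]
  -- The ray at angle `φ` meets the edge at distance `c / cos φ`, which must be less than one. The
  -- sign of `sin φ` decides which endpoint of the edge supplies the bound.
  have hcos : ∀ φ ∈ Set.Ioo (Real.arctan (s₁ / c)) (Real.arctan (s₂ / c)), c < Real.cos φ := by
    intro φ hφ
    have hφ' : φ ∈ Set.Ioo (-(Real.pi / 2)) (Real.pi / 2) :=
      ⟨(Real.neg_pi_div_two_lt_arctan _).trans hφ.1, hφ.2.trans (Real.arctan_lt_pi_div_two _)⟩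
    have hcos := Real.cos_pos_of_mem_Ioo hφ'
    have hm := (mem_wedge_polar_iff hc hs (r := 1) one_pos
      (Set.Ioo_subset_Ioo (by linarith) (by linarith) hφ')).2 hφ
    simp only [one_mul] at hm
    have hsc := Real.sin_sq_add_cos_sq φ
    have hlt : (c * Real.sin φ) ^ 2 < (1 - c ^ 2) * Real.cos φ ^ 2 := by
      rcases le_total 0 (Real.sin φ) with h0 | h0
      · have h3 : (c * Real.sin φ) ^ 2 < (s₂ * Real.cos φ) ^ 2 :=
          pow_lt_pow_left₀ hm.2 (by positivity) (by norm_num)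
        have : s₂ ^ 2 * Real.cos φ ^ 2 ≤ (1 - c ^ 2) * Real.cos φ ^ 2 :=
          mul_le_mul_of_nonneg_right (by linarith) (by positivity)
        rw [mul_pow s₂] at h3
        linarith
      · have h3 : (-(c * Real.sin φ)) ^ 2 < (-(s₁ * Real.cos φ)) ^ 2 :=
          pow_lt_pow_left₀ (neg_lt_neg hm.1)
            (neg_nonneg.2 (mul_nonpos_of_nonneg_of_nonpos hc.le h0)) (by norm_num)
        have : s₁ ^ 2 * Real.cos φ ^ 2 ≤ (1 - c ^ 2) * Real.cos φ ^ 2 :=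
          mul_le_mul_of_nonneg_right (by linarith) (by positivity)
        rw [neg_sq, neg_sq, mul_pow s₁] at h3
        linarith
    refine lt_of_pow_lt_pow_left₀ 2 hcos.le ?_
    nlinarith
  have hc1 : c < 1 := by
    obtain ⟨φ, hφ⟩ := exists_between h12
    exact (hcos φ hφ).trans_le (Real.cos_le_one φ)
  have hcc : 0 < 1 - c ^ 2 := by nlinarith
  have hsq : 0 < √(1 - c ^ 2) := Real.sqrt_pos.2 hcc
  have m1 : Measurable fun φ : ℝ => ENNReal.ofReal (1 / √(1 - (c / Real.cos φ) ^ 2) - 1) := by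
    have := Real.continuous_cos.measurable
    fun_prop
  have M0 : MeasurableSet {y : ℝ × ℝ | s₁ * y.1 < c * y.2 ∧ c * y.2 < s₂ * y.1} :=
    .setOf_and (measurableSet_lt (by fun_prop) (by fun_prop))
      (measurableSet_lt (by fun_prop) (by fun_prop))
  have M1 : MeasurableSet ({y : ℝ × ℝ | (s₁ * y.1 < c * y.2 ∧ c * y.2 < s₂ * y.1) ∧ y.1 < c} ∩
      {y | y.1 ^ 2 + y.2 ^ 2 < 1}) :=
    (M0.setOf_and (measurableSet_lt (by fun_prop) (by fun_prop))).inter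
      (measurableSet_lt (by fun_prop) (by fun_prop))
  have M2 : MeasurableSet ({y : ℝ × ℝ | (s₁ * y.1 < c * y.2 ∧ c * y.2 < s₂ * y.1) ∧
      y.1 ^ 2 + y.2 ^ 2 < 3 / 4} ∩ {y | y.1 ^ 2 + y.2 ^ 2 < 1}) :=
    (M0.setOf_and (measurableSet_lt (by fun_prop) (by fun_prop))).inter
      (measurableSet_lt (by fun_prop) (by fun_prop))
  rw [lintegral_diskDensity_polar (φ₁ := Real.arctan (s₁ / c)) (φ₂ := Real.arctan (s₂ / c))
      (R := fun φ => c / Real.cos φ) M1 b₁ b₂,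
    lintegral_diskDensity_polar (φ₁ := Real.arctan (s₁ / c)) (φ₂ := Real.arctan (s₂ / c))
      (R := fun _ => √(3 / 4)) M2 b₁ b₂, ← lintegral_add_left m1]
  · have hsin : ∀ s, Real.sin (Real.arctan (s / c)) = s / √(c ^ 2 + s ^ 2) := by
      intro s
      have : 1 + (s / c) ^ 2 = (c ^ 2 + s ^ 2) / c ^ 2 := by field_simp
      rw [Real.sin_arctan, this, Real.sqrt_div (by positivity), Real.sqrt_sq hc.le]
      have : 0 < √(c ^ 2 + s ^ 2) := Real.sqrt_pos.2 (by positivity)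
      field_simp
    rw [edgeAngle, edgeAngle, ← hsin, ← hsin]
    rw [← lintegral_Ioo_of_hasDerivAt
      (f := fun φ => Real.arcsin (Real.sin φ / √(1 - c ^ 2)))
      (f' := fun φ => 1 / √(1 - (c / Real.cos φ) ^ 2)) h12.le]
    · refine setLIntegral_congr_fun measurableSet_Ioo fun φ hφ => ?_
      have h3 := hcos φ hφ
      have h4 : 0 < Real.cos φ := hc.trans h3
      have h5 : (c / Real.cos φ) ^ 2 < 1 := by
        rw [sq_lt_one_iff₀ (by positivity), div_lt_one h4]; exact h3
      have h6 : 1 ≤ 1 / √(1 - (c / Real.cos φ) ^ 2) := by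
        rw [le_div_iff₀ (Real.sqrt_pos.2 (by linarith)), one_mul]
        exact Real.sqrt_le_one.2 (by nlinarith [sq_nonneg (c / Real.cos φ)])
      rw [← ENNReal.ofReal_add (by linarith), Real.sq_sqrt (by norm_num),
        show (1 : ℝ) - 3 / 4 = (1 / 2) ^ 2 by norm_num, Real.sqrt_sq (by norm_num)]
      · congr 1; ring
      · rw [Real.sq_sqrt (by norm_num),
          show (1 : ℝ) - 3 / 4 = (1 / 2) ^ 2 by norm_num, Real.sqrt_sq (by norm_num)]
        norm_num
    · exact (Real.continuous_arcsin.comp (Real.continuous_sin.div_const _)).continuousOn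
    · intro φ hφ
      have h3 := hcos φ hφ
      have h4 : 0 < Real.cos φ := hc.trans h3
      have hsc := Real.sin_sq_add_cos_sq φ
      have h5 : (Real.sin φ / √(1 - c ^ 2)) ^ 2 < 1 := by
        rw [div_pow, Real.sq_sqrt hcc.le, div_lt_one hcc]; nlinarith
      have h6 : |Real.sin φ / √(1 - c ^ 2)| < 1 := (sq_lt_one_iff_abs_lt_one _).1 h5
      rw [abs_lt] at h6
      have h7 := (Real.hasDerivAt_arcsin h6.1.ne' h6.2.ne).comp φ
        ((Real.hasDerivAt_sin φ).div_const (√(1 - c ^ 2)))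
      refine h7.congr_deriv ?_
      have e1 : 1 - (Real.sin φ / √(1 - c ^ 2)) ^ 2 = (Real.cos φ ^ 2 - c ^ 2) / (1 - c ^ 2) := by
        rw [div_pow, Real.sq_sqrt hcc.le]
        field_simp
        linarith
      have e2 : 1 - (c / Real.cos φ) ^ 2 = (Real.cos φ ^ 2 - c ^ 2) / Real.cos φ ^ 2 := by
        field_simp
      have e3 : 0 < Real.cos φ ^ 2 - c ^ 2 := by nlinarith
      have := Real.sqrt_pos.2 e3
      rw [e1, e2, Real.sqrt_div e3.le, Real.sqrt_div e3.le, Real.sqrt_sq h4.le]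
      field_simp
    · intro φ _; positivity
  · intro φ _
    refine ⟨by positivity, ?_⟩
    rw [Real.sqrt_lt' one_pos]; norm_num
  · intro r φ hr hφ
    simp only [Set.mem_inter_iff, Set.mem_ofPred_eq, hpol]
    rw [mem_wedge_polar_iff hc hs hr hφ, Real.lt_sqrt hr.le]
    constructor
    · exact fun h => h.1
    · exact fun h => ⟨h, by linarith [h.2]⟩
  · intro φ hφ
    have h3 := hcos φ hφ
    exact ⟨by have := hc.trans h3; positivity, (div_lt_one (hc.trans h3)).2 h3⟩
  · intro r φ hr hφ
    simp only [Set.mem_inter_iff, Set.mem_ofPred_eq, hpol]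
    rw [mem_wedge_polar_iff hc hs hr hφ]
    constructor
    · rintro ⟨⟨h3, h4⟩, -⟩
      exact ⟨h3, (lt_div_iff₀ (hc.trans (hcos φ h3))).2 h4⟩
    · rintro ⟨h3, h4⟩
      have h5 := hc.trans (hcos φ h3)
      refine ⟨⟨h3, (lt_div_iff₀ h5).1 h4⟩, ?_⟩
      have h6 := h4.trans ((div_lt_one h5).2 (hcos φ h3))
      nlinarith

theorem sin_arctan_div {c : ℝ} (hc : 0 < c) (s : ℝ) :
    Real.sin (Real.arctan (s / c)) = s / √(c ^ 2 + s ^ 2) := by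
  have : 1 + (s / c) ^ 2 = (c ^ 2 + s ^ 2) / c ^ 2 := by field_simp
  rw [Real.sin_arctan, this, Real.sqrt_div (by positivity), Real.sqrt_sq hc.le]
  have : 0 < √(c ^ 2 + s ^ 2) := Real.sqrt_pos.2 (by positivity)
  field_simp

theorem edgeAngle_neg (c s : ℝ) : edgeAngle c (-s) = - edgeAngle c s := by
  rw [edgeAngle, edgeAngle, neg_sq, neg_div, neg_div, Real.arcsin_neg]

theorem edgeAngle_mono {c s₁ s₂ : ℝ} (hc : 0 < c) (h : s₁ ≤ s₂) :
    edgeAngle c s₁ ≤ edgeAngle c s₂ := by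
  rw [edgeAngle, edgeAngle, ← sin_arctan_div hc, ← sin_arctan_div hc]
  apply Real.monotone_arcsin
  apply div_le_div_of_nonneg_right _ (Real.sqrt_nonneg _)
  apply Real.strictMonoOn_sin.monotoneOn
  · exact ⟨(Real.neg_pi_div_two_lt_arctan _).le, (Real.arctan_lt_pi_div_two _).le⟩
  · exact ⟨(Real.neg_pi_div_two_lt_arctan _).le, (Real.arctan_lt_pi_div_two _).le⟩
  · exact Real.arctan_strictMono.monotone (div_le_div_of_nonneg_right h hc.le)

/-- The inner products that define the angle at `v` are determined by those of the boosted points,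
through `inner_boost`. In the cosine `s'` cancels, leaving minus the argument of the arcsine in
`edgeAngle`. -/
theorem hypAngle_eq_edgeAngle {o v w : Space3} (ho : ‖o‖ < 1) (hv : ‖v‖ ≤ 1) (hw : ‖w‖ ≤ 1)
    {c s s' : ℝ} (hc : 0 < c) (hs : s < s') (hvv : ‖boost o v‖ ^ 2 = c ^ 2 + s ^ 2)
    (hww : ‖boost o w‖ ^ 2 = c ^ 2 + s' ^ 2)
    (hvw : inner ℝ (boost o v) (boost o w) = c ^ 2 + s * s') :
    hypAngle v o w = Real.pi / 2 + edgeAngle c s := by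
  have hN := one_sub_norm_sq_pos ho
  have hLv := one_sub_inner_pos ho hv
  have hLw := one_sub_inner_pos ho hw
  have e1 := norm_boost_sq ho hLv.ne'
  have e2 := norm_boost_sq ho hLw.ne'
  have e3 := inner_boost ho hLv.ne' hLw.ne'
  rw [hvv] at e1
  rw [hww] at e2
  rw [hvw] at e3
  have hNv0 : 0 ≤ 1 - ‖v‖ ^ 2 := by nlinarith [norm_nonneg v]
  have hNw0 : 0 ≤ 1 - ‖w‖ ^ 2 := by nlinarith [norm_nonneg w]
  have q1 : 0 ≤ 1 - (c ^ 2 + s ^ 2) := by rw [e1]; positivity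
  have q2 : 0 ≤ 1 - (c ^ 2 + s' ^ 2) := by rw [e2]; positivity
  have hcc : 0 < 1 - c ^ 2 := by
    by_contra! hcon
    have h1 : s ^ 2 = 0 := le_antisymm (by linarith) (sq_nonneg _)
    have h2 : s' ^ 2 = 0 := le_antisymm (by linarith) (sq_nonneg _)
    rw [pow_eq_zero_iff two_ne_zero] at h1 h2
    linarith
  have hsq := Real.sqrt_pos.2 hcc
  by_cases hv1 : ‖v‖ < 1
  · have hNv := one_sub_norm_sq_pos hv1
    rw [hypAngle, if_pos hv1, InnerProductGeometry.angle]
    have hx : inner ℝ (frameMap v (o - v)) (frameMap v (w - v)) /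
        (‖frameMap v (o - v)‖ * ‖frameMap v (w - v)‖) =
        -(s / √(c ^ 2 + s ^ 2) / √(1 - c ^ 2)) := by
      have i1 := inner_frameMap_sub hv1 o w
      have i2 := inner_frameMap_sub hv1 o o
      have i3 := inner_frameMap_sub hv1 w w
      rw [real_inner_self_eq_norm_sq] at i2 i3
      rw [real_inner_self_eq_norm_sq] at i2 i3
      set q := 1 - (c ^ 2 + s ^ 2) with hq
      have hq0 : 0 < q := by rw [e1]; positivity
      rw [real_inner_comm o v] at i1 i2
      rw [eq_div_iff (by positivity)] at e1 e2 e3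
      set N := 1 - ‖o‖ ^ 2
      set Nv := 1 - ‖v‖ ^ 2
      set Nw := 1 - ‖w‖ ^ 2
      set Lv := 1 - inner ℝ o v
      set Lw := 1 - inner ℝ o w
      set Lvw := 1 - inner ℝ v w
      have f1 : Nv = q * Lv ^ 2 / N := by field_simp; linarith
      have f2 : Nw = (1 - (c ^ 2 + s' ^ 2)) * Lw ^ 2 / N := by field_simp; linarith
      have f3 : Lvw = (1 - (c ^ 2 + s * s')) * (Lv * Lw) / N := by field_simp; linarith
      have hd : 0 < s' - s := by linarith
      have hcs : 0 < c ^ 2 + s ^ 2 := by positivity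
      have hcsq := Real.sqrt_pos.2 hcs
      have i1' : inner ℝ (frameMap v (o - v)) (frameMap v (w - v)) =
          s * (s - s') * (N * Lw / (q ^ 2 * Lv ^ 2)) := by
        rw [i1, f3, f1]
        field_simp
        rw [hq]; ring
      have i2' : ‖frameMap v (o - v)‖ = √(c ^ 2 + s ^ 2) * (N / (q * Lv)) := by
        rw [← Real.sqrt_sq (norm_nonneg (frameMap v (o - v))), i2, f1,
          ← Real.sqrt_sq (show 0 ≤ N / (q * Lv) by positivity), ← Real.sqrt_mul hcs.le]
        congr 1
        field_simp
        rw [hq]; ring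
      have i3' : ‖frameMap v (w - v)‖ = √(1 - c ^ 2) * ((s' - s) * Lw / (q * Lv)) := by
        rw [← Real.sqrt_sq (norm_nonneg (frameMap v (w - v))), i3, f1, f2, f3,
          ← Real.sqrt_sq (show 0 ≤ (s' - s) * Lw / (q * Lv) by positivity), ← Real.sqrt_mul hcc.le]
        congr 1
        field_simp
        rw [hq]; ring
      rw [i1', i2', i3']
      field_simp
      ring
    rw [hx, Real.arccos_neg, edgeAngle, Real.arcsin_eq_pi_div_two_sub_arccos]
    ring
  · have hv1 : ‖v‖ = 1 := le_antisymm hv (not_lt.1 hv1)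
    rw [hypAngle, if_neg (by rw [hv1]; exact lt_irrefl _)]
    have h0 : c ^ 2 + s ^ 2 = 1 := by
      rw [hv1] at e1; simp at e1; linarith
    -- If `s` were nonnegative, `s < s'` would push the other endpoint out of the unit disk.
    have hs0 : s < 0 := by
      by_contra! hcon
      nlinarith
    have h1 : √(1 - c ^ 2) = -s := by
      rw [show 1 - c ^ 2 = (-s) ^ 2 by linarith [neg_sq s], Real.sqrt_sq (by linarith)]
    rw [edgeAngle, h0, h1, Real.sqrt_one, div_one, div_neg, div_self hs0.ne, Real.arcsin_neg_one]
    ring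

/-- Gram-Schmidt beginning with `w`. With an endpoint of an edge for `v` and the vector along the
edge for `w`, it places the edge on the line with first coordinate `c`. -/
theorem exists_orthonormal_pair {v w : Space3} (h : ∀ a b : ℝ, a • v + b • w = 0 → a = 0 ∧ b = 0) :
    ∃ (b₁ b₂ : Space3) (c s σ : ℝ), 0 < c ∧ 0 < σ ∧ inner ℝ b₁ b₁ = (1 : ℝ) ∧
      inner ℝ b₁ b₂ = (0 : ℝ) ∧ inner ℝ b₂ b₂ = (1 : ℝ) ∧ w = σ • b₂ ∧ v = c • b₁ + s • b₂ := by
  have hw : w ≠ 0 := by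
    rintro rfl
    have := (h 0 1 (by simp)).2
    norm_num at this
  have hσ : 0 < ‖w‖ := norm_pos_iff.2 hw
  set b₂ := ‖w‖⁻¹ • w with hb₂
  have h22 : inner ℝ b₂ b₂ = (1 : ℝ) := by
    rw [hb₂, inner_smul_left, inner_smul_right, real_inner_self_eq_norm_sq]
    simp only [RCLike.conj_to_real]; field_simp
  set u := v - (inner ℝ b₂ v : ℝ) • b₂ with hu
  have hu0 : u ≠ 0 := by
    intro e
    have := (h 1 (-(inner ℝ b₂ v * ‖w‖⁻¹)) (by
      rw [hu, hb₂, smul_smul] at e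
      rw [hb₂, one_smul, neg_smul, ← sub_eq_add_neg]; exact e)).1
    norm_num at this
  have hc : 0 < ‖u‖ := norm_pos_iff.2 hu0
  have hu2 : inner ℝ u b₂ = (0 : ℝ) := by
    rw [hu, inner_sub_left, inner_smul_left, h22, real_inner_comm]; simp
  refine ⟨‖u‖⁻¹ • u, b₂, ‖u‖, inner ℝ b₂ v, ‖w‖, hc, hσ, ?_, ?_, h22, ?_, ?_⟩
  · rw [inner_smul_left, inner_smul_right, real_inner_self_eq_norm_sq]
    simp only [RCLike.conj_to_real]; field_simp
  · rw [inner_smul_left, hu2, mul_zero]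
  · rw [hb₂, smul_smul, mul_inv_cancel₀ hσ.ne', one_smul]
  · rw [smul_smul, mul_inv_cancel₀ hc.ne', one_smul, hu]; abel

/-! ### The area measure of a plane and the triangle formula. -/

/-- The hyperbolic area measure of a plane in an affine chart. -/
noncomputable def planeArea (a e₁ e₂ : Space3) : Measure (ℝ × ℝ) :=
  (volume.restrict {z | ‖planeChart a e₁ e₂ z‖ < 1}).withDensity
    fun z => ENNReal.ofReal (areaDensity (planeChart a e₁ e₂ z) e₁ e₂)

theorem planeArea_apply {a e₁ e₂ : Space3} {Y : Set (ℝ × ℝ)} (hY : MeasurableSet Y) :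
    planeArea a e₁ e₂ Y = ∫⁻ z in {z | z ∈ Y ∧ ‖planeChart a e₁ e₂ z‖ < 1},
      ENNReal.ofReal (areaDensity (planeChart a e₁ e₂ z) e₁ e₂) := by
  rw [planeArea, withDensity_apply _ hY, Measure.restrict_restrict hY]; rfl

theorem planeArea_absolutelyContinuous (a e₁ e₂ : Space3) : planeArea a e₁ e₂ ≪ volume :=
  (withDensity_absolutelyContinuous _ _).trans Measure.absolutelyContinuous_restrict

theorem volume_line {u : ℝ × ℝ} (hu : u ≠ 0) (z₀ : ℝ × ℝ) :
    volume {z : ℝ × ℝ | cross u (z - z₀) = 0} = 0 := by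
  have : {z : ℝ × ℝ | cross u (z - z₀) = 0} =
      (AffineSubspace.mk' z₀ (LinearMap.ker (crossLinear u)) : Set (ℝ × ℝ)) := by
    ext z
    rw [SetLike.mem_coe, AffineSubspace.mem_mk', LinearMap.mem_ker]
    rfl
  rw [this]
  apply Measure.addHaar_affineSubspace
  intro htop
  have hd := congrArg AffineSubspace.direction htop
  rw [AffineSubspace.direction_mk', AffineSubspace.direction_top, LinearMap.ker_eq_top] at hd
  apply hu
  have h1 := LinearMap.congr_fun hd (0, 1)
  have h2 := LinearMap.congr_fun hd (1, 0)
  simp [crossLinear, cross] at h1 h2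
  exact Prod.ext h1 h2

theorem continuous_cross_left (u : ℝ × ℝ) (z₀ : ℝ × ℝ) :
    Continuous fun z => cross u (z - z₀) := by unfold cross; fun_prop

theorem measurableSet_inWedge (u w z₀ : ℝ × ℝ) : MeasurableSet {z | InWedge u w (z - z₀)} := by
  unfold InWedge cross
  exact MeasurableSet.setOf_and (measurableSet_lt (by fun_prop) (by fun_prop))
    (measurableSet_lt (by fun_prop) (by fun_prop))

/-- The disk of hyperbolic area `2 π` about `o`. -/
def areaDisk (a e₁ e₂ o : Space3) : Set (ℝ × ℝ) :=
  {z | ‖boost o (planeChart a e₁ e₂ z)‖ ^ 2 < 3 / 4}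

theorem measurableSet_areaDisk (a e₁ e₂ o : Space3) : MeasurableSet (areaDisk a e₁ e₂ o) := by
  have hf : Continuous (frameMap o) := (frameMap o).continuous_of_finiteDimensional
  have h1 : Measurable fun z => (1 - ‖o‖ ^ 2) / (1 - inner ℝ o (planeChart a e₁ e₂ z)) :=
    measurable_const.div
      (continuous_const.sub (continuous_const.inner (continuous_planeChart _ _ _))).measurable
  have h2 : Measurable fun z => frameMap o (planeChart a e₁ e₂ z - o) :=
    (hf.comp ((continuous_planeChart _ _ _).sub continuous_const)).measurable
  exact measurableSet_lt ((h1.smul h2).norm.pow_const 2) measurable_const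

theorem IsFrame.norm_boost_sq {a e₁ e₂ o b₁ b₂ : Space3} (h : IsFrame a e₁ e₂ o b₁ b₂)
    {z : ℝ × ℝ} (hz : ‖planeChart a e₁ e₂ z‖ ≤ 1) :
    ‖boost o (planeChart a e₁ e₂ z)‖ ^ 2 = (diskCoord o b₁ b₂ (planeChart a e₁ e₂ z)).1 ^ 2 +
      (diskCoord o b₁ b₂ (planeChart a e₁ e₂ z)).2 ^ 2 := by
  have h1 := h.one_sub_diskCoord (one_sub_inner_pos h.norm_lt hz).ne'
  have h2 := _root_.norm_boost_sq h.norm_lt (one_sub_inner_pos h.norm_lt hz).ne'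
  rw [← h2] at h1
  linarith

theorem exists_isFrame {a e₁ e₂ o : Space3} (hli : LinearIndependent ℝ ![e₁, e₂]) (ho : ‖o‖ < 1)
    (hmem : ∃ z, planeChart a e₁ e₂ z = o) : ∃ b₁ b₂, IsFrame a e₁ e₂ o b₁ b₂ := by
  obtain ⟨b₁, b₂, c, s, σ, -, -, h11, h12, h22, h2, h1⟩ :=
    exists_orthonormal_pair (v := frameMap o e₁) (w := frameMap o e₂) (fun α β h => by
      rw [← map_smul, ← map_smul, ← map_add] at h
      exact LinearIndependent.pair_iff.1 hli _ _
        (frameMap_injective ho (h.trans (map_zero _).symm)))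
  exact ⟨b₁, b₂, ho, hmem, hli, h11, h12, h22, ⟨c, s, h1⟩, ⟨0, σ, by rw [h2]; simp⟩⟩

theorem planeArea_areaDisk {a e₁ e₂ o : Space3} (hli : LinearIndependent ℝ ![e₁, e₂])
    (ho : ‖o‖ < 1) (hmem : ∃ z, planeChart a e₁ e₂ z = o) :
    planeArea a e₁ e₂ (areaDisk a e₁ e₂ o) = ENNReal.ofReal (2 * Real.pi) := by
  obtain ⟨b₁, b₂, hf⟩ := exists_isFrame hli ho hmem
  rw [← lintegral_disk, ← hf.lintegral_preimage (measurableSet_lt (by fun_prop) (by fun_prop)),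
    planeArea_apply (measurableSet_areaDisk _ _ _ _)]
  congr 2
  ext z
  simp only [Set.mem_ofPred_eq, areaDisk]
  rw [and_comm]
  refine and_congr_right fun hz => ?_
  rw [hf.norm_boost_sq hz.le]

/-- The area of a triangle together with that of the sector at its vertex `o`. -/
theorem planeArea_triangle_add_sector {a e₁ e₂ : Space3} (hli : LinearIndependent ℝ ![e₁, e₂])
    {z₀ zv zw : ℝ × ℝ} (ho : ‖planeChart a e₁ e₂ z₀‖ < 1) (hv : ‖planeChart a e₁ e₂ zv‖ ≤ 1)
    (hw : ‖planeChart a e₁ e₂ zw‖ ≤ 1) (hC : cross (zv - z₀) (zw - z₀) ≠ 0) :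
    0 ≤ Real.pi - hypAngle (planeChart a e₁ e₂ zv) (planeChart a e₁ e₂ z₀) (planeChart a e₁ e₂ zw)
        - hypAngle (planeChart a e₁ e₂ zw) (planeChart a e₁ e₂ z₀) (planeChart a e₁ e₂ zv) ∧
    planeArea a e₁ e₂ {z | InWedge (zv - z₀) (zw - z₀) (z - z₀) ∧
        0 < cross (zw - zv) (z - zv) * cross (zv - z₀) (zw - z₀)} +
      planeArea a e₁ e₂ ({z | InWedge (zv - z₀) (zw - z₀) (z - z₀)} ∩
        areaDisk a e₁ e₂ (planeChart a e₁ e₂ z₀)) =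
    ENNReal.ofReal (Real.pi -
      hypAngle (planeChart a e₁ e₂ zv) (planeChart a e₁ e₂ z₀) (planeChart a e₁ e₂ zw) -
      hypAngle (planeChart a e₁ e₂ zw) (planeChart a e₁ e₂ z₀) (planeChart a e₁ e₂ zv)) := by
  set P := planeChart a e₁ e₂ with hP
  set o := P z₀ with ho'
  set C := cross (zv - z₀) (zw - z₀) with hCdef
  have hN := one_sub_norm_sq_pos ho
  have hLv := one_sub_inner_pos ho hv
  have hLw := one_sub_inner_pos ho hw
  set N := 1 - ‖o‖ ^ 2 with hNdef
  set Lv := 1 - inner ℝ o (P zv) with hLvdef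
  set Lw := 1 - inner ℝ o (P zw) with hLwdef
  -- points of the plane in the coordinates given by the triangle
  have hcoord : ∀ z, P z - o = (cross (z - z₀) (zw - z₀) / C) • (P zv - o) +
      (cross (zv - z₀) (z - z₀) / C) • (P zw - o) := by
    intro z
    rw [ho', hP, planeChart_sub, planeChart_sub, planeChart_sub]
    have i1 : z.1 - z₀.1 = cross (z - z₀) (zw - z₀) / C * (zv.1 - z₀.1) +
        cross (zv - z₀) (z - z₀) / C * (zw.1 - z₀.1) := by
      field_simp; rw [hCdef]; simp only [cross, Prod.fst_sub, Prod.snd_sub]; ring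
    have i2 : z.2 - z₀.2 = cross (z - z₀) (zw - z₀) / C * (zv.2 - z₀.2) +
        cross (zv - z₀) (z - z₀) / C * (zw.2 - z₀.2) := by
      field_simp; rw [hCdef]; simp only [cross, Prod.fst_sub, Prod.snd_sub]; ring
    rw [i1, i2]
    module
  have hbv : frameMap o (P zv - o) = (Lv / N) • boost o (P zv) := by
    rw [boost, smul_smul, ← hNdef, ← hLvdef, div_mul_div_comm, mul_comm Lv, div_self (by positivity),
      one_smul]
  have hbw : frameMap o (P zw - o) = (Lw / N) • boost o (P zw) := by
    rw [boost, smul_smul, ← hNdef, ← hLwdef, div_mul_div_comm, mul_comm Lw, div_self (by positivity),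
      one_smul]
  have hspan : ∀ i j : ℝ, i • e₁ + j • e₂ = (cross (i, j) (zw - z₀) / C) • (P zv - o) +
      (cross (zv - z₀) (i, j) / C) • (P zw - o) := by
    intro i j
    have := hcoord (z₀ + (i, j))
    rw [ho', hP, planeChart_sub a e₁ e₂ (z₀ + (i, j)), add_sub_cancel_left] at this
    simpa using this
  have hindep : ∀ α β : ℝ, α • boost o (P zv) + β • (boost o (P zw) - boost o (P zv)) = 0 →
      α = 0 ∧ β = 0 := by
    intro α β h
    have h1 : frameMap o (((α - β) * (N / Lv)) • (P zv - o) + (β * (N / Lw)) • (P zw - o)) = 0 := by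
      rw [map_add, map_smul, map_smul, hbv, hbw, smul_smul, smul_smul]
      have i1 : (α - β) * (N / Lv) * (Lv / N) = α - β := by field_simp
      have i2 : β * (N / Lw) * (Lw / N) = β := by field_simp
      rw [i1, i2, ← h]; module
    have h2 := frameMap_injective ho (h1.trans (map_zero _).symm)
    rw [ho', hP, planeChart_sub, planeChart_sub] at h2
    set x := (α - β) * (N / Lv) with hx
    set y := β * (N / Lw) with hy
    have h3 : (x * (zv.1 - z₀.1) + y * (zw.1 - z₀.1)) • e₁ +
        (x * (zv.2 - z₀.2) + y * (zw.2 - z₀.2)) • e₂ = 0 := by rw [← h2]; module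
    obtain ⟨h4, h5⟩ := LinearIndependent.pair_iff.1 hli _ _ h3
    have hx0 : x = 0 := by
      apply mul_right_cancel₀ hC
      rw [hCdef]; simp only [cross, Prod.fst_sub, Prod.snd_sub]
      linear_combination (zw.2 - z₀.2) * h4 - (zw.1 - z₀.1) * h5
    have hy0 : y = 0 := by
      apply mul_right_cancel₀ hC
      rw [hCdef]; simp only [cross, Prod.fst_sub, Prod.snd_sub]
      linear_combination (zv.1 - z₀.1) * h5 - (zv.2 - z₀.2) * h4
    have hβ : β = 0 := (mul_eq_zero.1 hy0).resolve_right (by positivity)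
    have hα := (mul_eq_zero.1 hx0).resolve_right (by positivity)
    exact ⟨by linarith, hβ⟩
  -- With `b₂` along the boosted edge its endpoints become `(c, s₁)` and `(c, s₁ + σ)`, as in
  -- `lintegral_triangle_add_sector`.
  obtain ⟨b₁, b₂, c, s₁, σ, hc, hσ, h11, h12, h22, hdiff, hv'⟩ := exists_orthonormal_pair hindep
  have h21 : inner ℝ b₂ b₁ = (0 : ℝ) := by rw [real_inner_comm, h12]
  set s₂ := s₁ + σ with hs₂
  have hs : s₁ < s₂ := by linarith
  have hw' : boost o (P zw) = c • b₁ + s₂ • b₂ := by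
    rw [← sub_add_cancel (boost o (P zw)) (boost o (P zv)), hdiff, hv', hs₂]; module
  have hframe : IsFrame a e₁ e₂ o b₁ b₂ := by
    refine ⟨ho, ⟨z₀, rfl⟩, hli, h11, h12, h22, ?_, ?_⟩
    · have := hspan 1 0
      rw [one_smul, zero_smul, add_zero] at this
      rw [this, map_add, map_smul, map_smul, hbv, hbw, hv', hw']
      exact ⟨cross (1, 0) (zw - z₀) / C * (Lv / N) * c + cross (zv - z₀) (1, 0) / C * (Lw / N) * c,
        cross (1, 0) (zw - z₀) / C * (Lv / N) * s₁ + cross (zv - z₀) (1, 0) / C * (Lw / N) * s₂,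
        by module⟩
    · have := hspan 0 1
      rw [one_smul, zero_smul, zero_add] at this
      rw [this, map_add, map_smul, map_smul, hbv, hbw, hv', hw']
      exact ⟨cross (0, 1) (zw - z₀) / C * (Lv / N) * c + cross (zv - z₀) (0, 1) / C * (Lw / N) * c,
        cross (0, 1) (zw - z₀) / C * (Lv / N) * s₁ + cross (zv - z₀) (0, 1) / C * (Lw / N) * s₂,
        by module⟩
  have nv : ‖boost o (P zv)‖ ^ 2 = c ^ 2 + s₁ ^ 2 := by
    rw [← real_inner_self_eq_norm_sq, hv']
    simp only [inner_smul_right, inner_smul_left, inner_add_right, inner_add_left, h11, h12, h22,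
      h21, RCLike.conj_to_real]
    ring
  have nw : ‖boost o (P zw)‖ ^ 2 = c ^ 2 + s₂ ^ 2 := by
    rw [← real_inner_self_eq_norm_sq, hw']
    simp only [inner_smul_right, inner_smul_left, inner_add_right, inner_add_left, h11, h12, h22,
      h21, RCLike.conj_to_real]
    ring
  have nvw : inner ℝ (boost o (P zv)) (boost o (P zw)) = c ^ 2 + s₁ * s₂ := by
    rw [hv', hw']
    simp only [inner_smul_right, inner_smul_left, inner_add_right, inner_add_left, h11, h12, h22,
      h21, RCLike.conj_to_real]
    ring
  have a1 := hypAngle_eq_edgeAngle ho hv hw hc hs nv nw nvw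
  -- The angle at the other end, by the reflection that reverses the sign of the second coordinate.
  have a2 := hypAngle_eq_edgeAngle ho hw hv hc (neg_lt_neg hs) (by rw [nw]; ring) (by rw [nv]; ring)
    (by rw [real_inner_comm, nvw]; ring)
  rw [edgeAngle_neg] at a2
  have hsum : Real.pi - hypAngle (P zv) o (P zw) - hypAngle (P zw) o (P zv) =
      edgeAngle c s₂ - edgeAngle c s₁ := by rw [a1, a2]; ring
  have hle : ∀ {z}, ‖P z‖ ≤ 1 → ‖boost o (P z)‖ ^ 2 ≤ 1 := by
    intro z hz
    have h1 := norm_boost_sq ho (one_sub_inner_pos ho hz).ne'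
    have h2 : 0 ≤ 1 - ‖P z‖ ^ 2 := by nlinarith [norm_nonneg (P z)]
    have h3 := one_sub_inner_pos ho hz
    have : 0 ≤ 1 - ‖boost o (P z)‖ ^ 2 := by rw [h1]; positivity
    linarith
  rw [hsum]
  refine ⟨sub_nonneg.2 (edgeAngle_mono hc hs.le), ?_⟩
  rw [← lintegral_triangle_add_sector hc hs (by rw [← nv]; exact hle hv) (by rw [← nw]; exact hle hw)]
  have M0 : MeasurableSet {y : ℝ × ℝ | s₁ * y.1 < c * y.2 ∧ c * y.2 < s₂ * y.1} :=
    .setOf_and (measurableSet_lt (by fun_prop) (by fun_prop))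
      (measurableSet_lt (by fun_prop) (by fun_prop))
  rw [← hframe.lintegral_preimage (M0.setOf_and (measurableSet_lt (by fun_prop) (by fun_prop))),
    ← hframe.lintegral_preimage (M0.setOf_and (measurableSet_lt (by fun_prop) (by fun_prop)))]
  have hW := measurableSet_inWedge (zv - z₀) (zw - z₀) z₀
  have hT : MeasurableSet {z | 0 < cross (zw - zv) (z - zv) * C} :=
    measurableSet_lt measurable_const ((continuous_cross_left _ _).mul continuous_const).measurable
  have hD := measurableSet_areaDisk a e₁ e₂ o
  rw [planeArea_apply (hW.setOf_and hT), planeArea_apply (hW.inter hD)]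
  -- description of the wedge in the disk
  have key : ∀ z, ‖P z‖ < 1 →
      (InWedge (zv - z₀) (zw - z₀) (z - z₀) ↔
        s₁ * (diskCoord o b₁ b₂ (P z)).1 < c * (diskCoord o b₁ b₂ (P z)).2 ∧
        c * (diskCoord o b₁ b₂ (P z)).2 < s₂ * (diskCoord o b₁ b₂ (P z)).1) ∧
      (0 < cross (zw - zv) (z - zv) * C ↔ (diskCoord o b₁ b₂ (P z)).1 < c) := by
    intro z hz
    have hL := one_sub_inner_pos ho hz.le
    have hLz := hcoord z
    set α := cross (z - z₀) (zw - z₀) / C with hα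
    set β := cross (zv - z₀) (z - z₀) / C with hβ
    have hαC : cross (z - z₀) (zw - z₀) = α * C := (div_mul_cancel₀ _ hC).symm
    have hβC : cross (zv - z₀) (z - z₀) = β * C := (div_mul_cancel₀ _ hC).symm
    -- The denominator is an affine function, so it is expanded in the barycentric coordinates `1 -
    -- α - β`, `α`, `β`. Each inequality in the disk then becomes positivity of one of them.
    have hLform : 1 - inner ℝ o (P z) = (1 - α - β) * N + α * Lv + β * Lw := by
      have : inner ℝ o (P z - o) = α * inner ℝ o (P zv - o) + β * inner ℝ o (P zw - o) := by
        rw [hLz, inner_add_right, inner_smul_right, inner_smul_right]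
      simp only [inner_sub_right, real_inner_self_eq_norm_sq] at this
      rw [hLvdef, hLwdef, hNdef]
      linear_combination -this
    have hbz : boost o (P z) = ((α * Lv + β * Lw) * c / (1 - inner ℝ o (P z))) • b₁ +
        ((α * Lv * s₁ + β * Lw * s₂) / (1 - inner ℝ o (P z))) • b₂ := by
      rw [boost, ← hNdef, hLz, map_add, map_smul, map_smul, hbv, hbw, hv', hw']
      have i1 : (α * Lv + β * Lw) * c / (1 - inner ℝ o (P z)) =
        N / (1 - inner ℝ o (P z)) * (α * (Lv / N) * c + β * (Lw / N) * c) := by field_simp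
      have i2 : (α * Lv * s₁ + β * Lw * s₂) / (1 - inner ℝ o (P z)) =
        N / (1 - inner ℝ o (P z)) * (α * (Lv / N) * s₁ + β * (Lw / N) * s₂) := by field_simp
      rw [i1, i2]
      module
    have y1 : (diskCoord o b₁ b₂ (P z)).1 = (α * Lv + β * Lw) * c / (1 - inner ℝ o (P z)) := by
      rw [diskCoord, hbz]; simp only [inner_add_right, inner_smul_right, h11, h12]; ring
    have y2 : (diskCoord o b₁ b₂ (P z)).2 =
        (α * Lv * s₁ + β * Lw * s₂) / (1 - inner ℝ o (P z)) := by
      rw [diskCoord, hbz]; simp only [inner_add_right, inner_smul_right, h22, h21]; ring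
    have hCC : 0 < C * C := mul_self_pos.2 hC
    have w1 : 0 < cross (zv - z₀) (z - z₀) * C ↔ 0 < β := by
      rw [hβC, mul_assoc, mul_pos_iff_of_pos_right hCC]
    have w2 : 0 < cross (z - z₀) (zw - z₀) * C ↔ 0 < α := by
      rw [hαC, mul_assoc, mul_pos_iff_of_pos_right hCC]
    have w3 : 0 < cross (zw - zv) (z - zv) * C ↔ 0 < 1 - α - β := by
      have : cross (zw - zv) (z - zv) = (1 - α - β) * C := by
        have i : cross (zw - zv) (z - zv) = C - cross (z - z₀) (zw - z₀) -
            cross (zv - z₀) (z - z₀) := by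
          rw [hCdef]; simp only [cross, Prod.fst_sub, Prod.snd_sub]; ring
        rw [i, hαC, hβC]; ring
      rw [this, mul_assoc, mul_pos_iff_of_pos_right hCC]
    rw [InWedge, ← hCdef, w1, w2, w3, y1, y2]
    have j1 : s₁ * ((α * Lv + β * Lw) * c / (1 - inner ℝ o (P z))) <
        c * ((α * Lv * s₁ + β * Lw * s₂) / (1 - inner ℝ o (P z))) ↔ 0 < β := by
      rw [← sub_pos]
      have : c * ((α * Lv * s₁ + β * Lw * s₂) / (1 - inner ℝ o (P z))) -
        s₁ * ((α * Lv + β * Lw) * c / (1 - inner ℝ o (P z))) =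
        β * (c * Lw * σ / (1 - inner ℝ o (P z))) := by rw [hs₂]; field_simp; ring
      rw [this, mul_pos_iff_of_pos_right (by positivity)]
    have j2 : c * ((α * Lv * s₁ + β * Lw * s₂) / (1 - inner ℝ o (P z))) <
        s₂ * ((α * Lv + β * Lw) * c / (1 - inner ℝ o (P z))) ↔ 0 < α := by
      rw [← sub_pos]
      have : s₂ * ((α * Lv + β * Lw) * c / (1 - inner ℝ o (P z))) -
        c * ((α * Lv * s₁ + β * Lw * s₂) / (1 - inner ℝ o (P z))) =
        α * (c * Lv * σ / (1 - inner ℝ o (P z))) := by rw [hs₂]; field_simp; ring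
      rw [this, mul_pos_iff_of_pos_right (by positivity)]
    have j3 : (α * Lv + β * Lw) * c / (1 - inner ℝ o (P z)) < c ↔ 0 < 1 - α - β := by
      rw [div_lt_iff₀ hL, ← sub_pos]
      have : c * (1 - inner ℝ o (P z)) - (α * Lv + β * Lw) * c = (1 - α - β) * (c * N) := by
        rw [hLform]; ring
      rw [this, mul_pos_iff_of_pos_right (by positivity)]
    rw [j1, j2, j3]
    exact ⟨Iff.rfl, Iff.rfl⟩
  congr 3
  · ext z
    simp only [Set.mem_ofPred_eq]
    rw [and_comm]
    refine and_congr_right fun hz => ?_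
    rw [(key z hz).1, (key z hz).2]
  · ext z
    simp only [Set.mem_ofPred_eq, Set.mem_inter_iff, areaDisk]
    rw [and_comm]
    refine and_congr_right fun hz => ?_
    rw [(key z hz).1, hframe.norm_boost_sq hz.le]

/-! ### Gauss-Bonnet by coning from the barycentre. -/

/-- The sum of `‖x u - o‖ ^ 2` equals that of `‖x u‖ ^ 2 - ‖o‖ ^ 2`, and it is positive if two
points differ. So the apex of the cone is a finite point even when all vertices are infinite. -/
theorem norm_barycentre_lt_one {ι E : Type*} [NormedAddCommGroup E] [InnerProductSpace ℝ E]
    {A : Finset ι} {x : ι → E} (hx : ∀ v ∈ A, ‖x v‖ ≤ 1)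
    (hne : ∃ v ∈ A, ∃ w ∈ A, x v ≠ x w) : ‖barycentre A x‖ < 1 := by
  obtain ⟨v, hv, w, hw, hvw⟩ := hne
  have hA : A.Nonempty := ⟨v, hv⟩
  have hk : (0 : ℝ) < A.card := by exact_mod_cast hA.card_pos
  set o := barycentre A x with ho
  have h0 : ∑ u ∈ A, inner ℝ o (x u - o) = 0 := by
    rw [← inner_sum, sum_sub_barycentre hA, inner_zero_right]
  have h1 : ∑ u ∈ A, ‖x u - o‖ ^ 2 = ∑ u ∈ A, (‖x u‖ ^ 2 - ‖o‖ ^ 2) := by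
    have : ∀ u ∈ A, ‖x u - o‖ ^ 2 = (‖x u‖ ^ 2 - ‖o‖ ^ 2) - 2 * inner ℝ o (x u - o) := by
      intro u _
      rw [@norm_sub_sq_real, inner_sub_right, real_inner_self_eq_norm_sq, real_inner_comm]
      ring
    rw [Finset.sum_congr rfl this, Finset.sum_sub_distrib, ← Finset.mul_sum, h0]; ring
  have h2 : 0 < ∑ u ∈ A, ‖x u - o‖ ^ 2 := by
    refine Finset.sum_pos' (fun _ _ => sq_nonneg _) ?_
    by_contra! hc
    have h3 : ∀ u ∈ A, x u = o := fun u hu => by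
      have := le_antisymm (hc u hu) (sq_nonneg _)
      rw [pow_eq_zero_iff two_ne_zero, norm_eq_zero, sub_eq_zero] at this
      exact this
    exact hvw ((h3 v hv).trans (h3 w hw).symm)
  have h3 : ∑ u ∈ A, (‖x u‖ ^ 2 - ‖o‖ ^ 2) ≤ ∑ u ∈ A, (1 - ‖o‖ ^ 2) :=
    Finset.sum_le_sum fun u hu => by
      have := pow_le_one₀ (n := 2) (norm_nonneg _) (hx u hu)
      linarith
  rw [Finset.sum_const, nsmul_eq_mul] at h3
  have h4 : 0 < 1 - ‖o‖ ^ 2 := by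
    rw [h1] at h2
    exact (mul_pos_iff_of_pos_left hk).1 (h2.trans_le h3)
  rw [← sq_lt_one_iff₀ (norm_nonneg _)]
  linarith

theorem planeChart_barycentre {ι : Type*} {A : Finset ι} (hA : A.Nonempty) (a e₁ e₂ : Space3)
    (z : ι → ℝ × ℝ) : planeChart a e₁ e₂ (barycentre A z) =
      barycentre A fun v => planeChart a e₁ e₂ (z v) := by
  have hk : (A.card : ℝ) ≠ 0 := by exact_mod_cast hA.card_pos.ne'
  simp only [barycentre, planeChart, Finset.sum_add_distrib, Finset.sum_const, smul_add,
    ← Finset.sum_smul]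
  rw [← Nat.cast_smul_eq_nsmul ℝ, inv_smul_smul₀ hk, smul_smul, smul_smul]
  simp [Prod.fst_sum, Prod.snd_sum]

theorem barycentre_mem_convexHull {ι : Type*} {A : Finset ι} (hA : A.Nonempty) (z : ι → ℝ × ℝ) :
    barycentre A z ∈ convexHull ℝ (z '' (A : Set ι)) := by
  have hk : (0 : ℝ) < A.card := by exact_mod_cast hA.card_pos
  rw [barycentre, Finset.smul_sum]
  refine (convex_convexHull ℝ _).sum_mem (fun _ _ => by positivity) ?_
    fun v hv => subset_convexHull ℝ _ ⟨v, hv, rfl⟩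
  rw [Finset.sum_const, nsmul_eq_mul, mul_inv_cancel₀ hk.ne']

namespace IsWeakPolygon

variable {ι : Type*} {A : Finset ι} {N : ι → ι → Prop} {z : ι → ℝ × ℝ}

theorem cross_ne_zero (h : IsWeakPolygon A N z) {v w : ι} (hv : v ∈ A) (hw : w ∈ A) (hN : N v w) :
    cross (z v - barycentre A z) (z w - barycentre A z) ≠ 0 := by
  rw [← cross_sub_sub]; exact h.cross_barycentre_ne_zero v hv w hw hN

theorem cross_mul_nonneg_vertex (h : IsWeakPolygon A N z) {v w x : ι} (hv : v ∈ A) (hw : w ∈ A)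
    (hN : N v w) (hx : x ∈ A) :
    0 ≤ cross (z w - z v) (z x - z v) * cross (z w - z v) (barycentre A z - z v) := by
  have hA : A.Nonempty := ⟨v, hv⟩
  have hk : (0 : ℝ) < A.card := by exact_mod_cast hA.card_pos
  have h1 := Finset.sum_nonneg fun x' hx' => h.support v hv w hw hN x hx x' hx'
  rw [← Finset.mul_sum, sum_cross_eq hA, mul_left_comm] at h1
  exact (mul_nonneg_iff_of_pos_left hk).1 h1

theorem cross_mul_nonneg (h : IsWeakPolygon A N z) {v w : ι} (hv : v ∈ A) (hw : w ∈ A)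
    (hN : N v w) {y : ℝ × ℝ} (hy : y ∈ convexHull ℝ (z '' (A : Set ι))) :
    0 ≤ cross (z w - z v) (y - z v) * cross (z w - z v) (barycentre A z - z v) := by
  set C := cross (z w - z v) (barycentre A z - z v)
  have hsub : convexHull ℝ (z '' (A : Set ι)) ⊆
      {y | C * cross (z w - z v) (z v) ≤ (C • crossLinear (z w - z v)) y} := by
    refine convexHull_min ?_ (convex_halfSpace_ge (LinearMap.isLinear _) _)
    rintro _ ⟨x, hx, rfl⟩
    have := h.cross_mul_nonneg_vertex hv hw hN hx
    change C * cross (z w - z v) (z v) ≤ C * cross (z w - z v) (z x)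
    have e : cross (z w - z v) (z x - z v) = cross (z w - z v) (z x) - cross (z w - z v) (z v) :=
      map_sub (crossLinear (z w - z v)) _ _
    rw [e] at this
    linarith
  have h1 : C * cross (z w - z v) (z v) ≤ C * cross (z w - z v) y := hsub hy
  have e : cross (z w - z v) (y - z v) = cross (z w - z v) y - cross (z w - z v) (z v) :=
    map_sub (crossLinear (z w - z v)) _ _
  rw [e]
  linarith

theorem triangle_subset (h : IsWeakPolygon A N z) {v w : ι} (hv : v ∈ A) (hw : w ∈ A)
    (hN : N v w) {y : ℝ × ℝ}
    (hy : InWedge (z v - barycentre A z) (z w - barycentre A z) (y - barycentre A z))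
    (hy' : 0 < cross (z w - z v) (y - z v) *
      cross (z v - barycentre A z) (z w - barycentre A z)) :
    y ∈ convexHull ℝ (z '' (A : Set ι)) := by
  set o := barycentre A z with ho
  have hC := h.cross_ne_zero hv hw hN
  rw [← ho] at hC
  set C := cross (z v - o) (z w - o) with hCdef
  have hCC : 0 < C ^ 2 := by positivity
  obtain ⟨h1, h2⟩ := hy
  rw [← hCdef] at h1 h2
  have e1 : (1 - cross (y - o) (z w - o) * C / C ^ 2 - cross (z v - o) (y - o) * C / C ^ 2) =
      cross (z w - z v) (y - z v) * C / C ^ 2 := by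
    have : cross (z w - z v) (y - z v) = C - cross (y - o) (z w - o) - cross (z v - o) (y - o) := by
      rw [hCdef]; simp only [cross, Prod.fst_sub, Prod.snd_sub]; ring
    rw [this]; field_simp
  have e2 : y = (1 - cross (y - o) (z w - o) * C / C ^ 2 - cross (z v - o) (y - o) * C / C ^ 2) • o +
      (cross (y - o) (z w - o) * C / C ^ 2) • z v + (cross (z v - o) (y - o) * C / C ^ 2) • z w := by
    ext
    · simp only [Prod.fst_add, Prod.smul_fst, smul_eq_mul]
      field_simp
      rw [hCdef]; simp only [cross, Prod.fst_sub, Prod.snd_sub]; ring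
    · simp only [Prod.snd_add, Prod.smul_snd, smul_eq_mul]
      field_simp
      rw [hCdef]; simp only [cross, Prod.fst_sub, Prod.snd_sub]; ring
  have hmem := (convex_convexHull ℝ (z '' (A : Set ι))).sum_mem (t := Finset.univ)
    (w := ![1 - cross (y - o) (z w - o) * C / C ^ 2 - cross (z v - o) (y - o) * C / C ^ 2,
      cross (y - o) (z w - o) * C / C ^ 2, cross (z v - o) (y - o) * C / C ^ 2])
    (z := ![o, z v, z w]) ?_ ?_ ?_
  · rw [Fin.sum_univ_three] at hmem
    rw [e2]
    exact hmem
  · intro i _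
    fin_cases i
    · change 0 ≤ 1 - _ - _
      rw [e1]; positivity
    · change 0 ≤ cross (y - o) (z w - o) * C / C ^ 2
      positivity
    · change 0 ≤ cross (z v - o) (y - o) * C / C ^ 2
      positivity
  · rw [Fin.sum_univ_three]
    change 1 - cross (y - o) (z w - o) * C / C ^ 2 - cross (z v - o) (y - o) * C / C ^ 2 +
      cross (y - o) (z w - o) * C / C ^ 2 + cross (z v - o) (y - o) * C / C ^ 2 = 1
    ring
  · intro i _
    fin_cases i
    · exact barycentre_mem_convexHull ⟨v, hv⟩ z
    · exact subset_convexHull ℝ _ ⟨v, hv, rfl⟩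
    · exact subset_convexHull ℝ _ ⟨w, hw, rfl⟩

open Classical in
/-- The wedges over the edges, each edge taken twice, cover the plane twice. -/
theorem sum_measure_inter_wedge (h : IsWeakPolygon A N z)
    (hdeg : ∀ v ∈ A, ∃ w ∈ A, N v w) {μ : Measure (ℝ × ℝ)} (hμ : μ ≪ volume) (Y : Set (ℝ × ℝ)) :
    ∑ e ∈ (A ×ˢ A).filter (fun e => N e.1 e.2), μ (Y ∩
      {y | InWedge (z e.1 - barycentre A z) (z e.2 - barycentre A z) (y - barycentre A z)}) =
      2 * μ Y := by
  set o := barycentre A z with ho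
  set W : ι × ι → Set (ℝ × ℝ) := fun e => {y | InWedge (z e.1 - o) (z e.2 - o) (y - o)} with hW
  have hWm : ∀ e, MeasurableSet (W e) := fun e => measurableSet_inWedge _ _ _
  have h1 : ∀ e, μ (Y ∩ W e) = ∫⁻ y, (W e).indicator 1 y ∂(μ.restrict Y) := by
    intro e
    rw [lintegral_indicator_one (hWm e), Measure.restrict_apply (hWm e), Set.inter_comm]
  change ∑ e ∈ (A ×ˢ A).filter (fun e => N e.1 e.2), μ (Y ∩ W e) = 2 * μ Y
  simp_rw [h1]
  rw [← lintegral_finsetSum _ fun e _ => measurable_one.indicator (hWm e)]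
  -- The exceptional points lie on the lines joining the barycentre to the vertices, finitely many
  -- null sets.
  have hgen : ∀ᵐ y ∂(μ.restrict Y), ∀ v ∈ A, cross (y - o) (z v - o) ≠ 0 := by
    rw [Finset.eventually_all]
    intro v hv
    obtain ⟨w, hw, hN⟩ := hdeg v hv
    have hne : z v - o ≠ 0 := by
      intro h0
      have := h.cross_ne_zero hv hw hN
      rw [← ho, h0] at this
      simp [cross] at this
    have h0 : μ {y | cross (z v - o) (y - o) = 0} = 0 := hμ (volume_line hne o)
    refine Measure.absolutelyContinuous_of_le Measure.restrict_le_self ?_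
    convert h0 using 2
    ext y
    simp only [Set.mem_compl_iff, Set.mem_ofPred_eq, not_not]
    have : cross (y - o) (z v - o) = - cross (z v - o) (y - o) := by simp only [cross]; ring
    rw [this, neg_eq_zero]
  have h2 : ∀ᵐ y ∂(μ.restrict Y),
      ∑ e ∈ (A ×ˢ A).filter (fun e => N e.1 e.2), (W e).indicator 1 y = (2 : ENNReal) := by
    filter_upwards [hgen] with y hy
    have hc := h.card_inWedge (y - o) hy
    simp only [Set.indicator_apply, Pi.one_apply]
    rw [Finset.sum_ite, Finset.sum_const_zero, add_zero, Finset.sum_const, nsmul_eq_mul, mul_one]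
    rw [← Set.ncard_coe_finset]
    have : (↑(((A ×ˢ A).filter (fun e => N e.1 e.2)).filter fun e => y ∈ W e) : Set (ι × ι)) =
        {e : ι × ι | e ∈ A ×ˢ A ∧ N e.1 e.2 ∧
          InWedge (z e.1 - barycentre A z) (z e.2 - barycentre A z) (y - o)} := by
      ext e
      rw [Finset.mem_coe, Finset.mem_filter, Finset.mem_filter, and_assoc]
      rfl
    rw [this, hc]
    norm_num
  rw [lintegral_congr_ae h2, lintegral_const, Measure.restrict_apply_univ]

open Classical in
/-- The Gauss-Bonnet formula for a hyperbolic polygon. -/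
theorem gauss_bonnet (h : IsWeakPolygon A N z)
    (hdeg : ∀ v ∈ A, (A.filter fun w => N v w).card = 2)
    {a e₁ e₂ : Space3} (hli : LinearIndependent ℝ ![e₁, e₂])
    (hnorm : ∀ v ∈ A, ‖planeChart a e₁ e₂ (z v)‖ ≤ 1) (ho : ‖planeChart a e₁ e₂ (barycentre A z)‖ < 1)
    {S : ℝ} (hS : 0 ≤ S)
    (harea : planeArea a e₁ e₂ (convexHull ℝ (z '' (A : Set ι))) = ENNReal.ofReal S) :
    ((A.card : ℝ) - 2) * Real.pi - S = ∑ v ∈ A, ∑ w ∈ A.filter (fun w => N v w),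
      hypAngle (planeChart a e₁ e₂ (z v)) (planeChart a e₁ e₂ (barycentre A z))
        (planeChart a e₁ e₂ (z w)) := by
  set P := planeChart a e₁ e₂ with hP
  set o := barycentre A z with hodef
  set K := convexHull ℝ (z '' (A : Set ι)) with hK
  have hdeg' : ∀ v ∈ A, ∃ w ∈ A, N v w := by
    intro v hv
    have : (A.filter fun w => N v w).Nonempty := by
      rw [← Finset.card_pos, hdeg v hv]; norm_num
    obtain ⟨w, hw⟩ := this
    exact ⟨w, (Finset.mem_filter.1 hw).1, (Finset.mem_filter.1 hw).2⟩
  set E := (A ×ˢ A).filter (fun e => N e.1 e.2) with hE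
  have hac := planeArea_absolutelyContinuous a e₁ e₂
  have hsumK := h.sum_measure_inter_wedge hdeg' hac K
  have hsumD := h.sum_measure_inter_wedge hdeg' hac (areaDisk a e₁ e₂ (P o))
  rw [harea] at hsumK
  rw [planeArea_areaDisk hli ho ⟨o, rfl⟩] at hsumD
  set W : ι × ι → Set (ℝ × ℝ) := fun e => {y | InWedge (z e.1 - o) (z e.2 - o) (y - o)} with hW
  set X : ι × ι → ℝ := fun e => Real.pi - hypAngle (P (z e.1)) (P o) (P (z e.2)) -
    hypAngle (P (z e.2)) (P o) (P (z e.1)) with hX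
  -- Within the wedge over an edge the polygon is the triangle over that edge, up to points of the
  -- edge line, which is null.
  have hedge : ∀ e ∈ E, 0 ≤ X e ∧ planeArea a e₁ e₂ (K ∩ W e) +
      planeArea a e₁ e₂ (areaDisk a e₁ e₂ (P o) ∩ W e) = ENNReal.ofReal (X e) := by
    rintro ⟨v, w⟩ he
    obtain ⟨he1, hN⟩ := Finset.mem_filter.1 he
    obtain ⟨hv, hw⟩ := Finset.mem_product.1 he1
    simp only at hv hw hN
    have hC := h.cross_ne_zero hv hw hN
    obtain ⟨h1, h2⟩ := planeArea_triangle_add_sector hli ho (hnorm v hv) (hnorm w hw) hC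
    refine ⟨h1, ?_⟩
    rw [← h2, Set.inter_comm (areaDisk a e₁ e₂ (P o))]
    congr 1
    apply le_antisymm
    · have hsub : K ∩ W (v, w) ⊆ {y | InWedge (z v - o) (z w - o) (y - o) ∧
          0 < cross (z w - z v) (y - z v) * cross (z v - o) (z w - o)} ∪
          {y | cross (z w - z v) (y - z v) = 0} := by
        rintro y ⟨hyK, hyW⟩
        by_cases h0 : cross (z w - z v) (y - z v) = 0
        · exact Or.inr h0
        · left
          refine ⟨hyW, ?_⟩
          have h3 := h.cross_mul_nonneg hv hw hN hyK
          rw [cross_sub_sub (z v) (z w) (barycentre A z)] at h3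
          exact lt_of_le_of_ne h3 (mul_ne_zero h0 hC).symm
      have hwv : z w - z v ≠ 0 := by
        intro h0
        have := h.cross_barycentre_ne_zero v hv w hw hN
        rw [h0] at this
        simp [cross] at this
      refine (measure_mono hsub).trans ((measure_union_le _ _).trans ?_)
      rw [hac (volume_line hwv (z v)), add_zero]
    · exact measure_mono fun y hy => ⟨h.triangle_subset hv hw hN hy.1 hy.2, hy.1⟩
  -- Ordered pairs count every wedge twice, so both the area `S` and the area `2 π` of the disk are
  -- doubled.
  have htot : ENNReal.ofReal (2 * S + 4 * Real.pi) = ENNReal.ofReal (∑ e ∈ E, X e) := by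
    rw [ENNReal.ofReal_sum_of_nonneg fun e he => (hedge e he).1,
      ← Finset.sum_congr rfl fun e he => (hedge e he).2, Finset.sum_add_distrib, hsumK, hsumD,
      ENNReal.ofReal_add (by positivity) (by positivity), ENNReal.ofReal_mul (by norm_num),
      show (4 : ℝ) * Real.pi = 2 * (2 * Real.pi) by ring, ENNReal.ofReal_mul (p := 2) (by norm_num)]
    simp
  rw [ENNReal.ofReal_eq_ofReal_iff (by positivity)
    (Finset.sum_nonneg fun e he => (hedge e he).1)] at htot
  have hsumE : ∀ f : ι → ι → ℝ, ∑ e ∈ E, f e.1 e.2 =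
      ∑ v ∈ A, ∑ w ∈ A.filter (fun w => N v w), f v w := by
    intro f
    rw [hE, Finset.sum_filter, Finset.sum_product]
    exact Finset.sum_congr rfl fun v _ => by rw [Finset.sum_filter]
  have hswap : ∑ e ∈ E, hypAngle (P (z e.2)) (P o) (P (z e.1)) =
      ∑ e ∈ E, hypAngle (P (z e.1)) (P o) (P (z e.2)) := by
    refine Finset.sum_bij' (fun e _ => e.swap) (fun e _ => e.swap) ?_ ?_ ?_ ?_ ?_
    · intro e he
      simp only [hE, Finset.mem_filter, Finset.mem_product, Prod.fst_swap, Prod.snd_swap] at he ⊢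
      exact ⟨⟨he.1.2, he.1.1⟩, h.symm _ _ he.2⟩
    · intro e he
      simp only [hE, Finset.mem_filter, Finset.mem_product, Prod.fst_swap, Prod.snd_swap] at he ⊢
      exact ⟨⟨he.1.2, he.1.1⟩, h.symm _ _ he.2⟩
    · intro e _; exact e.swap_swap
    · intro e _; exact e.swap_swap
    · intro e _; rfl
  have hpi : ∑ e ∈ E, Real.pi = 2 * A.card * Real.pi := by
    rw [hsumE fun _ _ => Real.pi]
    have : ∀ v ∈ A, ∑ w ∈ A.filter (fun w => N v w), Real.pi = 2 * Real.pi := fun v hv => by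
      rw [Finset.sum_const, hdeg v hv]; simp
    rw [Finset.sum_congr rfl this, Finset.sum_const, nsmul_eq_mul]; ring
  simp only [hX] at htot
  rw [Finset.sum_sub_distrib, Finset.sum_sub_distrib, hswap, hpi,
    hsumE fun v w => hypAngle (P (z v)) (P o) (P (z w))] at htot
  linarith

end IsWeakPolygon

/-! ### The spherical polygon inequality at a vertex. -/

/-- In a pseudometric, a chain of edges whose boundary modulo two consists of two points is at
least as long as the distance of the two points; in case of equality it is geodesic. -/
theorem chain_length {ι κ : Type*} [DecidableEq ι] {d : ι → ι → ℝ}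
    (htri : ∀ x y z, d x z ≤ d x y + d y z) (hsymm : ∀ x y, d x y = d y x)
    (hnonneg : ∀ x y, 0 ≤ d x y) (s t : κ → ι) (J : Finset κ) :
    ∀ u w, u ≠ w → (∀ a ∈ J, s a ≠ t a) →
      (∑ a ∈ J, (Pi.single (s a) 1 + Pi.single (t a) 1 : ι → ZMod 2) =
        Pi.single u 1 + Pi.single w 1) →
      d u w ≤ ∑ a ∈ J, d (s a) (t a) ∧
      (d u w = ∑ a ∈ J, d (s a) (t a) → (∀ a ∈ J, 0 < d (s a) (t a)) →
        (∀ a ∈ J, ∀ x, x = s a ∨ x = t a → x = u ∨ x = w ∨ d u w = d u x + d x w) ∧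
        ∃ u', 0 < d u u' ∧ ((∀ a ∈ J, ∀ x, x = s a ∨ x = t a → x = u ∨ x = w) ∨
          (d u w = d u u' + d u' w ∧ ∀ a ∈ J, ∀ x, x = s a ∨ x = t a →
            x = u ∨ x = u' ∨ x = w ∨ d u' w = d u' x + d x w))) := by
  classical
  induction J using Finset.strongInduction with
  | H J ih =>
  intro u w huw hst hb
  -- The boundary does not vanish at `u`, so some edge of the chain ends there. It is peeled off;
  -- with `u'` its other end, the remaining edges have boundary `u' + w`, or none if `u' = w`.
  obtain ⟨a, haJ, ha⟩ : ∃ a ∈ J, u = s a ∨ u = t a := by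
    by_contra! hc
    have h1 := congrFun hb u
    rw [Finset.sum_apply, Finset.sum_eq_zero] at h1
    · simp [huw] at h1
    · intro a ha
      simp [hc a ha]
  obtain ⟨u', hu', hsa, hend, hsingle⟩ : ∃ u', u ≠ u' ∧ d (s a) (t a) = d u u' ∧
      (∀ x, x = s a ∨ x = t a → x = u ∨ x = u') ∧
      (Pi.single (s a) 1 + Pi.single (t a) 1 : ι → ZMod 2) = Pi.single u 1 + Pi.single u' 1 := by
    rcases ha with rfl | rfl
    · exact ⟨t a, hst a haJ, rfl, fun x hx => hx, rfl⟩
    · exact ⟨s a, (hst a haJ).symm, hsymm _ _, fun x hx => hx.symm, add_comm _ _⟩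
  have hsub : J.erase a ⊂ J := Finset.erase_ssubset haJ
  have hsum : ∑ b ∈ J, d (s b) (t b) = d u u' + ∑ b ∈ J.erase a, d (s b) (t b) := by
    rw [← Finset.add_sum_erase J _ haJ, hsa]
  have hrest : 0 ≤ ∑ b ∈ J.erase a, d (s b) (t b) := Finset.sum_nonneg fun b _ => hnonneg _ _
  by_cases huw' : u' = w
  · subst huw'
    refine ⟨by linarith, fun heq hpos => ?_⟩
    -- The first edge already exhausts the length, and positivity leaves no room for others.
    have h0 : ∑ b ∈ J.erase a, d (s b) (t b) = 0 := by linarith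
    have hJ : ∀ b ∈ J, b = a := by
      intro b hb
      by_contra hba
      have h1 := (Finset.sum_eq_zero_iff_of_nonneg fun b _ => hnonneg (s b) (t b)).1 h0 b
        (Finset.mem_erase.2 ⟨hba, hb⟩)
      exact (hpos b hb).ne' h1
    have hall : ∀ b ∈ J, ∀ x, x = s b ∨ x = t b → x = u ∨ x = u' := by
      intro b hb x hx
      rw [hJ b hb] at hx
      exact hend x hx
    refine ⟨fun b hb x hx => ?_, u', ?_, Or.inl hall⟩
    · rcases hall b hb x hx with h | h
      · exact Or.inl h
      · exact Or.inr (Or.inl h)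
    · rw [← hsa]; exact hpos a haJ
  · have hb' : ∑ b ∈ J.erase a, (Pi.single (s b) 1 + Pi.single (t b) 1 : ι → ZMod 2) =
        Pi.single u' 1 + Pi.single w 1 := by
      rw [← Finset.add_sum_erase J _ haJ, hsingle] at hb
      funext x
      have := congrFun hb x
      simp only [Pi.add_apply] at this ⊢
      have key : ∀ a b c r : ZMod 2, a + b + r = a + c → r = b + c := by decide
      exact key _ _ _ _ this
    obtain ⟨hle, heq'⟩ := ih _ hsub u' w huw' (fun b hb => hst b (Finset.mem_of_mem_erase hb)) hb'
    have h1 := htri u u' w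
    refine ⟨by linarith, fun heq hpos => ?_⟩
    -- Equality overall forces equality both in the triangle inequality at `u'` and for the shorter
    -- chain.
    have e1 : d u w = d u u' + d u' w := by linarith
    have e2 : d u' w = ∑ b ∈ J.erase a, d (s b) (t b) := by linarith
    obtain ⟨hbt, -⟩ := heq' e2 fun b hb => hpos b (Finset.mem_of_mem_erase hb)
    have hall : ∀ b ∈ J, ∀ x, x = s b ∨ x = t b →
        x = u ∨ x = u' ∨ x = w ∨ d u' w = d u' x + d x w := by
      intro b hb x hx
      by_cases hba : b = a
      · subst hba
        rcases hend x hx with h | h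
        · exact Or.inl h
        · exact Or.inr (Or.inl h)
      · exact Or.inr (hbt b (Finset.mem_erase.2 ⟨hba, hb⟩) x hx)
    refine ⟨fun b hb x hx => ?_, u', ?_, Or.inr ⟨e1, hall⟩⟩
    · rcases hall b hb x hx with h | h | h | h
      · exact Or.inl h
      · rw [h]; exact Or.inr (Or.inr e1)
      · exact Or.inr (Or.inl h)
      · refine Or.inr (Or.inr (le_antisymm (htri _ _ _) ?_))
        have := htri u u' x
        linarith
    · rw [← hsa]; exact hpos a haJ

theorem mem_span_of_angle_eq_add {V : Type*} [NormedAddCommGroup V] [InnerProductSpace ℝ V]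
    {x y z : V} (hy : y ≠ 0) (hxz : InnerProductGeometry.angle x z ≠ Real.pi)
    (h : InnerProductGeometry.angle x z =
      InnerProductGeometry.angle x y + InnerProductGeometry.angle y z) :
    ∃ α β : ℝ, α • x + β • z = y := by
  have h1 := ((InnerProductGeometry.angle_eq_angle_add_angle_iff hy).1 h).resolve_left hxz
  obtain ⟨α, β, e⟩ := Submodule.mem_span_pair.1 h1
  exact ⟨α, β, e⟩

theorem coplanar_image_of_coords {n : ℕ} {p : Fin n → Space3} {v : Fin n} {s : Set (Fin n)}
    (g h : Space3) (hs : ∀ x ∈ s, ∃ α β : ℝ, α • g + β • h = p x - p v) :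
    Coplanar ℝ (p '' insert v s) := by
  classical
  rw [coplanar_iff_finrank_le_two]
  rw [vectorSpan_eq_span_vsub_set_right ℝ (Set.mem_image_of_mem p (Set.mem_insert v s))]
  have hle : Submodule.span ℝ ((· -ᵥ p v) '' (p '' insert v s)) ≤ Submodule.span ℝ {g, h} := by
    rw [Submodule.span_le]
    rintro _ ⟨_, ⟨x, hx, rfl⟩, rfl⟩
    rcases hx with rfl | hx
    · simp
    · obtain ⟨α, β, e⟩ := hs x hx
      simp only [vsub_eq_sub, SetLike.mem_coe]
      rw [← e]
      exact Submodule.mem_span_pair.2 ⟨α, β, rfl⟩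
  refine (Submodule.finrank_mono hle).trans ?_
  have := finrank_span_finset_le_card (R := ℝ) ({g, h} : Finset Space3)
  rw [Finset.coe_pair] at this
  exact this.trans Finset.card_le_two

/-- The polygon inequality for the face angles at a vertex. -/
theorem IsNondegPolyhedron.vertex_inequality {n m : ℕ} {q : Fin n → Space3}
    {F : Fin m → Finset (Fin n)} (hq : IsNondegPolyhedron q F) {p : Fin n → Space3}
    (hp : Function.Injective p) {v : Fin n} {i : Fin m} (hv : v ∈ F i) {T : Space3 →ₗ[ℝ] Space3}
    (hT : Function.Injective T) {θ : Fin m → ℝ}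
    (hθ : ∀ a, v ∈ F a → ∀ w₁ ∈ F a, ∀ w₂ ∈ F a, IsEdge F v w₁ → IsEdge F v w₂ → w₁ ≠ w₂ →
      θ a = InnerProductGeometry.angle (T (p w₁ - p v)) (T (p w₂ - p v))) :
    θ i ≤ ∑ a ∈ (Finset.univ.erase i).filter (fun a => v ∈ F a), θ a ∧
    ((∀ a, v ∈ F a → 0 < θ a) → ¬ Coplanar ℝ (p '' insert v {w | IsEdge F v w}) →
      θ i < ∑ a ∈ (Finset.univ.erase i).filter (fun a => v ∈ F a), θ a) := by
  classical
  have hex : ∀ a, ∃ e : Fin n × Fin n, v ∈ F a →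
      e.1 ≠ e.2 ∧ (F a).filter (fun w => IsEdge F v w) = {e.1, e.2} := by
    intro a
    by_cases ha : v ∈ F a
    · obtain ⟨x, y, hxy, e⟩ := Finset.card_eq_two.1 (hq.card_edges_of_mem_facet ha)
      exact ⟨(x, y), fun _ => ⟨hxy, e⟩⟩
    · exact ⟨(v, v), fun h => absurd h ha⟩
  choose e he using hex
  -- The distance of two vertices as seen from `p v`, after the linear map `T`. With `T = frameMap
  -- (p v)` it is the hyperbolic angle.
  set d : Fin n → Fin n → ℝ := fun x y =>
    InnerProductGeometry.angle (T (p x - p v)) (T (p y - p v)) with hd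
  have hmem : ∀ a, v ∈ F a → ∀ w, (w = (e a).1 ∨ w = (e a).2) ↔ w ∈ F a ∧ IsEdge F v w := by
    intro a ha w
    rw [← Finset.mem_filter (p := fun w => IsEdge F v w), (he a ha).2, Finset.mem_insert,
      Finset.mem_singleton]
  have hθd : ∀ a, v ∈ F a → θ a = d (e a).1 (e a).2 := by
    intro a ha
    have h1 := (hmem a ha (e a).1).1 (Or.inl rfl)
    have h2 := (hmem a ha (e a).2).1 (Or.inr rfl)
    exact hθ a ha _ h1.1 _ h2.1 h1.2 h2.2 (he a ha).1
  set J := (Finset.univ.erase i).filter (fun a => v ∈ F a) with hJ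
  have hJmem : ∀ a, a ∈ J ↔ a ≠ i ∧ v ∈ F a := fun a => by simp [hJ]
  -- A neighbour `w` of `v` is an end of exactly the two facets containing the edge, any other `w`
  -- of none. Modulo two the boundary of all facets at `v` is zero.
  have hcount : ∀ w, ∑ a ∈ Finset.univ.filter (fun a => v ∈ F a),
      ((Pi.single (e a).1 1 + Pi.single (e a).2 1 : Fin n → ZMod 2) w) = 0 := by
    intro w
    have h1 : ∀ a ∈ Finset.univ.filter (fun a => v ∈ F a),
        ((Pi.single (e a).1 1 + Pi.single (e a).2 1 : Fin n → ZMod 2) w) =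
          if w ∈ F a ∧ IsEdge F v w then 1 else 0 := by
      intro a ha
      have ha := (Finset.mem_filter.1 ha).2
      rw [if_congr (hmem a ha w).symm rfl rfl]
      have hne := (he a ha).1
      simp only [Pi.add_apply, Pi.single_apply]
      by_cases h1 : w = (e a).1
      · have h2 : w ≠ (e a).2 := fun h => hne (h1.symm.trans h)
        rw [if_pos h1, if_neg h2, if_pos (Or.inl h1), add_zero]
      · by_cases h2 : w = (e a).2
        · rw [if_neg h1, if_pos h2, if_pos (Or.inr h2), zero_add]
        · rw [if_neg h1, if_neg h2, if_neg (not_or.2 ⟨h1, h2⟩), add_zero]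
    rw [Finset.sum_congr rfl h1]
    by_cases hw : IsEdge F v w
    · simp only [hw, and_true]
      rw [Finset.sum_ite, Finset.sum_const_zero, add_zero, Finset.sum_const, Finset.filter_filter,
        hq.card_facets_of_isEdge hw]
      decide
    · simp [hw]
  have hJi : Finset.univ.filter (fun a => v ∈ F a) = insert i J := by
    ext a
    rw [Finset.mem_insert, hJmem, Finset.mem_filter]
    by_cases hai : a = i
    · simp [hai, hv]
    · simp [hai]
  have hiJ : i ∉ J := fun h => ((hJmem i).1 h).1 rfl
  have hb : ∑ a ∈ J, (Pi.single (e a).1 1 + Pi.single (e a).2 1 : Fin n → ZMod 2) =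
      Pi.single (e i).1 1 + Pi.single (e i).2 1 := by
    funext w
    have h1 := hcount w
    rw [hJi, Finset.sum_insert hiJ] at h1
    rw [Finset.sum_apply]
    have key : ∀ a b : ZMod 2, a + b = 0 → b = a := by decide
    exact key _ _ h1
  have hchain := chain_length (d := d)
    (fun x y z => InnerProductGeometry.angle_le_angle_add_angle _ _ _)
    (fun x y => InnerProductGeometry.angle_comm _ _)
    (fun x y => InnerProductGeometry.angle_nonneg _ _) (fun a => (e a).1) (fun a => (e a).2) J
    (e i).1 (e i).2 (he i hv).1 (fun a ha => (he a ((hJmem a).1 ha).2).1) hb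
  have hsumθ : ∑ a ∈ J, θ a = ∑ a ∈ J, d (e a).1 (e a).2 :=
    Finset.sum_congr rfl fun a ha => hθd a ((hJmem a).1 ha).2
  rw [hsumθ, hθd i hv]
  refine ⟨hchain.1, fun hpos hnc => lt_of_le_of_ne hchain.1 fun heq => hnc ?_⟩
  obtain ⟨hbt, u', hu', hpeel⟩ := hchain.2 heq fun a ha => by
    have := ((hJmem a).1 ha).2
    rw [← hθd a this]; exact hpos a this
  -- every edge at the vertex belongs to the chain
  have hcover : ∀ w, IsEdge F v w → ∃ a ∈ J, w = (e a).1 ∨ w = (e a).2 := by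
    intro w hw
    obtain ⟨a, b, hab, hF⟩ := Finset.card_eq_two.1 (hq.card_facets_of_isEdge hw)
    have h1 : a ∈ Finset.univ.filter fun a => v ∈ F a ∧ w ∈ F a := by rw [hF]; simp
    have h2 : b ∈ Finset.univ.filter fun a => v ∈ F a ∧ w ∈ F a := by rw [hF]; simp
    have h1 := (Finset.mem_filter.1 h1).2
    have h2 := (Finset.mem_filter.1 h2).2
    by_cases hai : a = i
    · exact ⟨b, (hJmem b).2 ⟨fun h => hab (hai.trans h.symm), h2.1⟩,
        (hmem b h2.1 w).2 ⟨h2.2, hw⟩⟩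
    · exact ⟨a, (hJmem a).2 ⟨hai, h1.1⟩, (hmem a h1.1 w).2 ⟨h1.2, hw⟩⟩
  have hne : ∀ w, IsEdge F v w → T (p w - p v) ≠ 0 := by
    intro w hw h0
    have := hT (h0.trans (map_zero T).symm)
    exact hw.1 (hp (sub_eq_zero.1 this)).symm
  have hpull : ∀ x y z : Fin n, (∃ α β : ℝ, α • T (p x - p v) + β • T (p y - p v) = T (p z - p v)) →
      ∃ α β : ℝ, α • (p x - p v) + β • (p y - p v) = p z - p v := by
    rintro x y z ⟨α, β, h⟩
    exact ⟨α, β, hT (by rw [map_add, map_smul, map_smul, h])⟩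
  -- Between opposite directions every vector satisfies the equality of angles, so at `π` nothing
  -- follows about planes. There the point `u'` is used: once the first side is peeled off, the
  -- remaining ends are at an angle less than `π`, and the equality does place vectors in their
  -- span.
  by_cases hπ : d (e i).1 (e i).2 = Real.pi
  · rcases hpeel with hpeel | ⟨e1, hpeel⟩
    · refine coplanar_image_of_coords (p (e i).1 - p v) (p (e i).2 - p v) fun w hw => ?_
      obtain ⟨a, ha, hwa⟩ := hcover w hw
      rcases hpeel a ha w hwa with rfl | rfl
      · exact ⟨1, 0, by simp⟩
      · exact ⟨0, 1, by simp⟩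
    · refine coplanar_image_of_coords (p u' - p v) (p (e i).2 - p v) fun w hw => ?_
      obtain ⟨a, ha, hwa⟩ := hcover w hw
      rcases hpeel a ha w hwa with rfl | rfl | rfl | h
      · obtain ⟨-, r, -, hr⟩ := InnerProductGeometry.angle_eq_pi_iff.1
          ((InnerProductGeometry.angle_comm _ _).trans hπ)
        exact hpull _ _ _ ⟨0, r, by rw [hr]; simp⟩
      · exact ⟨1, 0, by simp⟩
      · exact ⟨0, 1, by simp⟩
      · refine hpull _ _ _ (mem_span_of_angle_eq_add (hne w hw) ?_ h)
        have : d u' (e i).2 < Real.pi := by rw [← hπ, e1]; linarith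
        exact this.ne
  · refine coplanar_image_of_coords (p (e i).1 - p v) (p (e i).2 - p v) fun w hw => ?_
    obtain ⟨a, ha, hwa⟩ := hcover w hw
    rcases hbt a ha w hwa with rfl | rfl | h
    · exact ⟨1, 0, by simp⟩
    · exact ⟨0, 1, by simp⟩
    · exact hpull _ _ _ (mem_span_of_angle_eq_add (hne w hw) hπ h)

/-! ### The angles of the facets of a limit polyhedron. -/

/-- As `L` is defined on all of space, it also projects the facets of the approximating polyhedra,
which need not lie in the plane of the chart. -/
theorem exists_chart_leftInverse {e₁ e₂ : Space3} (hli : LinearIndependent ℝ ![e₁, e₂])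
    (a : Space3) : ∃ L : Space3 →ₗ[ℝ] ℝ × ℝ, ∀ z, L (planeChart a e₁ e₂ z - a) = z := by
  set J : ℝ × ℝ →ₗ[ℝ] Space3 :=
    (LinearMap.fst ℝ ℝ ℝ).smulRight e₁ + (LinearMap.snd ℝ ℝ ℝ).smulRight e₂ with hJ
  have hJz : ∀ z, J z = z.1 • e₁ + z.2 • e₂ := fun z => by simp [hJ]
  obtain ⟨L, hL⟩ := LinearMap.exists_leftInverse_of_injective J (by
    rw [LinearMap.ker_eq_bot']
    intro z hz
    rw [hJz] at hz
    obtain ⟨h1, h2⟩ := LinearIndependent.pair_iff.1 hli _ _ hz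
    exact Prod.ext h1 h2)
  refine ⟨L, fun z => ?_⟩
  have : planeChart a e₁ e₂ z - a = J z := by rw [hJz, planeChart]; abel
  rw [this]
  exact LinearMap.congr_fun hL z

theorem planeChart_injective {e₁ e₂ : Space3} (hli : LinearIndependent ℝ ![e₁, e₂]) (a : Space3) :
    Function.Injective (planeChart a e₁ e₂) := by
  obtain ⟨L, hL⟩ := exists_chart_leftInverse hli a
  intro z z' h
  rw [← hL z, ← hL z', h]

theorem planeChart_preimage_convexHull {a e₁ e₂ : Space3} (hli : LinearIndependent ℝ ![e₁, e₂])
    (s : Set (ℝ × ℝ)) :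
    planeChart a e₁ e₂ ⁻¹' convexHull ℝ (planeChart a e₁ e₂ '' s) = convexHull ℝ s := by
  set f : ℝ × ℝ →ᵃ[ℝ] Space3 := ((LinearMap.fst ℝ ℝ ℝ).smulRight e₁ +
    (LinearMap.snd ℝ ℝ ℝ).smulRight e₂).toAffineMap + AffineMap.const ℝ (ℝ × ℝ) a with hf
  have hfe : planeChart a e₁ e₂ = f := by
    funext z; simp [hf, planeChart]; abel
  rw [hfe, ← AffineMap.image_convexHull, Set.preimage_image_eq]
  rw [← hfe]
  exact planeChart_injective hli a

theorem volume_convexHull_of_collinear {ι : Type*} {A : Finset ι} {z : ι → ℝ × ℝ}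
    (h : ∀ a ∈ A, ∀ b ∈ A, ∀ c ∈ A, cross (z b - z a) (z c - z a) = 0) :
    volume (convexHull ℝ (z '' (A : Set ι))) = 0 := by
  rcases A.eq_empty_or_nonempty with rfl | ⟨a, ha⟩
  · simp
  obtain ⟨u, hu, hc⟩ : ∃ u : ℝ × ℝ, u ≠ 0 ∧ ∀ c ∈ A, cross u (z c - z a) = 0 := by
    by_cases hb : ∃ b ∈ A, z b ≠ z a
    · obtain ⟨b, hb, hne⟩ := hb
      exact ⟨z b - z a, sub_ne_zero.2 hne, h a ha b hb⟩
    · push Not at hb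
      exact ⟨(1, 0), by simp, fun c hc => by rw [hb c hc]; simp [cross]⟩
  refine measure_mono_null ?_ (volume_line hu (z a))
  have e : ∀ y, cross u (y - z a) = crossLinear u y - crossLinear u (z a) := fun y =>
    map_sub (crossLinear u) _ _
  have hset : {y | cross u (y - z a) = 0} = {y | crossLinear u y = crossLinear u (z a)} := by
    ext y; rw [Set.mem_ofPred_eq, Set.mem_ofPred_eq, e, sub_eq_zero]
  rw [hset]
  refine convexHull_min ?_ (convex_hyperplane (LinearMap.isLinear _) _)
  rintro _ ⟨c, hc', rfl⟩
  have := hc c hc'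
  rw [e, sub_eq_zero] at this
  exact this

/-- Additivity of angles, for a vector between two others or on one side of a straight angle. -/
theorem angle_add_of_linear_combination {V : Type*} [NormedAddCommGroup V]
    [InnerProductSpace ℝ V] {x y z : V} (hx : x ≠ 0) (hy : y ≠ 0) {κ μ ν : ℝ} (hκ : 0 ≤ κ) (hμ : 0 < μ)
    (hν : 0 < ν) (h : κ • y = μ • x + ν • z) :
    InnerProductGeometry.angle x z =
      InnerProductGeometry.angle x y + InnerProductGeometry.angle y z := by
  rw [InnerProductGeometry.angle_eq_angle_add_angle_iff hy]
  rcases hκ.lt_or_eq with hκ | rfl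
  · right
    rw [Submodule.mem_span_pair]
    refine ⟨⟨κ⁻¹ * μ, by positivity⟩, ⟨κ⁻¹ * ν, by positivity⟩, ?_⟩
    change (κ⁻¹ * μ) • x + (κ⁻¹ * ν) • z = y
    rw [mul_smul, mul_smul, ← smul_add, ← h, inv_smul_smul₀ hκ.ne']
  · left
    rw [zero_smul] at h
    have hz : z = (-(μ / ν)) • x := by
      have h1 : ν • z = -(μ • x) := (neg_eq_of_add_eq_zero_right h.symm).symm
      rw [← inv_smul_smul₀ hν.ne' z, h1, smul_neg, smul_smul, neg_smul]
      congr 2; field_simp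
    exact InnerProductGeometry.angle_eq_pi_iff.2
      ⟨hx, _, neg_neg_of_pos (div_pos hμ hν), hz⟩

/-- With edge vectors `a`, `b` and `d` pointing to the barycentre, Cramer's rule times `cross a d`
writes a multiple of `d` through `a` and `b`. Its coefficients have the right signs by `support` and
`opposite`; that of `d` vanishes exactly at a straight angle. A zero angle would make `d` parallel
to `a`. -/
theorem IsWeakPolygon.angle_add {ι V : Type*} [NormedAddCommGroup V] [InnerProductSpace ℝ V]
    {A : Finset ι} {N : ι → ι → Prop} {z : ι → ℝ × ℝ} (h : IsWeakPolygon A N z)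
    {G : ℝ × ℝ →ₗ[ℝ] V} (hG : Function.Injective G) {v w₁ w₂ : ι} (hv : v ∈ A) (hw₁ : w₁ ∈ A)
    (hw₂ : w₂ ∈ A) (hN₁ : N v w₁) (hN₂ : N v w₂) (hne : w₁ ≠ w₂) :
    InnerProductGeometry.angle (G (z w₁ - z v)) (G (z w₂ - z v)) =
        InnerProductGeometry.angle (G (z w₁ - z v)) (G (barycentre A z - z v)) +
          InnerProductGeometry.angle (G (barycentre A z - z v)) (G (z w₂ - z v)) ∧
      0 < InnerProductGeometry.angle (G (z w₁ - z v)) (G (z w₂ - z v)) := by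
  have h1 := h.cross_mul_nonneg_vertex hv hw₁ hN₁ hw₂
  have h2 := h.opposite v hv w₁ hw₁ w₂ hw₂ hN₁ hN₂ hne
  have h3 := h.cross_barycentre_ne_zero v hv w₁ hw₁ hN₁
  set a := z w₁ - z v
  set b := z w₂ - z v
  set d := barycentre A z - z v
  have ha : a ≠ 0 := by rintro h0; exact h3 (by rw [h0]; simp [cross])
  have hd : d ≠ 0 := by rintro h0; exact h3 (by rw [h0]; simp [cross])
  have hadd := angle_add_of_linear_combination (x := G a) (y := G d) (z := G b)
    ((map_ne_zero_iff G hG).2 ha) ((map_ne_zero_iff G hG).2 hd) h1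
    (μ := cross d b * cross a d) (ν := cross a d ^ 2)
    (by have : cross d b * cross a d = -(cross a d * cross b d) := by simp only [cross]; ring
        rw [this]; exact neg_pos.2 h2)
    (by positivity) (by
      rw [← map_smul, ← map_smul, ← map_smul, ← map_add]
      congr 1
      ext <;> simp [cross] <;> ring)
  refine ⟨hadd, lt_of_le_of_ne (InnerProductGeometry.angle_nonneg _ _) fun h0 => ?_⟩
  rw [← h0] at hadd
  have h4 : InnerProductGeometry.angle (G a) (G d) = 0 := by
    linarith [InnerProductGeometry.angle_nonneg (G a) (G d),
      InnerProductGeometry.angle_nonneg (G d) (G b)]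
  obtain ⟨-, r, -, hr⟩ := InnerProductGeometry.angle_eq_zero_iff.1 h4
  rw [← map_smul] at hr
  refine h3 ?_
  rw [hG hr, cross_smul_right, cross_same, mul_zero]

theorem exists_noncollinear {ι : Type*} {A : Finset ι} {a e₁ e₂ : Space3} {z : ι → ℝ × ℝ}
    (h : planeArea a e₁ e₂ (convexHull ℝ (z '' (A : Set ι))) ≠ 0) :
    ∃ a ∈ A, ∃ b ∈ A, ∃ c ∈ A, cross (z b - z a) (z c - z a) ≠ 0 := by
  by_contra! hc
  exact h (planeArea_absolutelyContinuous _ _ _ (volume_convexHull_of_collinear hc))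

/-- A chart of the plane of a polygon, with the coordinates of the vertices. -/
theorem HasHypArea.exists_chart {n : ℕ} {p : Fin n → Space3} {A : Finset (Fin n)} {S : ℝ}
    (h : HasHypArea (polygonOf p A) S) :
    ∃ (a e₁ e₂ : Space3) (L : Space3 →ₗ[ℝ] ℝ × ℝ), LinearIndependent ℝ ![e₁, e₂] ∧
      (∀ v ∈ A, planeChart a e₁ e₂ (L (p v - a)) = p v) ∧
      planeArea a e₁ e₂ (convexHull ℝ ((fun v => L (p v - a)) '' (A : Set (Fin n)))) =
        ENNReal.ofReal S := by
  obtain ⟨-, a, e₁, e₂, hli, hsub, hS⟩ := h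
  obtain ⟨L, hL⟩ := exists_chart_leftInverse hli a
  have hv : ∀ v ∈ A, planeChart a e₁ e₂ (L (p v - a)) = p v := fun v hv => by
    obtain ⟨y, hy⟩ := hsub (subset_convexHull ℝ _ ⟨v, hv, rfl⟩)
    rw [← hy, hL]
  refine ⟨a, e₁, e₂, L, hli, hv, ?_⟩
  have hm : MeasurableSet (convexHull ℝ ((fun v => L (p v - a)) '' (A : Set (Fin n)))) :=
    ((A.finite_toSet.image _).isClosed_convexHull ℝ).measurableSet
  rw [planeArea_apply hm, ← hS, ← planeChart_preimage_convexHull hli (a := a), Set.image_image,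
    Set.image_congr hv]
  congr 2
  ext y
  simp [polygonOf]

/-- The angle at `v` is taken as Gauss-Bonnet delivers it, split by the ray to the barycentre. At a
finite vertex the two parts recombine by `IsWeakPolygon.angle_add`; at an infinite one both are zero
by convention. -/
theorem IsNondegPolyhedron.facet_angles {n m : ℕ} {p : Fin n → Space3}
    {F : Fin m → Finset (Fin n)} {q : ℕ → Fin n → Space3} (hq : ∀ t, IsNondegPolyhedron (q t) F)
    (hlim : ∀ v, Tendsto (fun t => q t v) atTop (𝓝 (p v))) (hp : Function.Injective p)
    (a : Fin m) {S : ℝ} (hS : HasHypArea (polygonOf p (F a)) S) (hpos : 0 < S) :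
    ∃ θ : Fin n → ℝ, (((F a).card : ℝ) - 2) * Real.pi - S = ∑ v ∈ F a, θ v ∧
      ∀ v ∈ F a, 0 ≤ θ v ∧ (‖p v‖ < 1 → 0 < θ v ∧ ∀ w₁ ∈ F a, ∀ w₂ ∈ F a,
        IsEdge F v w₁ → IsEdge F v w₂ → w₁ ≠ w₂ →
        θ v = InnerProductGeometry.angle (frameMap (p v) (p w₁ - p v))
          (frameMap (p v) (p w₂ - p v))) ∧ (¬ ‖p v‖ < 1 → θ v = 0) := by
  classical
  obtain ⟨a₀, e₁, e₂, L, hli, hz, harea⟩ := hS.exists_chart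
  set z : Fin n → ℝ × ℝ := fun v => L (p v - a₀) with hzdef
  have hLc : Continuous L := L.continuous_of_finiteDimensional
  have hnorm : ∀ v, ‖p v‖ ≤ 1 := fun v =>
    le_of_tendsto (hlim v).norm (Eventually.of_forall fun t => (hq t).norm_le_one v)
  have hnc := exists_noncollinear (A := F a) (a := a₀) (e₁ := e₁) (e₂ := e₂) (z := z) (by
    rw [harea]; exact (ENNReal.ofReal_pos.2 hpos).ne')
  have hylim : ∀ v ∈ F a, Tendsto (fun t => L (q t v - a₀)) atTop (𝓝 (z v)) := fun v _ =>
    (hLc.tendsto _).comp ((hlim v).sub_const a₀)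
  have hzinj : Set.InjOn z (F a) := fun v hv w hw hvw => hp (by
    rw [← hz v hv, ← hz w hw]; exact congrArg _ hvw)
  have hweak : IsWeakPolygon (F a) (IsEdge F) z := by
    -- Positive area provides three non-collinear vertices of the limit. They remain non-collinear
    -- in the projections of all late polyhedra, which are therefore strict polygons.
    refine IsWeakPolygon.of_tendsto (y := fun t v => L (q t v - a₀)) ?_ hylim hzinj hnc
    obtain ⟨b₀, hb₀, b₁, hb₁, b₂, hb₂, hne⟩ := hnc
    have hcr : Tendsto (fun t => cross (L (q t b₁ - a₀) - L (q t b₀ - a₀))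
        (L (q t b₂ - a₀) - L (q t b₀ - a₀))) atTop
        (𝓝 (cross (z b₁ - z b₀) (z b₂ - z b₀))) :=
      ((hylim b₁ hb₁).sub (hylim b₀ hb₀)).cross ((hylim b₂ hb₂).sub (hylim b₀ hb₀))
    filter_upwards [hcr.eventually_ne hne] with t ht
    refine (hq t).isStrictPolygon a L a₀ ⟨b₀, hb₀, b₁, hb₁, b₂, hb₂, ?_⟩
    rw [← map_sub, ← map_sub, sub_sub_sub_cancel_right, sub_sub_sub_cancel_right] at ht
    exact ht
  have hA : (F a).Nonempty := let ⟨b, hb, _⟩ := hnc; ⟨b, hb⟩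
  have ho : ‖planeChart a₀ e₁ e₂ (barycentre (F a) z)‖ < 1 := by
    rw [planeChart_barycentre hA]
    refine norm_barycentre_lt_one (fun v hv => by rw [hz v hv]; exact hnorm v) ?_
    obtain ⟨b₀, hb₀, b₁, hb₁, b₂, hb₂, hne⟩ := hnc
    refine ⟨b₁, hb₁, b₀, hb₀, fun h => hne ?_⟩
    rw [planeChart_injective hli a₀ h, sub_self]; simp [cross]
  have hdeg : ∀ v ∈ F a, ((F a).filter fun w => IsEdge F v w).card = 2 := fun v hv =>
    (hq 0).card_edges_of_mem_facet hv
  have hGB := hweak.gauss_bonnet (by convert hdeg) hli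
    (fun v hv => by rw [hz v hv]; exact hnorm v) ho hpos.le harea
  refine ⟨_, hGB, fun v hv => ⟨Finset.sum_nonneg fun w _ => ?_, fun hlt => ?_, fun hlt =>
    Finset.sum_eq_zero fun w _ => ?_⟩⟩
  · rw [hypAngle]; split_ifs
    exacts [InnerProductGeometry.angle_nonneg _ _, le_rfl]
  · set G : ℝ × ℝ →ₗ[ℝ] Space3 := frameMap (p v) ∘ₗ
      ((LinearMap.fst ℝ ℝ ℝ).smulRight e₁ + (LinearMap.snd ℝ ℝ ℝ).smulRight e₂) with hGdef
    have hGs : ∀ y y', G (y - y') =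
        frameMap (p v) (planeChart a₀ e₁ e₂ y - planeChart a₀ e₁ e₂ y') := fun y y' => by
      rw [planeChart_sub]; simp [hGdef]
    have hG : Function.Injective G := fun y y' hyy => by
      rw [← sub_eq_zero, ← map_sub, hGs] at hyy
      have := (map_eq_zero_iff _ (frameMap_injective hlt)).1 hyy
      exact planeChart_injective hli a₀ (sub_eq_zero.1 this)
    have key : ∀ w₁ ∈ F a, ∀ w₂ ∈ F a, IsEdge F v w₁ → IsEdge F v w₂ → w₁ ≠ w₂ →
        ∑ w ∈ (F a).filter (fun w => IsEdge F v w), hypAngle (planeChart a₀ e₁ e₂ (z v))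
          (planeChart a₀ e₁ e₂ (barycentre (F a) z)) (planeChart a₀ e₁ e₂ (z w)) =
        InnerProductGeometry.angle (frameMap (p v) (p w₁ - p v))
          (frameMap (p v) (p w₂ - p v)) ∧ 0 < InnerProductGeometry.angle
            (frameMap (p v) (p w₁ - p v)) (frameMap (p v) (p w₂ - p v)) := by
      intro w₁ hw₁ w₂ hw₂ he₁ he₂ hne
      have hpair : (F a).filter (fun w => IsEdge F v w) = {w₁, w₂} := by
        refine (Finset.eq_of_subset_of_card_le ?_ ?_).symm
        · intro w hw
          rw [Finset.mem_insert, Finset.mem_singleton] at hw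
          rcases hw with rfl | rfl
          exacts [Finset.mem_filter.2 ⟨hw₁, he₁⟩, Finset.mem_filter.2 ⟨hw₂, he₂⟩]
        · rw [hdeg v hv, Finset.card_pair hne]
      have hadd := hweak.angle_add hG hv hw₁ hw₂ he₁ he₂ hne
      rw [hGs, hGs, hGs, hz v hv, hz w₁ hw₁, hz w₂ hw₂] at hadd
      refine ⟨?_, hadd.2⟩
      rw [hpair, Finset.sum_pair hne, hz v hv, hz w₁ hw₁, hz w₂ hw₂, hypAngle, hypAngle,
        if_pos hlt, if_pos hlt, hadd.1, InnerProductGeometry.angle_comm]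
    obtain ⟨w₁, w₂, hne, hpair⟩ := Finset.card_eq_two.1 (hdeg v hv)
    have hw : ∀ w, w = w₁ ∨ w = w₂ → w ∈ F a ∧ IsEdge F v w := fun w hw => by
      rw [← Finset.mem_filter, hpair]; simpa using hw
    obtain ⟨hw₁, he₁⟩ := hw w₁ (Or.inl rfl)
    obtain ⟨hw₂, he₂⟩ := hw w₂ (Or.inr rfl)
    refine ⟨?_, fun w₁ hw₁ w₂ hw₂ he₁ he₂ hne => ?_⟩
    · obtain ⟨h1, h2⟩ := key w₁ hw₁ w₂ hw₂ he₁ he₂ hne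
      refine lt_of_lt_of_eq h2 (h1.symm.trans ?_)
      congr!
    · refine Eq.trans ?_ (key w₁ hw₁ w₂ hw₂ he₁ he₂ hne).1
      congr!
  · rw [hz v hv, hypAngle, if_neg hlt]

/-! ### Independence of the area from the chart. -/

theorem vectorSpan_eq_span_of_subset_chart {a e₁ e₂ : Space3} {X : Set Space3}
    (hsub : X ⊆ Set.range (planeChart a e₁ e₂)) (hX : Module.finrank ℝ (vectorSpan ℝ X) = 2) :
    vectorSpan ℝ X = Submodule.span ℝ {e₁, e₂} := by
  refine Submodule.eq_of_le_of_finrank_le ?_ ?_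
  · rw [vectorSpan_def, Submodule.span_le]
    rintro _ ⟨x, hx, y, hy, rfl⟩
    obtain ⟨s, rfl⟩ := hsub hx
    obtain ⟨t, rfl⟩ := hsub hy
    exact Submodule.mem_span_pair.2 ⟨_, _, (planeChart_sub _ _ _ _ _).symm⟩
  · rw [hX]
    have := finrank_span_finset_le_card (R := ℝ) ({e₁, e₂} : Finset Space3)
    rw [Finset.coe_pair] at this
    exact this.trans Finset.card_le_two

theorem IsFrame.of_span_eq {a e₁ e₂ a' e₁' e₂' o b₁ b₂ : Space3} (h : IsFrame a e₁ e₂ o b₁ b₂)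
    (hli : LinearIndependent ℝ ![e₁', e₂']) (ho : ∃ z, planeChart a' e₁' e₂' z = o)
    (hspan : Submodule.span ℝ {e₁', e₂'} = Submodule.span ℝ {e₁, e₂}) :
    IsFrame a' e₁' e₂' o b₁ b₂ := by
  have key : ∀ e ∈ Submodule.span ℝ {e₁', e₂'}, ∃ α β : ℝ, frameMap o e = α • b₁ + β • b₂ := by
    intro e he
    rw [hspan, Submodule.mem_span_pair] at he
    obtain ⟨s, t, rfl⟩ := he
    obtain ⟨α, β, h1⟩ := h.span₁
    obtain ⟨α', β', h2⟩ := h.span₂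
    refine ⟨s * α + t * α', s * β + t * β', ?_⟩
    rw [map_add, map_smul, map_smul, h1, h2]
    module
  exact ⟨h.norm_lt, ho, hli, h.inner₁₁, h.inner₁₂, h.inner₂₂,
    key _ (Submodule.subset_span (by simp)), key _ (Submodule.subset_span (by simp))⟩

/-- Positive area gives a point of `X` inside the ball. A frame at this point serves both charts,
since they parametrize the same plane, and both integrals become that of `diskDensity` over one set.
This is needed for the two coinciding facets of a doubly counted polygon. -/
theorem HasHypArea.unique {X : Set Space3} {S S' : ℝ} (h : HasHypArea X S) (h' : HasHypArea X S')
    (hpos : 0 < S) (hm : MeasurableSet X) (hX : Module.finrank ℝ (vectorSpan ℝ X) = 2) :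
    S = S' := by
  obtain ⟨hS0, a, e₁, e₂, hli, hsub, hS⟩ := h
  obtain ⟨hS0', a', e₁', e₂', hli', hsub', hS'⟩ := h'
  obtain ⟨o, hoX, hob⟩ : (X ∩ Metric.ball 0 1).Nonempty := by
    rw [Set.nonempty_iff_ne_empty]
    intro h0
    rw [h0, Set.preimage_empty, setLIntegral_empty] at hS
    exact (ENNReal.ofReal_pos.2 hpos).ne hS
  rw [mem_ball_zero_iff] at hob
  obtain ⟨b₁, b₂, hf⟩ := exists_isFrame hli hob (hsub hoX)
  have hf' : IsFrame a' e₁' e₂' o b₁ b₂ := hf.of_span_eq hli' (hsub' hoX) (by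
    rw [← vectorSpan_eq_span_of_subset_chart hsub hX, vectorSpan_eq_span_of_subset_chart hsub' hX])
  have key : ∀ {a e₁ e₂ : Space3}, IsFrame a e₁ e₂ o b₁ b₂ → X ⊆ Set.range (planeChart a e₁ e₂) →
      ∫⁻ y in diskCoord o b₁ b₂ '' (X ∩ Metric.ball 0 1), ENNReal.ofReal (diskDensity y) =
        ∫⁻ z in planeChart a e₁ e₂ ⁻¹' (X ∩ Metric.ball 0 1),
          ENNReal.ofReal (areaDensity (planeChart a e₁ e₂ z) e₁ e₂) := by
    intro a e₁ e₂ hf hsub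
    rw [← hf.lintegral_image ((hm.inter Metric.isOpen_ball.measurableSet).preimage
      (continuous_planeChart a e₁ e₂).measurable) fun z hz => mem_ball_zero_iff.1 hz.2,
      ← Set.image_image (diskCoord o b₁ b₂) (planeChart a e₁ e₂), Set.image_preimage_eq_of_subset
        (Set.inter_subset_left.trans hsub)]
  rw [← key hf hsub] at hS
  rw [← key hf' hsub', hS] at hS'
  exact (ENNReal.ofReal_eq_ofReal_iff hS0 hS0').1 hS'

/-! ### The inequality between the facets. -/

/-- Both sides become sums over vertices and are compared term by term. Only finite vertices of `F
i` have a positive term on the left, and there `vertex_inequality` applies. -/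
theorem IsNondegPolyhedron.area_inequality {n m : ℕ} {p : Fin n → Space3}
    {F : Fin m → Finset (Fin n)} {q : ℕ → Fin n → Space3} (hq : ∀ t, IsNondegPolyhedron (q t) F)
    (hlim : ∀ v, Tendsto (fun t => q t v) atTop (𝓝 (p v))) (hp : Function.Injective p)
    {S : Fin m → ℝ} (hS : ∀ j, HasHypArea (polygonOf p (F j)) (S j)) (hpos : ∀ j, 0 < S j)
    (i : Fin m) :
    (((F i).card : ℝ) - 2) * Real.pi - S i
        ≤ ∑ j ∈ Finset.univ.erase i, ((((F j).card : ℝ) - 2) * Real.pi - S j) ∧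
      ((∃ v : Fin n, ‖p v‖ < 1 ∧
          ¬ Coplanar ℝ (p '' (insert v {w : Fin n | IsEdge F v w}))) →
        (((F i).card : ℝ) - 2) * Real.pi - S i
          < ∑ j ∈ Finset.univ.erase i, ((((F j).card : ℝ) - 2) * Real.pi - S j)) := by
  classical
  choose θ hsum hθ using fun j =>
    IsNondegPolyhedron.facet_angles hq hlim hp j (hS j) (hpos j)
  set R : Fin n → ℝ := fun v => ∑ j ∈ (Finset.univ.erase i).filter (fun j => v ∈ F j), θ j v
  have hswap : ∑ j ∈ Finset.univ.erase i, ((((F j).card : ℝ) - 2) * Real.pi - S j) =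
      ∑ v, R v := by
    simp only [R, hsum, Finset.sum_filter]
    rw [Finset.sum_comm]
    refine Finset.sum_congr rfl fun j _ => ?_
    rw [← Finset.sum_filter, Finset.filter_mem_eq_inter, Finset.univ_inter]
  have hvert : ∀ v, ‖p v‖ < 1 → v ∈ F i → θ i v ≤ R v ∧
      (¬ Coplanar ℝ (p '' (insert v {w : Fin n | IsEdge F v w})) → θ i v < R v) := by
    intro v hv hvi
    -- Only incidences are taken from the polyhedron `q 0`; the angles are those of the limit.
    have := (hq 0).vertex_inequality hp hvi (T := frameMap (p v)) (frameMap_injective hv)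
      (θ := fun a => θ a v) fun a ha => ((hθ a v ha).2.1 hv).2
    exact ⟨this.1, this.2 fun a ha => ((hθ a v ha).2.1 hv).1⟩
  have hR : ∀ v, ∀ j ∈ (Finset.univ.erase i).filter (fun j => v ∈ F j), 0 ≤ θ j v :=
    fun v j hj => (hθ j v (Finset.mem_filter.1 hj).2).1
  have hle : ∀ v, (if v ∈ F i then θ i v else 0) ≤ R v := by
    intro v
    split_ifs with hvi
    · by_cases hv : ‖p v‖ < 1
      · exact (hvert v hv hvi).1
      · rw [(hθ i v hvi).2.2 hv]; exact Finset.sum_nonneg (hR v)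
    · exact Finset.sum_nonneg (hR v)
  have hleft : (((F i).card : ℝ) - 2) * Real.pi - S i = ∑ v, if v ∈ F i then θ i v else 0 := by
    rw [hsum, ← Finset.sum_filter, Finset.filter_mem_eq_inter, Finset.univ_inter]
  rw [hleft, hswap]
  refine ⟨Finset.sum_le_sum fun v _ => hle v, ?_⟩
  rintro ⟨v, hv, hnc⟩
  refine Finset.sum_lt_sum (fun v _ => hle v) ⟨v, Finset.mem_univ _, ?_⟩
  split_ifs with hvi
  · exact (hvert v hv hvi).2 hnc
  -- Away from `F i` the left term is zero, so one facet through `v` suffices for strictness. It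
  -- exists because a vertex without edges would be trivially coplanar with them.
  · obtain ⟨w, -, a, b, -, hab⟩ : {w | IsEdge F v w}.Nonempty := by
      rw [Set.nonempty_iff_ne_empty]
      intro h0
      rw [h0, insert_empty_eq, Set.image_singleton] at hnc
      exact hnc (coplanar_singleton ℝ _)
    have hva : v ∈ F a := Finset.mem_of_mem_inter_left (hab ▸ Finset.mem_insert_self v {w})
    refine Finset.sum_pos' (hR v) ⟨a, Finset.mem_filter.2 ⟨Finset.mem_erase.2
      ⟨fun h => hvi (h ▸ hva), Finset.mem_univ _⟩, hva⟩, ((hθ a v hva).2.1 hv).1⟩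

theorem IsDoublePolygon.coplanar {n m : ℕ} {p : Fin n → Space3} {F : Fin m → Finset (Fin n)}
    (h : IsDoublePolygon p F) (s : Set (Fin n)) : Coplanar ℝ (p '' s) := by
  rw [coplanar_iff_finrank_le_two]
  exact (Submodule.finrank_mono (vectorSpan_mono ℝ (Set.image_subset_range p s))).trans h.planar.le

theorem IsDoublePolygon.area_eq {n m : ℕ} {p : Fin n → Space3} {F : Fin m → Finset (Fin n)}
    (h : IsDoublePolygon p F) {S : Fin m → ℝ}
    (hS : ∀ j, HasHypArea (polygonOf p (F j)) (S j)) (hpos : ∀ j, 0 < S j) (i j : Fin m) :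
    S i = S j := by
  have hi := hS i
  have hj := hS j
  rw [h.facets] at hi hj
  refine hi.unique hj (hpos i)
    (((Finset.finite_toSet _).image p).isClosed_convexHull ℝ).measurableSet ?_
  rw [polygonOf, ← direction_affineSpan, affineSpan_convexHull, direction_affineSpan,
    Finset.coe_univ, Set.image_univ, h.planar]

theorem mainTheorem7 {n m : ℕ} (p : Fin n → Space3) (F : Fin m → Finset (Fin n))
    (hP : IsConvexPolyhedron p F) (S : Fin m → ℝ)
    (hS : ∀ j, HasHypArea (polygonOf p (F j)) (S j)) (hpos : ∀ j, 0 < S j) (i : Fin m) :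
    (((F i).card : ℝ) - 2) * Real.pi - S i
        ≤ ∑ j ∈ Finset.univ.erase i, ((((F j).card : ℝ) - 2) * Real.pi - S j) ∧
      ((∃ v : Fin n, ‖p v‖ < 1 ∧
          ¬ Coplanar ℝ (p '' (insert v {w : Fin n | IsEdge F v w}))) →
        (((F i).card : ℝ) - 2) * Real.pi - S i
          < ∑ j ∈ Finset.univ.erase i, ((((F j).card : ℝ) - 2) * Real.pi - S j)) := by
  rcases hP with ⟨hp, q, hq, hlim⟩ | hd
  · exact IsNondegPolyhedron.area_inequality hq hlim hp hS hpos i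
  -- For a doubly counted polygon the right side is the single, equal term of the other facet, and
  -- the strict case is void because all vertices are coplanar.
  · refine ⟨?_, fun ⟨v, _, hnc⟩ => (hnc (hd.coplanar _)).elim⟩
    rw [Finset.sum_congr rfl fun j _ => by rw [hd.area_eq hS hpos j i, hd.facets j, ← hd.facets i],
      Finset.sum_const, Finset.card_erase_of_mem (Finset.mem_univ i), Finset.card_univ,
      Fintype.card_fin, hd.card_facets]
    simp
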